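/- Let $\hbar>0$, let $l,m\ge 1$ be coprime integers, and let $\omega_1,\omega_2>0$. In $\mathcal L=L^2(\mathbb R^2)$, with the scalar product $(\cdot,\cdot)$ linear in the first argument, let $\mathbf b_j=(\omega_jx_j+\hbar\partial_j)/\sqrt{2\omega_j}$ and $\mathbf b_j^*=(\omega_jx_j-\hbar\partial_j)/\sqrt{2\omega_j}$ ($j=1,2$) be the annihilation and creation operators, acting on the Schwartz space $\mathcal S(\mathbb R^2)$, so that $[\mathbf b_j,\mathbf b_j^*]=\hbar$. Put $$\mathbf A_1=\mathbf b_1^*\mathbf b_1,\quad \mathbf A_2=\mathbf b_2^*\mathbf b_2,\quad \mathbf A_+=(\mathbf b_2^*)^l\mathbf b_1^m,\quad \mathbf A_-=\mathbf A_+^*=(\mathbf b_1^*)^m\mathbf b_2^l. \tag{1}$$ Let $\rho_+(A_1)=\prod_{j=1}^m(A_1+j\hbar)$, $\rho_-(A_2)=\prod_{s=1}^l(A_2-s\hbar+\hbar)$, $\rho=\rho_+\rho_-$. The resonance algebra $\mathfrak F_{l,m}$ is the complex unital algebra with generators $A_1,A_2,A_+,A_-$ and relations $$[A_1,A_2]=0,\quad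 [A_1,A_\pm]=\mp\hbar mA_\pm,\quad [A_2,A_\pm]=\pm\hbar lA_\pm,\quad [A_-,A_+]=\rho(A_1-\hbar m,A_2+\hbar l)-\rho(A_1,A_2).$$ For integers $r\ge0$, $0\le q\le l-1$, $0\le p\le m-1$ let $\mathcal P_{r,q,p}$ be the space of polynomials $\varphi(\bar z)=\sum_{n=0}^r\varphi_n\bar z^n$ with the scalar product $$(\varphi,\varphi')=\sum_{n=0}^r\hbar^{(l-m)n}\frac{(q+nl)!\,(p+(r-n)m)!}{q!\,(p+rm)!}\varphi_n\overline{\varphi'_n},$$ and on it, with $\bar\partial=\partial/\partial\bar z$, the operators $$\mathbf a_1=\hbar(rm+p)-\hbar m\bar z\bar\partial,\quad \mathbf a_2=\hbar q+\hbar l\bar z\bar\partial,\quad \mathbf a_+=\hbar^m\prod_{j=1}^m(rm+p+j-m\bar z\bar\partial)\cdot\bar z,\quad \mathbf a_-=\frac{\hbar^l}{\bar z}\prod_{s=1}^l(q-s+1+l\bar z\bar\partial). \tag{2}$$ Let $$k(x)=\sum_{n=0}^r\hbar^{(m-l)n}\frac{q!\,(p+rm)!}{(q+nl)!\,(p+(r-n)m)!}x^n,\qquad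 K(z)=k(|z|^2),\qquad K^\#(a|b)=k(\bar ab),$$ $g(x)=\hbar\frac{d}{dx}\bigl(x\frac{d}{dx}\ln k(x)\bigr)$, and $p_a(b)=|K^\#(a|b)|^2/(K(a)K(b))$. For $E>0$, $x>0$ let $\alpha_E(x)\in[-\frac E{2lm},\frac E{2lm}]$ be the solution of $x=(\frac E{2m}+l\alpha_E)^l(\frac E{2l}-m\alpha_E)^{-m}$, and put $A_1=\frac E{2l}-m\alpha_E(x)$, $A_2=\frac E{2m}+l\alpha_E(x)$, $$L=\frac1{\hbar^{rm+p+q+1}(p+rm)!\,q!\,x}\int_0^\infty A_1^{rm+p}A_2^q\Bigl(\frac{l^2}{A_2}+\frac{m^2}{A_1}\Bigr)^{-1}e^{-(A_1+A_2)/\hbar}\,dE,\qquad x=|z|^2.$$ The quantum reproducing measure on $\mathbb C$ is $dm=L\,K\,|d\bar z\wedge dz|$, where $|d\bar z\wedge dz|=2\,d\mathrm{Re}z\,d\mathrm{Im}z$. The phase space is the sphere $\Omega=\mathbb C\cup\{\infty\}$, and $\{\infty\}$ has measure $0$. A vacuum vector is $\mathfrak P_0\in\mathcal S(\mathbb R^2)$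 with $\|\mathfrak P_0\|=1$, $\mathbf A_1\mathfrak P_0=\hbar(rm+p)\mathfrak P_0$, $\mathbf A_2\mathfrak P_0=\hbar q\,\mathfrak P_0$, $\mathbf A_-\mathfrak P_0=0$. Given vacuum vectors for all $(r,q,p)$, the coherent states are $$\mathfrak P_z=\sum_{n=0}^r\frac{q!}{(q+ln)!}\Bigl(\frac z{\hbar^l}\Bigr)^n\mathbf A_+^n\mathfrak P_0,\quad z\in\mathbb C.$$ Let $\boldsymbol\Pi_z$ be the orthogonal projection onto $\mathbb C\,\mathfrak P_z$, $\boldsymbol\Pi_\infty$ the orthogonal projection onto $\mathbb C\,\mathbf A_+^r\mathfrak P_0$, and $\mathcal L_{r,q,p}$ the span of $\mathbf A_+^n\mathfrak P_0$, $n=0,\dots,r$. The Wick symbol of an operator $\mathbf f$ in $\mathcal P_{r,q,p}$ is $f(z)=\frac1{K(z)}\bigl(\mathbf f\,k(\cdot\,z)\bigr)(\bar z)$. Theorem. $\mathbf A_-$ and $\mathbf A_+$ are adjoint to each other on $\mathcal S(\mathbb R^2)$, the operators (1) on $\mathcal S(\mathbb R^2)$ and (2) on polynomials (leaving $\mathcal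 P_{r,q,p}$ invariant) define unique representations of $\mathfrak F_{l,m}$, vacuum vectors exist for all $(r,q,p)$, and for any choice of the vacuum vectors the following holds. (a) $(\mathfrak P_z,\mathfrak P_w)=K^\#(w|z)$ for all $z,w\in\mathbb C$. In particular $\|\mathfrak P_z\|^2=K(z)$. (b) $\frac1{2\pi\hbar}\int_\Omega\boldsymbol\Pi_z\,dm(z)=\mathbf I_{r,q,p}$, the orthogonal projection of $\mathcal L$ onto $\mathcal L_{r,q,p}$, with the integral absolutely convergent in operator norm. Moreover $\boldsymbol\Pi_z\to\boldsymbol\Pi_\infty$ in norm as $z\to\infty$. (c) $\mathcal L$ is the orthogonal Hilbert direct sum of the subspaces $\mathcal L_{r,q,p}$ ($r\ge0$, $0\le q\le l-1$, $0\le p\le m-1$), each of which is nonzero, invariant and irreducible under the operators (1). (d) The coherent transform $\nu:\mathcal L_{r,q,p}\to\mathcal P_{r,q,p}$, $\nu(\psi)(\bar z)=(\psi,\mathfrak P_z)$, has the inverse $$\nu^{-1}(\varphi)=\frac1{2\pi\hbar}\int_\Omega\frac{\mathfrak P_z\,\varphi(\bar z)}{K(z)}\,dm(z)$$ (an absolutely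 convergent integral), and $\nu$, $\nu^{-1}$ intertwine the representations of $\mathfrak F_{l,m}$ given by (1) on $\mathcal L_{r,q,p}$ and by (2) on $\mathcal P_{r,q,p}$. (e) Let $\mathbf F$ be the realization via (1) of an element of $\mathfrak F_{l,m}$, let $\mathbf f=\nu\circ\mathbf F\circ\nu^{-1}$, and let $f$ be the Wick symbol of $\mathbf f$. Then $f(z)=\operatorname{tr}(\mathbf F\boldsymbol\Pi_z)$ for $z\in\mathbb C$, and $f(z)\to\operatorname{tr}(\mathbf F\boldsymbol\Pi_\infty)$ as $z\to\infty$. Every element of $\mathfrak F_{l,m}$ can be written as a polynomial $F$ in the generators, ordered with $A_+$ on the left, then $A_1,A_2$, then $A_-$ on the right, and for each such polynomial $\mathbf F=F(\mathbf A)$, $\mathbf f=F(\mathbf a)$. The operator $\rho_+(\mathbf A_1)$ is injective on $\mathcal S(\mathbb R^2)$ and maps $\mathcal L_{r,q,p}$ onto itself. With $\mathbf z=\mathbf A_-\rho_+(\mathbf A_1)^{-1}$, $\mathbf z^*=\rho_+(\mathbf A_1)^{-1}\mathbf A_+$, the operator $\bar z$ of multiplication by $\bar z$, and its conjugate $\bar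 z^*$ in $\mathcal P_{r,q,p}$ (the operator determined by $(\bar z\varphi,\varphi')=(\varphi,\bar z^*\varphi')$, where the coefficient of $\bar z^{r+1}$ in $\bar z\varphi$ is ignored), the operators are reconstructed from the symbol by $$\mathbf F=f(\overset2{\mathbf z}{}^*,\overset1{\mathbf z})\ \text{ on }\mathcal L_{r,q,p},\qquad \mathbf f=f(\overset2{\bar z},\overset1{\bar z}{}^*);$$ that is, $f$ has an expansion $f=\sum_{j,k\ge0}c_{jk}\bar z^jz^k$ near $z=0$, and for any such expansion $\mathbf F\psi=\sum_{j,k}c_{jk}(\mathbf z^*)^j\mathbf z^k\psi$ for $\psi\in\mathcal L_{r,q,p}$ and $(\mathbf f\varphi)(\bar z)=\sum_{j,k}c_{jk}\bar z^j\bigl((\bar z^*)^k\varphi\bigr)(\bar z)$ for $\varphi\in\mathcal P_{r,q,p}$ and $z$ near $0$. Finally, the Wick symbol of the coherent projection $\boldsymbol\Pi_a$ is the probability function: $\operatorname{tr}(\boldsymbol\Pi_a\boldsymbol\Pi_b)=p_a(b)$, and $p_a$ is the Wick symbol of $\nu\circ\boldsymbol\Pi_a\circ\nu^{-1}$. Moreover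 $$p_a(b)=\exp\Bigl\{\frac i\hbar\int_\Sigma\omega\Bigr\},\qquad \omega=i\,g(\bar zz)\,d\bar z\wedge dz,$$ for every membrane $\Sigma=\{(\bar z,z)=(u(s),v(t)):0\le s,t\le1\}$, oriented by $ds\wedge dt$, in the complexified space with $C^1$ curves $u$ from $\bar a$ to $\bar b$ and $v$ from $a$ to $b$ such that $k(u(s)v(t))\ne0$ for all $s,t\in[0,1]$. -/

import Mathlib

open MeasureTheory Filter Topology Set
open scoped SchwartzMap Polynomial ComplexConjugate LineDeriv Nat InnerProductSpace

namespace Resonance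

noncomputable section

/-! ### The Hilbert space `L²(ℝ × ℝ)` and operators on it

All operators generated by the creation and annihilation operators act on the Schwartz space,
which is their common invariant dense domain in `L²(ℝ × ℝ)`. -/

/-- The Schwartz space on `ℝ × ℝ`. -/
abbrev Sch : Type := 𝓢(ℝ × ℝ, ℂ)

/-- The Hilbert space `L²(ℝ × ℝ)`. -/
abbrev L2 : Type := Lp ℂ 2 (volume : Measure (ℝ × ℝ))

/-- The (injective, dense) inclusion of the Schwartz space into `L²`. -/
def toL2 : Sch →ₗ[ℂ] L2 := (SchwartzMap.toLpCLM ℂ ℂ 2 (volume : Measure (ℝ × ℝ))).toLinearMap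

theorem toL2_injective : Function.Injective toL2 :=
  SchwartzMap.injective_toLp 2 (volume : Measure (ℝ × ℝ))

open Classical in
/-- The operator in `L²` with domain the Schwartz space that is given by `T : Sch → Sch`
(the value is set to `0` outside the domain). -/
def opL2 (T : Sch → Sch) (ψ : L2) : L2 :=
  if h : ∃ χ : Sch, toL2 χ = ψ then toL2 (T h.choose) else 0

theorem opL2_toL2 (T : Sch → Sch) (χ : Sch) : opL2 T (toL2 χ) = toL2 (T χ) := by
  have h : ∃ χ' : Sch, toL2 χ' = toL2 χ := ⟨χ, rfl⟩
  rw [opL2, dif_pos h, toL2_injective h.choose_spec]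

/-- Multiplication by the first coordinate. -/
def mulX1 : Module.End ℂ Sch :=
  (SchwartzMap.smulLeftCLM ℂ (fun x : ℝ × ℝ => (x.1 : ℂ))).toLinearMap

/-- Multiplication by the second coordinate. -/
def mulX2 : Module.End ℂ Sch :=
  (SchwartzMap.smulLeftCLM ℂ (fun x : ℝ × ℝ => (x.2 : ℂ))).toLinearMap

theorem mulX1_apply (f : Sch) (x : ℝ × ℝ) : mulX1 f x = x.1 * f x := by
  have h : Function.HasTemperateGrowth (fun x : ℝ × ℝ => (x.1 : ℂ)) :=
    (Complex.ofRealCLM ∘L ContinuousLinearMap.fst ℝ ℝ ℝ).hasTemperateGrowth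
  simp [mulX1, SchwartzMap.smulLeftCLM_apply_apply h]

theorem mulX2_apply (f : Sch) (x : ℝ × ℝ) : mulX2 f x = x.2 * f x := by
  have h : Function.HasTemperateGrowth (fun x : ℝ × ℝ => (x.2 : ℂ)) :=
    (Complex.ofRealCLM ∘L ContinuousLinearMap.snd ℝ ℝ ℝ).hasTemperateGrowth
  simp [mulX2, SchwartzMap.smulLeftCLM_apply_apply h]

/-- The derivative in the first coordinate. -/
def der1 : Module.End ℂ Sch :=
  (LineDeriv.lineDerivOpCLM ℂ Sch ((1, 0) : ℝ × ℝ)).toLinearMap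

/-- The derivative in the second coordinate. -/
def der2 : Module.End ℂ Sch :=
  (LineDeriv.lineDerivOpCLM ℂ Sch ((0, 1) : ℝ × ℝ)).toLinearMap

/-- The annihilation operator `(ω x₁ + ħ ∂₁) / √(2ω)` of the first oscillator. -/
def b1 (ħ ω : ℝ) : Module.End ℂ Sch :=
  ((1 / √(2 * ω) : ℝ) : ℂ) • ((ω : ℂ) • mulX1 + (ħ : ℂ) • der1)

/-- The creation operator `(ω x₁ - ħ ∂₁) / √(2ω)` of the first oscillator. -/
def b1s (ħ ω : ℝ) : Module.End ℂ Sch :=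
  ((1 / √(2 * ω) : ℝ) : ℂ) • ((ω : ℂ) • mulX1 - (ħ : ℂ) • der1)

/-- The annihilation operator `(ω x₂ + ħ ∂₂) / √(2ω)` of the second oscillator. -/
def b2 (ħ ω : ℝ) : Module.End ℂ Sch :=
  ((1 / √(2 * ω) : ℝ) : ℂ) • ((ω : ℂ) • mulX2 + (ħ : ℂ) • der2)

/-- The creation operator `(ω x₂ - ħ ∂₂) / √(2ω)` of the second oscillator. -/
def b2s (ħ ω : ℝ) : Module.End ℂ Sch :=
  ((1 / √(2 * ω) : ℝ) : ℂ) • ((ω : ℂ) • mulX2 - (ħ : ℂ) • der2)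

/-! ### The resonance algebra -/

/-- Names of the four generators `A₁, A₂, A₊, A₋`. -/
inductive Gen : Type
  | one
  | two
  | plus
  | minus

/-- `ρ₊` as a polynomial in `A₁`: `∏_{j=1}^m (A₁ + jħ)`. -/
def rhoPlusPoly (ħ : ℝ) (m : ℕ) : ℂ[X] :=
  ∏ j ∈ Finset.range m, (Polynomial.X + Polynomial.C (((j : ℂ) + 1) * (ħ : ℂ)))

/-- `ρ₋` as a polynomial in `A₂`: `∏_{s=1}^l (A₂ - sħ + ħ)`. -/
def rhoMinusPoly (ħ : ℝ) (l : ℕ) : ℂ[X] :=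
  ∏ s ∈ Finset.range l, (Polynomial.X - Polynomial.C ((s : ℂ) * (ħ : ℂ)))

/-- `ρ(A₁, A₂) = ρ₊(A₁) ρ₋(A₂)` for elements of a complex algebra. -/
def rho {B : Type*} [Ring B] [Algebra ℂ B] (ħ : ℝ) (l m : ℕ) (x y : B) : B :=
  Polynomial.aeval x (rhoPlusPoly ħ m) * Polynomial.aeval y (rhoMinusPoly ħ l)

/-- The free generators. -/
def fgen (g : Gen) : FreeAlgebra ℂ Gen := FreeAlgebra.ι ℂ g

/-- The commutation relations of the `l : m` resonance algebra. -/
inductive ResRel (ħ : ℝ) (l m : ℕ) : FreeAlgebra ℂ Gen → FreeAlgebra ℂ Gen → Prop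
  | comm12 : ResRel ħ l m ⁅fgen .one, fgen .two⁆ 0
  | comm1p : ResRel ħ l m ⁅fgen .one, fgen .plus⁆ ((-(ħ * m) : ℂ) • fgen .plus)
  | comm1m : ResRel ħ l m ⁅fgen .one, fgen .minus⁆ ((ħ * m : ℂ) • fgen .minus)
  | comm2p : ResRel ħ l m ⁅fgen .two, fgen .plus⁆ ((ħ * l : ℂ) • fgen .plus)
  | comm2m : ResRel ħ l m ⁅fgen .two, fgen .minus⁆ ((-(ħ * l) : ℂ) • fgen .minus)
  | commmp : ResRel ħ l m ⁅fgen .minus, fgen .plus⁆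
      (rho ħ l m (fgen .one - algebraMap ℂ _ (ħ * m)) (fgen .two + algebraMap ℂ _ (ħ * l))
        - rho ħ l m (fgen .one) (fgen .two))

/-- The abstract `l : m` resonance algebra. -/
abbrev ResAlg (ħ : ℝ) (l m : ℕ) : Type := RingQuot (ResRel ħ l m)

/-- The generators of the resonance algebra. -/
def gen (ħ : ℝ) (l m : ℕ) (g : Gen) : ResAlg ħ l m :=
  RingQuot.mkAlgHom ℂ (ResRel ħ l m) (fgen g)

/-- The value of the polynomial `P` on the generators `x`, ordered with `x₊` on the left, then
`x₁, x₂`, and `x₋` on the right. -/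
def ordEval {B : Type*} [Ring B] [Algebra ℂ B] (x : Gen → B) (P : MvPolynomial Gen ℂ) : B :=
  ∑ s ∈ P.support, P.coeff s •
    (x .plus ^ s .plus * x .one ^ s .one * x .two ^ s .two * x .minus ^ s .minus)

/-- The realization of the generators in `L²`: `A₁ = b₁* b₁`, `A₂ = b₂* b₂`,
`A₊ = (b₂*)^l b₁^m`, `A₋ = A₊* = (b₁*)^m b₂^l`. -/
def opA (ħ ω₁ ω₂ : ℝ) (l m : ℕ) : Gen → Module.End ℂ Sch
  | .one => b1s ħ ω₁ * b1 ħ ω₁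
  | .two => b2s ħ ω₂ * b2 ħ ω₂
  | .plus => b2s ħ ω₂ ^ l * b1 ħ ω₁ ^ m
  | .minus => b1s ħ ω₁ ^ m * b2 ħ ω₂ ^ l

/-! ### The representation by differential operators on polynomials

A polynomial `phi : ℂ[X]` stands for the antiholomorphic function `z ↦ phi.eval (conj z)`. -/

/-- The space `P_r` of polynomials of degree at most `r`. -/
abbrev Pol (r : ℕ) : Submodule ℂ ℂ[X] := Polynomial.degreeLE ℂ r

/-- Multiplication by the variable. -/
def mulVar : Module.End ℂ ℂ[X] := LinearMap.mulLeft ℂ (Polynomial.X : ℂ[X])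

/-- Division by the variable (used on polynomials without constant term only). -/
def divVar : Module.End ℂ ℂ[X] where
  toFun := Polynomial.divX
  map_add' _ _ := Polynomial.divX_add
  map_smul' c phi := by
    ext n
    simp [Polynomial.coeff_divX]

/-- The Euler operator `z̄ ∂/∂z̄`. -/
def euler : Module.End ℂ ℂ[X] := mulVar * Polynomial.derivative

/-- The operators `a₁, a₂, a₊, a₋` of the representation with labels `r, q, p`:
`a₁ = ħ(rm+p) - ħm z̄∂̄`, `a₂ = ħq + ħl z̄∂̄`, `a₊ = ħ^m ∏_{j=1}^m (rm+p+j - m z̄∂̄) ∘ z̄`,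
`a₋ = ħ^l z̄⁻¹ ∏_{s=1}^l (q-s+1 + l z̄∂̄)`. -/
def opPol (ħ : ℝ) (l m r q p : ℕ) : Gen → Module.End ℂ ℂ[X]
  | .one => (ħ * (r * m + p) : ℂ) • 1 - (ħ * m : ℂ) • euler
  | .two => (ħ * q : ℂ) • 1 + (ħ * l : ℂ) • euler
  | .plus => ((ħ : ℂ) ^ m) • (Polynomial.aeval euler
      (∏ j ∈ Finset.range m, (Polynomial.C ((r : ℂ) * m + p + (j + 1))
        - Polynomial.C (m : ℂ) * Polynomial.X)) * mulVar)
  | .minus => ((ħ : ℂ) ^ l) • (divVar * Polynomial.aeval euler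
      (∏ s ∈ Finset.range l, (Polynomial.C ((q : ℂ) - (s + 1) + 1)
        + Polynomial.C (l : ℂ) * Polynomial.X)))

theorem aeval_euler_coeff (P phi : ℂ[X]) (n : ℕ) :
    (Polynomial.aeval euler P phi).coeff n = P.eval (n : ℂ) * phi.coeff n := by
  have he : ∀ phi : ℂ[X], (euler phi).coeff n = (n : ℂ) * phi.coeff n := by
    intro phi
    cases n with
    | zero => simp [euler, mulVar]
    | succ k =>
      simp only [euler, mulVar, Module.End.mul_apply, LinearMap.mulLeft_apply,
        Polynomial.coeff_X_mul, Polynomial.coeff_derivative]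
      push_cast
      ring
  induction P using Polynomial.induction_on' generalizing phi with
  | add f g hf hg => simp [hf, hg, add_mul]
  | monomial k c =>
    induction k generalizing phi with
    | zero => simp [Module.algebraMap_end_apply]
    | succ k ih =>
      have h := ih (euler phi)
      simp only [Polynomial.aeval_monomial, Polynomial.eval_monomial, pow_succ,
        Module.End.mul_apply] at h ⊢
      rw [h, he]
      ring

/-- In the definition of `a₋` the division by the variable is exact. -/
theorem opPol_minus_exact {ħ : ℝ} {l q : ℕ} (m r p : ℕ) (hq : q < l) (phi : ℂ[X]) :
    mulVar (opPol ħ l m r q p .minus phi) = ((ħ : ℂ) ^ l) • Polynomial.aeval euler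
      (∏ s ∈ Finset.range l, (Polynomial.C ((q : ℂ) - (s + 1) + 1)
        + Polynomial.C (l : ℂ) * Polynomial.X)) phi := by
  ext n
  cases n with
  | zero =>
    have h0 : ∏ s ∈ Finset.range l, ((q : ℂ) - (s + 1) + 1) = 0 :=
      Finset.prod_eq_zero (Finset.mem_range.2 hq) (by ring)
    simp [mulVar, aeval_euler_coeff, Polynomial.eval_prod, h0]
  | succ k => simp [mulVar, opPol, divVar, Polynomial.coeff_divX]

/-- The weights `ħ^{(l-m)n} (q+nl)! (p+(r-n)m)! / (q! (p+rm)!)` of the scalar product of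
`P_{r,q,p}`. -/
def weight (ħ : ℝ) (l m r q p n : ℕ) : ℝ :=
  ħ ^ (((l : ℤ) - m) * n) * ((q + n * l)! * (p + (r - n) * m)!) / (q ! * (p + r * m)!)

/-- The scalar product of `P_{r,q,p}`, linear in the first argument. Only the coefficients up to
degree `r` enter. -/
def scal (ħ : ℝ) (l m r q p : ℕ) (phi phi' : ℂ[X]) : ℂ :=
  ∑ n ∈ Finset.range (r + 1), (weight ħ l m r q p n : ℂ) * phi.coeff n * conj (phi'.coeff n)

/-- The conjugate, in `P_{r,q,p}`, of the operator of multiplication by `z̄`. -/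
def mulVarAdj (ħ : ℝ) (l m r q p : ℕ) (phi : ℂ[X]) : ℂ[X] :=
  ∑ n ∈ Finset.range r, Polynomial.monomial n
    (((weight ħ l m r q p (n + 1) / weight ħ l m r q p n : ℝ) : ℂ) * phi.coeff (n + 1))

theorem mulVarAdj_spec {ħ : ℝ} (hħ : 0 < ħ) (l m r q p : ℕ) (phi phi' : ℂ[X]) :
    mulVarAdj ħ l m r q p phi' ∈ Pol r ∧
    scal ħ l m r q p (mulVar phi) phi' = scal ħ l m r q p phi (mulVarAdj ħ l m r q p phi') := by
  have hw : ∀ n, (weight ħ l m r q p n : ℂ) ≠ 0 := fun n => by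
    have : 0 < weight ħ l m r q p n := by unfold weight; positivity
    exact_mod_cast this.ne'
  constructor
  · refine Submodule.sum_mem _ fun n hn => ?_
    refine Polynomial.mem_degreeLE.2 ((Polynomial.degree_monomial_le _ _).trans ?_)
    exact_mod_cast (Finset.mem_range.1 hn).le
  · have hc : ∀ n ∈ Finset.range r, (mulVarAdj ħ l m r q p phi').coeff n =
        ((weight ħ l m r q p (n + 1) / weight ħ l m r q p n : ℝ) : ℂ) * phi'.coeff (n + 1) := by
      intro n hn
      simp only [mulVarAdj, Polynomial.finsetSum_coeff, Polynomial.coeff_monomial]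
      rw [Finset.sum_ite_eq' (Finset.range r) n, if_pos hn]
    have hr : (mulVarAdj ħ l m r q p phi').coeff r = 0 := by
      simp only [mulVarAdj, Polynomial.finsetSum_coeff, Polynomial.coeff_monomial]
      rw [Finset.sum_ite_eq' (Finset.range r) r, if_neg Finset.notMem_range_self]
    unfold scal
    rw [Finset.sum_range_succ', Finset.sum_range_succ, hr]
    simp only [mulVar, LinearMap.mulLeft_apply, Polynomial.coeff_X_mul, Polynomial.coeff_X_mul_zero,
      map_zero, mul_zero, zero_mul, add_zero]
    refine Finset.sum_congr rfl fun n hn => ?_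
    rw [hc n hn]
    simp only [map_mul, Complex.conj_ofReal]
    push_cast
    field_simp [hw n]

/-! ### The reproducing kernel, the quantum metric, the reproducing measure -/

/-- The coefficients `ħ^{(m-l)n} q! (p+rm)! / ((q+nl)! (p+(r-n)m)!)` of the reproducing kernel. -/
def kcoef (ħ : ℝ) (l m r q p n : ℕ) : ℝ :=
  ħ ^ (((m : ℤ) - l) * n) * (q ! * (p + r * m)!) / ((q + n * l)! * (p + (r - n) * m)!)

/-- The polynomial `k(x) = ∑_{n ≤ r} kcoef n * xⁿ`, as a function of a complex variable. -/
def kfun (ħ : ℝ) (l m r q p : ℕ) (x : ℂ) : ℂ :=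
  ∑ n ∈ Finset.range (r + 1), (kcoef ħ l m r q p n : ℂ) * x ^ n

/-- The reproducing kernel `K(z) = k(|z|²)`. -/
def Kern (ħ : ℝ) (l m r q p : ℕ) (z : ℂ) : ℝ :=
  ∑ n ∈ Finset.range (r + 1), kcoef ħ l m r q p n * (‖z‖ ^ 2) ^ n

/-- The analytic continuation `K#(a|b) = k(ā b)`, antiholomorphic in `a`, holomorphic in `b`. -/
def Ksharp (ħ : ℝ) (l m r q p : ℕ) (a b : ℂ) : ℂ := kfun ħ l m r q p (conj a * b)

/-- The quantum metric `g(x) = ħ d/dx (x d/dx ln k(x))`, continued to complex `x`. -/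
def qmetric (ħ : ℝ) (l m r q p : ℕ) (x : ℂ) : ℂ :=
  ħ * deriv (fun y => y * logDeriv (kfun ħ l m r q p) y) x

/-- The probability function `p_a(b) = |K#(a|b)|² / (K(a) K(b))`. -/
def prob (ħ : ℝ) (l m r q p : ℕ) (a b : ℂ) : ℝ :=
  ‖Ksharp ħ l m r q p a b‖ ^ 2 / (Kern ħ l m r q p a * Kern ħ l m r q p b)

/-- For `E > 0`, `x ≥ 0`: the unique `α ∈ [-E/(2lm), E/(2lm)]` with
`x = (E/(2m) + lα)^l (E/(2l) - mα)^{-m}`. -/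
def alpha (l m : ℕ) (E x : ℝ) : ℝ :=
  Classical.epsilon fun α : ℝ => α ∈ Icc (-(E / (2 * l * m))) (E / (2 * l * m)) ∧
    x * (E / (2 * l) - m * α) ^ m = (E / (2 * m) + l * α) ^ l

/-- `A₁` as a function of `E` and `x = |z|²` on the classical leaf. -/
def clA1 (l m : ℕ) (E x : ℝ) : ℝ := E / (2 * l) - m * alpha l m E x

/-- `A₂` as a function of `E` and `x = |z|²` on the classical leaf. -/
def clA2 (l m : ℕ) (E x : ℝ) : ℝ := E / (2 * m) + l * alpha l m E x

/-- The density `L`, as a function of `x = |z|²`. -/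
def dens (ħ : ℝ) (l m r q p : ℕ) (x : ℝ) : ℝ :=
  1 / (ħ ^ (r * m + p + q + 1) * (p + r * m)! * q ! * x) *
    ∫ E in Ioi (0 : ℝ), clA1 l m E x ^ (r * m + p) * clA2 l m E x ^ q *
      ((l : ℝ) ^ 2 / clA2 l m E x + (m : ℝ) ^ 2 / clA1 l m E x)⁻¹ *
      Real.exp (-(clA1 l m E x + clA2 l m E x) / ħ)

/-- The quantum reproducing measure `dm = L K da` with `da = |dz̄ ∧ dz| = 2 dRe z dIm z`, in the
complex coordinate on the phase space (a sphere, whose point `z = ∞` has measure zero). -/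
def dm (ħ : ℝ) (l m r q p : ℕ) : Measure ℂ :=
  ((2 : ENNReal) • (volume : Measure ℂ)).withDensity fun z =>
    ENNReal.ofReal (dens ħ l m r q p (‖z‖ ^ 2) * Kern ħ l m r q p z)

/-! ### Vacuum vectors, coherent states, the coherent transform -/

/-- `P0` is a (normalized) vacuum vector with labels `r, q, p`. -/
structure IsVacuum (ħ ω₁ ω₂ : ℝ) (l m r q p : ℕ) (P0 : Sch) : Prop where
  norm_one : ‖toL2 P0‖ = 1
  eig_one : opA ħ ω₁ ω₂ l m .one P0 = (ħ * (r * m + p) : ℂ) • P0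
  eig_two : opA ħ ω₁ ω₂ l m .two P0 = (ħ * q : ℂ) • P0
  annul : opA ħ ω₁ ω₂ l m .minus P0 = 0

/-- The vector `A₊ⁿ P0`. -/
def tower (ħ ω₁ ω₂ : ℝ) (l m : ℕ) (P0 : Sch) (n : ℕ) : Sch :=
  (opA ħ ω₁ ω₂ l m .plus ^ n) P0

/-- The coherent states `∑_{n ≤ r} q!/(q+ln)! (z/ħ^l)ⁿ A₊ⁿ P0`. -/
def coh (ħ ω₁ ω₂ : ℝ) (l m r q : ℕ) (P0 : Sch) (z : ℂ) : Sch :=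
  ∑ n ∈ Finset.range (r + 1), (((q ! : ℂ) / (q + l * n)!) * (z / (ħ : ℂ) ^ l) ^ n) •
    tower ħ ω₁ ω₂ l m P0 n

/-- The coherent projection: the orthogonal projection in `L²` onto the line spanned by the
coherent state. -/
def cohProj (ħ ω₁ ω₂ : ℝ) (l m r q : ℕ) (P0 : Sch) (z : ℂ) : L2 →L[ℂ] L2 :=
  (Submodule.span ℂ {toL2 (coh ħ ω₁ ω₂ l m r q P0 z)}).starProjection

/-- The coherent projection at the point `z = ∞` of the sphere, where the coherent states
(divided by `z^r`) become proportional to `A₊^r P0`. -/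
def cohProjInf (ħ ω₁ ω₂ : ℝ) (l m r : ℕ) (P0 : Sch) : L2 →L[ℂ] L2 :=
  (Submodule.span ℂ {toL2 (tower ħ ω₁ ω₂ l m P0 r)}).starProjection

/-- The subspace `L_{r,q,p}` of `L²` spanned by `A₊ⁿ P0`, `n = 0, …, r`. -/
def Lsub (ħ ω₁ ω₂ : ℝ) (l m r : ℕ) (P0 : Sch) : Submodule ℂ L2 :=
  Submodule.span ℂ (range fun n : Fin (r + 1) => toL2 (tower ħ ω₁ ω₂ l m P0 n))

instance (ħ ω₁ ω₂ : ℝ) (l m r : ℕ) (P0 : Sch) :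
    FiniteDimensional ℂ (Lsub ħ ω₁ ω₂ l m r P0) :=
  FiniteDimensional.span_of_finite ℂ (finite_range _)

/-- The coherent transform: `ν(ψ)(z̄) = (ψ, 𝔓_z)`, see `cohTrans_eval`. -/
def cohTrans (ħ ω₁ ω₂ : ℝ) (l m r q : ℕ) (P0 : Sch) (ψ : L2) : ℂ[X] :=
  ∑ n ∈ Finset.range (r + 1), Polynomial.monomial n
    (((q ! : ℂ) / (q + l * n)!) * (1 / (ħ : ℂ) ^ l) ^ n *
      inner ℂ (toL2 (tower ħ ω₁ ω₂ l m P0 n)) ψ)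

theorem cohTrans_eval (ħ ω₁ ω₂ : ℝ) (l m r q : ℕ) (P0 : Sch) (ψ : L2) (z : ℂ) :
    (cohTrans ħ ω₁ ω₂ l m r q P0 ψ).eval (conj z) =
      inner ℂ (toL2 (coh ħ ω₁ ω₂ l m r q P0 z)) ψ := by
  simp only [cohTrans, coh, Polynomial.eval_finsetSum, Polynomial.eval_monomial, map_sum,
    map_smul, sum_inner, inner_smul_left]
  refine Finset.sum_congr rfl fun n _ => ?_
  simp only [map_mul, map_div₀, map_pow, Complex.conj_ofReal, Complex.conj_natCast, div_pow,
    one_pow]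
  ring

/-- The integrand `𝔓_z phi(z̄) / K(z)` of the inverse coherent transform. -/
def invIntegrand (ħ ω₁ ω₂ : ℝ) (l m r q p : ℕ) (P0 : Sch) (phi : ℂ[X]) (z : ℂ) : L2 :=
  (phi.eval (conj z) / (Kern ħ l m r q p z : ℂ)) • toL2 (coh ħ ω₁ ω₂ l m r q P0 z)

/-- The inverse coherent transform `(2πħ)⁻¹ ∫ (𝔓 ⊗ phi / K) dm`. -/
def invTrans (ħ ω₁ ω₂ : ℝ) (l m r q p : ℕ) (P0 : Sch) (phi : ℂ[X]) : L2 :=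
  ((1 / (2 * Real.pi * ħ) : ℝ) : ℂ) •
    ∫ z, invIntegrand ħ ω₁ ω₂ l m r q p P0 phi z ∂(dm ħ l m r q p)

/-- The transformed operator `ν ∘ T ∘ ν⁻¹` on polynomials. -/
def transOp (ħ ω₁ ω₂ : ℝ) (l m r q p : ℕ) (P0 : Sch) (T : L2 → L2) (phi : ℂ[X]) : ℂ[X] :=
  cohTrans ħ ω₁ ω₂ l m r q P0 (T (invTrans ħ ω₁ ω₂ l m r q p P0 phi))

/-! ### Wick symbols -/

/-- The reproducing kernel `w̄ ↦ k(w̄ z)` as a polynomial in the antiholomorphic variable. -/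
def kerPol (ħ : ℝ) (l m r q p : ℕ) (z : ℂ) : ℂ[X] :=
  ∑ n ∈ Finset.range (r + 1), Polynomial.monomial n ((kcoef ħ l m r q p n : ℂ) * z ^ n)

/-- The Wick symbol `f = K⁻¹ T(K)` of an operator `T` acting on polynomials in `z̄`. -/
def wick (ħ : ℝ) (l m r q p : ℕ) (T : ℂ[X] → ℂ[X]) (z : ℂ) : ℂ :=
  (T (kerPol ħ l m r q p z)).eval (conj z) / (Kern ħ l m r q p z : ℂ)

/-- The operator `T : L² → L²` is of trace class with trace `t`, in the sense that
`∑ᵢ (T eᵢ, eᵢ) = t` (absolutely) for every orthonormal basis. -/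
def HasTrace (T : L2 → L2) (t : ℂ) : Prop :=
  ∀ (ι : Type) (e : HilbertBasis ι ℂ L2), HasSum (fun i => inner ℂ (e i) (T (e i))) t

/-- `f(z̄, z) = ∑ c_{jk} z̄ʲ zᵏ` near `z = 0`. -/
def HasExpansion (f : ℂ → ℂ) (c : ℕ → ℕ → ℂ) : Prop :=
  ∀ᶠ z in 𝓝 (0 : ℂ), HasSum (fun i : ℕ × ℕ => c i.1 i.2 * conj z ^ i.1 * z ^ i.2) (f z)

/-- The operator `ρ₊(A) = ∏_{j=1}^m (A₁ + jħ)`. -/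
def rhoPlusA (ħ ω₁ ω₂ : ℝ) (l m : ℕ) : Module.End ℂ Sch :=
  Polynomial.aeval (opA ħ ω₁ ω₂ l m .one) (rhoPlusPoly ħ m)

/-- The operator `ρ₊(A)⁻¹` (inverse of the injective operator `ρ₊(A)`, on its range). -/
def rhoPlusAInv (ħ ω₁ ω₂ : ℝ) (l m : ℕ) : Sch → Sch := Function.invFun (rhoPlusA ħ ω₁ ω₂ l m)

/-- The operator of complex structure `𝐳 = A₋ ρ₊(A)⁻¹`. -/
def zOp (ħ ω₁ ω₂ : ℝ) (l m : ℕ) (ψ : Sch) : Sch :=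
  opA ħ ω₁ ω₂ l m .minus (rhoPlusAInv ħ ω₁ ω₂ l m ψ)

/-- The conjugate operator `𝐳* = ρ₊(A)⁻¹ A₊`. -/
def zStarOp (ħ ω₁ ω₂ : ℝ) (l m : ℕ) (ψ : Sch) : Sch :=
  rhoPlusAInv ħ ω₁ ω₂ l m (opA ħ ω₁ ω₂ l m .plus ψ)

end

end Resonance

open Resonance

/-!
The operators `A₁ = b₁* b₁`, `A₂ = b₂* b₂` count the quanta of two commuting oscillators, and
`A₊ = (b₂*)^l b₁^m` exchanges `m` quanta of the first one for `l` quanta of the second one. From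
`[b, b*] = ħ` alone follow `b*ⁿ bⁿ = ∏ (b* b - sħ)` and `bⁿ b*ⁿ = ∏ (b* b + sħ)`, hence
`A₊ A₋ = ρ(A₁, A₂)` and `A₋ A₊ = ρ(A₁ - ħm, A₂ + ħl)` (`opA_plus_mul_minus`,
`opA_minus_mul_plus`), and with them the relations of the resonance algebra (`isResRep_opA`).
On polynomials the same relations hold coefficientwise (`isResRep_opPol`).

Starting from a vacuum vector, the vectors `A₊ⁿ P0` are joint eigenvectors of `A₁`, `A₂`; their
norms follow by induction from `A₋ A₊ = ρ(…)`, and `A₊^(r+1) P0 = 0` since its norm contains the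
factor `ρ₊ = 0`. So all computations inside one irreducible subspace are computations with the
coefficients of `∑ xₙ A₊ⁿ P0`. This gives the scalar products of coherent states (`inner_coh`) and
irreducibility (`Lsub_irreducible`). A pair of quantum numbers `(j, k)` occurs in exactly one of
the subspaces, the one with `r = ⌊j/m⌋ + ⌊k/l⌋`, so the decomposition of `L²`
(`isHilbertSum_Lsub`) reduces to the totality of the Hermite functions
(`eq_zero_of_inner_herm`): a square integrable function orthogonal to all polynomials times a
Gaussian function has a vanishing Fourier transform after multiplication by the Gaussian.

The resolution of unity and the inversion of the coherent transform both integrate finite sums of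
`z̄ⁿ zᵏ` against the density `L(|z|²)`. Rotations annihilate the terms with `n ≠ k`. For `n = k`
the change of variables from `(E, x)` to `(A₁, A₂)`, with `E = l A₁ + m A₂` and
`x = A₂^l / A₁^m`, turns the moments of `L` into products of two Gamma integrals
(`lintegral_leaf`): the moments are the weights of the scalar product of polynomials, which are
inverse to the coefficients of `k` (`integrable_dm_and_integral`, `weight_mul_kcoef`).

The Wick symbol is the quotient of `(F 𝔓_z, 𝔓_z)` by `K(z)` (`wick_transOp`), hence a trace by
Parseval's identity. Its numerator is a polynomial in `z̄`, `z` whose coefficients are the matrix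
elements `F_ab` of the operator, so an expansion `f = ∑ c_jk z̄ʲ zᵏ` satisfies
`F_ab = ∑ₙ kₙ c_(a-n)(b-n)`, because coefficients of a power series in `z̄`, `z` are unique
(`HasExpansion.eq_zero`). On the other hand, in suitably scaled bases both `𝐳*` and the
multiplication by `z̄` act as the shift, and `𝐳` and `z̄*` act as its adjoint up to the weights
`kₙ`; summing `∑ c_jk (𝐳*)ʲ 𝐳ᵏ` along the diagonals reproduces the same combinations of the
coefficients (`hasSum_reorder`), that is, the matrix of the operator.

Finally, `ħ ln k(ȳz)` is a potential of the membrane form, so two integrations give a cross-ratio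
of values of `k`; the outer integral, of a logarithmic derivative along a curve, is exponentiated
without choosing a branch of the logarithm (`exp_integral_logDeriv`).
-/

namespace Resonance

/-! ### Creation and annihilation operators on the Schwartz space -/

theorem inner_toL2 (f g : Sch) : inner ℂ (toL2 f) (toL2 g) = ∫ x, conj (f x) * g x := by
  have h := L2.inner_def (𝕜 := ℂ) (μ := (volume : Measure (ℝ × ℝ))) (toL2 f) (toL2 g)
  rw [h]
  refine integral_congr_ae ?_
  filter_upwards [f.coeFn_toLp 2 volume, g.coeFn_toLp 2 volume] with x hf hg
  change inner ℂ ((f.toLp 2 volume) x) ((g.toLp 2 volume) x) = _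
  rw [hf, hg, RCLike.inner_apply, mul_comm]

/-- The pointwise complex conjugate of a Schwartz function. -/
noncomputable def conjSch (f : Sch) : Sch :=
  SchwartzMap.postcompCLM (𝕜 := ℝ) Complex.conjCLE.toContinuousLinearMap f

theorem conjSch_apply (f : Sch) (x : ℝ × ℝ) : conjSch f x = conj (f x) := rfl

theorem lineDeriv_conjSch (f : Sch) (v : ℝ × ℝ) (x : ℝ × ℝ) :
    (∂_{v} (conjSch f) : Sch) x = conj ((∂_{v} f : Sch) x) := by
  rw [SchwartzMap.lineDerivOp_apply_eq_fderiv, SchwartzMap.lineDerivOp_apply_eq_fderiv]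
  have h : HasFDerivAt (conjSch f)
      (Complex.conjCLE.toContinuousLinearMap ∘L fderiv ℝ f x) x :=
    Complex.conjCLE.toContinuousLinearMap.hasFDerivAt.comp x (f.hasFDerivAt x)
  rw [h.fderiv]
  rfl

/-- Integration by parts. -/
theorem inner_lineDeriv_left (f g : Sch) (v : ℝ × ℝ) :
    inner ℂ (toL2 (∂_{v} f)) (toL2 g) = -inner ℂ (toL2 f) (toL2 (∂_{v} g)) := by
  have h := SchwartzMap.integral_mul_lineDerivOp_right_eq_neg_left
    (μ := (volume : Measure (ℝ × ℝ))) (conjSch f) g v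
  rw [inner_toL2, inner_toL2]
  simp only [lineDeriv_conjSch, conjSch_apply] at h
  rw [h, neg_neg]

theorem inner_mulX1_left (f g : Sch) :
    inner ℂ (toL2 (mulX1 f)) (toL2 g) = inner ℂ (toL2 f) (toL2 (mulX1 g)) := by
  rw [inner_toL2, inner_toL2]
  congr 1; ext x
  simp only [mulX1_apply, map_mul, Complex.conj_ofReal]; ring

theorem inner_mulX2_left (f g : Sch) :
    inner ℂ (toL2 (mulX2 f)) (toL2 g) = inner ℂ (toL2 f) (toL2 (mulX2 g)) := by
  rw [inner_toL2, inner_toL2]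
  congr 1; ext x
  simp only [mulX2_apply, map_mul, Complex.conj_ofReal]; ring

theorem der1_apply (f : Sch) (x : ℝ × ℝ) : der1 f x = fderiv ℝ f x (1, 0) := rfl

theorem der2_apply (f : Sch) (x : ℝ × ℝ) : der2 f x = fderiv ℝ f x (0, 1) := rfl

/-- The adjoint relation `(T f, g) = (f, S g)` for operators on the Schwartz space. -/
def IsAdj (T S : Module.End ℂ Sch) : Prop :=
  ∀ f g : Sch, inner ℂ (toL2 (T f)) (toL2 g) = inner ℂ (toL2 f) (toL2 (S g))

theorem IsAdj.symm {T S : Module.End ℂ Sch} (h : IsAdj T S) : IsAdj S T := fun f g => by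
  rw [← inner_conj_symm, ← h g f, inner_conj_symm]

theorem IsAdj.mul {T S T' S' : Module.End ℂ Sch} (h : IsAdj T S) (h' : IsAdj T' S') :
    IsAdj (T * T') (S' * S) := fun f g => by
  rw [Module.End.mul_apply, h, h', Module.End.mul_apply]

theorem IsAdj.pow {T S : Module.End ℂ Sch} (h : IsAdj T S) (n : ℕ) :
    IsAdj (T ^ n) (S ^ n) := by
  induction n with
  | zero => intro f g; rfl
  | succ n ih => rw [pow_succ, pow_succ']; exact ih.mul h

theorem isAdj_b1s (ħ ω : ℝ) : IsAdj (b1s ħ ω) (b1 ħ ω) := fun f g => by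
  have h := inner_lineDeriv_left f g (1, 0)
  simp only [b1, b1s, LinearMap.smul_apply, LinearMap.sub_apply, LinearMap.add_apply, map_smul,
    map_sub, map_add, inner_smul_left, inner_smul_right, inner_sub_left, inner_add_right,
    Complex.conj_ofReal, inner_mulX1_left]
  change inner ℂ (toL2 (der1 f)) (toL2 g) = -inner ℂ (toL2 f) (toL2 (der1 g)) at h
  rw [h]; ring

theorem isAdj_b2s (ħ ω : ℝ) : IsAdj (b2s ħ ω) (b2 ħ ω) := fun f g => by
  have h := inner_lineDeriv_left f g (0, 1)
  simp only [b2, b2s, LinearMap.smul_apply, LinearMap.sub_apply, LinearMap.add_apply, map_smul,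
    map_sub, map_add, inner_smul_left, inner_smul_right, inner_sub_left, inner_add_right,
    Complex.conj_ofReal, inner_mulX2_left]
  change inner ℂ (toL2 (der2 f)) (toL2 g) = -inner ℂ (toL2 f) (toL2 (der2 g)) at h
  rw [h]; ring

theorem hasFDerivAt_mulX1 (f : Sch) (x : ℝ × ℝ) : HasFDerivAt (mulX1 f)
    ((x.1 : ℂ) • fderiv ℝ f x +
      (Complex.ofRealCLM ∘L ContinuousLinearMap.fst ℝ ℝ ℝ).smulRight (f x)) x := by
  have h : (mulX1 f : ℝ × ℝ → ℂ) = fun x => (x.1 : ℂ) • f x := by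
    ext x; rw [mulX1_apply]; rfl
  rw [h]
  exact (Complex.ofRealCLM ∘L ContinuousLinearMap.fst ℝ ℝ ℝ).hasFDerivAt.smul (f.hasFDerivAt x)

theorem hasFDerivAt_mulX2 (f : Sch) (x : ℝ × ℝ) : HasFDerivAt (mulX2 f)
    ((x.2 : ℂ) • fderiv ℝ f x +
      (Complex.ofRealCLM ∘L ContinuousLinearMap.snd ℝ ℝ ℝ).smulRight (f x)) x := by
  have h : (mulX2 f : ℝ × ℝ → ℂ) = fun x => (x.2 : ℂ) • f x := by
    ext x; rw [mulX2_apply]; rfl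
  rw [h]
  exact (Complex.ofRealCLM ∘L ContinuousLinearMap.snd ℝ ℝ ℝ).hasFDerivAt.smul (f.hasFDerivAt x)

theorem der1_mul_mulX1 : der1 * mulX1 = mulX1 * der1 + 1 := by
  ext f x
  simp [der1_apply, mulX1_apply, (hasFDerivAt_mulX1 f x).fderiv]

theorem der2_mul_mulX2 : der2 * mulX2 = mulX2 * der2 + 1 := by
  ext f x
  simp [der2_apply, mulX2_apply, (hasFDerivAt_mulX2 f x).fderiv]

theorem commute_der1_mulX2 : Commute der1 mulX2 := by
  refine LinearMap.ext fun f => SchwartzMap.ext fun x => ?_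
  simp [der1_apply, mulX2_apply, (hasFDerivAt_mulX2 f x).fderiv]

theorem commute_der2_mulX1 : Commute der2 mulX1 := by
  refine LinearMap.ext fun f => SchwartzMap.ext fun x => ?_
  simp [der2_apply, mulX1_apply, (hasFDerivAt_mulX1 f x).fderiv]

theorem commute_mulX1_mulX2 : Commute mulX1 mulX2 := by
  refine LinearMap.ext fun f => SchwartzMap.ext fun x => ?_
  simp [mulX1_apply, mulX2_apply]; ring

theorem commute_der1_der2 : Commute der1 der2 := by
  refine LinearMap.ext fun f => SchwartzMap.ext fun x => ?_
  have hf : Differentiable ℝ (fderiv ℝ f) :=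
    ((f.smooth 2).fderiv_right (m := 1) (by norm_num)).differentiable one_ne_zero
  have h : ∀ v w : ℝ × ℝ, fderiv ℝ (fun y => fderiv ℝ f y v) x w =
      fderiv ℝ (fderiv ℝ f) x w v := fun v w => by
    rw [((hf x).hasFDerivAt.clm_apply (hasFDerivAt_const v x)).fderiv]
    simp
  have hs := second_derivative_symmetric (f := f) (f' := fderiv ℝ f) (fun y => f.hasFDerivAt y)
    (hf x).hasFDerivAt (1, 0) (0, 1)
  change fderiv ℝ (fun y => fderiv ℝ f y (0, 1)) x (1, 0)
    = fderiv ℝ (fun y => fderiv ℝ f y (1, 0)) x (0, 1)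
  rw [h, h, hs]

/-- The canonical commutation relation `[b₁, b₁*] = ħ`. -/
theorem b1_mul_b1s {ω : ℝ} (ħ : ℝ) (hω : 0 < ω) :
    b1 ħ ω * b1s ħ ω = b1s ħ ω * b1 ħ ω + algebraMap ℂ _ (ħ : ℂ) := by
  have hc : ((1 / √(2 * ω) : ℝ) : ℂ) * ((1 / √(2 * ω) : ℝ) : ℂ) * (2 * ω) = 1 := by
    norm_cast
    rw [div_mul_div_comm, Real.mul_self_sqrt (by positivity)]
    field_simp
  have key : ((ω : ℂ) • mulX1 + (ħ : ℂ) • der1) * ((ω : ℂ) • mulX1 - (ħ : ℂ) • der1) =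
      ((ω : ℂ) • mulX1 - (ħ : ℂ) • der1) * ((ω : ℂ) • mulX1 + (ħ : ℂ) • der1)
        + (2 * ω * ħ : ℂ) • (1 : Module.End ℂ Sch) := by
    simp only [add_mul, mul_add, sub_mul, mul_sub, smul_mul_assoc, mul_smul_comm, der1_mul_mulX1,
      smul_add]
    module
  rw [b1, b1s, smul_mul_smul_comm, smul_mul_smul_comm, key, smul_add, smul_smul,
    Algebra.algebraMap_eq_smul_one]
  congr 2
  linear_combination (ħ : ℂ) * hc

/-- The canonical commutation relation `[b₂, b₂*] = ħ`. -/
theorem b2_mul_b2s {ω : ℝ} (ħ : ℝ) (hω : 0 < ω) :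
    b2 ħ ω * b2s ħ ω = b2s ħ ω * b2 ħ ω + algebraMap ℂ _ (ħ : ℂ) := by
  have hc : ((1 / √(2 * ω) : ℝ) : ℂ) * ((1 / √(2 * ω) : ℝ) : ℂ) * (2 * ω) = 1 := by
    norm_cast
    rw [div_mul_div_comm, Real.mul_self_sqrt (by positivity)]
    field_simp
  have key : ((ω : ℂ) • mulX2 + (ħ : ℂ) • der2) * ((ω : ℂ) • mulX2 - (ħ : ℂ) • der2) =
      ((ω : ℂ) • mulX2 - (ħ : ℂ) • der2) * ((ω : ℂ) • mulX2 + (ħ : ℂ) • der2)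
        + (2 * ω * ħ : ℂ) • (1 : Module.End ℂ Sch) := by
    simp only [add_mul, mul_add, sub_mul, mul_sub, smul_mul_assoc, mul_smul_comm, der2_mul_mulX2,
      smul_add]
    module
  rw [b2, b2s, smul_mul_smul_comm, smul_mul_smul_comm, key, smul_add, smul_smul,
    Algebra.algebraMap_eq_smul_one]
  congr 2
  linear_combination (ħ : ℂ) * hc

/-- Operators built from the first coordinate commute with those built from the second. -/
theorem commute_first_second (a b c d : ℂ) :
    Commute (a • mulX1 + b • der1) (c • mulX2 + d • der2) :=
  (((commute_mulX1_mulX2.smul_right c).add_right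
    (commute_der2_mulX1.symm.smul_right d)).smul_left a).add_left
  (((commute_der1_mulX2.smul_right c).add_right (commute_der1_der2.smul_right d)).smul_left b)

theorem commute_b1_b2 (ħ ω ω' : ℝ) : Commute (b1 ħ ω) (b2 ħ ω') :=
  ((commute_first_second _ _ _ _).smul_left _).smul_right _

theorem commute_b1_b2s (ħ ω ω' : ℝ) : Commute (b1 ħ ω) (b2s ħ ω') := by
  unfold b2s; rw [sub_eq_add_neg, ← neg_smul]
  exact ((commute_first_second _ _ _ _).smul_left _).smul_right _

theorem commute_b1s_b2 (ħ ω ω' : ℝ) : Commute (b1s ħ ω) (b2 ħ ω') := by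
  unfold b1s; rw [sub_eq_add_neg, ← neg_smul]
  exact ((commute_first_second _ _ _ _).smul_left _).smul_right _

theorem commute_b1s_b2s (ħ ω ω' : ℝ) : Commute (b1s ħ ω) (b2s ħ ω') := by
  unfold b1s b2s; rw [sub_eq_add_neg, sub_eq_add_neg, ← neg_smul, ← neg_smul]
  exact ((commute_first_second _ _ _ _).smul_left _).smul_right _

/-! ### Gaussian functions as Schwartz functions -/

/-- The negative quadratic form in the exponent of a Gaussian function. -/
def quadForm (a b : ℝ) (x : ℝ × ℝ) : ℝ := -(a * x.1 ^ 2 + b * x.2 ^ 2)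

theorem quadForm_hasTemperateGrowth (a b : ℝ) : (quadForm a b).HasTemperateGrowth := by
  have h1 : (fun x : ℝ × ℝ => x.1).HasTemperateGrowth :=
    (ContinuousLinearMap.fst ℝ ℝ ℝ).hasTemperateGrowth
  have h2 : (fun x : ℝ × ℝ => x.2).HasTemperateGrowth :=
    (ContinuousLinearMap.snd ℝ ℝ ℝ).hasTemperateGrowth
  exact (((Function.HasTemperateGrowth.const a).mul (h1.pow 2)).add
    ((Function.HasTemperateGrowth.const b).mul (h2.pow 2))).neg

theorem quadForm_le {a b : ℝ} (ha : 0 < a) (hb : 0 < b) (x : ℝ × ℝ) :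
    quadForm a b x ≤ -(min a b * ‖x‖ ^ 2) := by
  have h1 : 0 ≤ a * x.1 ^ 2 := by positivity
  have h2 : 0 ≤ b * x.2 ^ 2 := by positivity
  have hm : 0 < min a b := lt_min ha hb
  unfold quadForm
  rw [Prod.norm_def]
  rcases max_cases ‖x.1‖ ‖x.2‖ with ⟨h, -⟩ | ⟨h, -⟩ <;> rw [h, Real.norm_eq_abs, sq_abs]
  · nlinarith [mul_le_mul_of_nonneg_right (min_le_left a b) (sq_nonneg x.1)]
  · nlinarith [mul_le_mul_of_nonneg_right (min_le_right a b) (sq_nonneg x.2)]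

theorem one_add_pow_mul_exp_le {c : ℝ} (hc : 0 < c) (M : ℕ) {t : ℝ} (ht : 0 ≤ t) :
    (1 + t) ^ M * Real.exp (-(c * t ^ 2)) ≤ M ! * Real.exp (1 + 1 / (4 * c)) := by
  have h1 : (1 + t) ^ M ≤ M ! * Real.exp (1 + t) := by
    have := Real.pow_div_factorial_le_exp (x := 1 + t) (by positivity) M
    rwa [div_le_iff₀' (by positivity)] at this
  have h2 : 1 + t + -(c * t ^ 2) ≤ 1 + 1 / (4 * c) := by
    have : 0 ≤ c * (t - 1 / (2 * c)) ^ 2 := by positivity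
    have e : c * (t - 1 / (2 * c)) ^ 2 = c * t ^ 2 - t + 1 / (4 * c) := by
      field_simp; ring
    linarith
  calc (1 + t) ^ M * Real.exp (-(c * t ^ 2))
      ≤ M ! * Real.exp (1 + t) * Real.exp (-(c * t ^ 2)) := by gcongr
    _ = M ! * Real.exp (1 + t + -(c * t ^ 2)) := by rw [Real.exp_add (1 + t)]; ring
    _ ≤ _ := by gcongr

/-- The real Gaussian function `exp (-(a x₁² + b x₂²))` as a Schwartz function. -/
noncomputable def gaussianReal {a b : ℝ} (ha : 0 < a) (hb : 0 < b) : 𝓢(ℝ × ℝ, ℝ) where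
  toFun := Real.exp ∘ quadForm a b
  smooth' := Real.contDiff_exp.comp (quadForm_hasTemperateGrowth a b).1
  decay' := by
    intro k n
    obtain ⟨N, C, hC, hN⟩ := (quadForm_hasTemperateGrowth a b).norm_iteratedFDeriv_le_uniform n
    have hm : 0 < min a b := lt_min ha hb
    refine ⟨n ! * (max C 1) ^ n * ((k + N * n)! * Real.exp (1 + 1 / (4 * min a b))), fun x => ?_⟩
    have hx : (0 : ℝ) ≤ ‖x‖ := norm_nonneg x
    have h := norm_iteratedFDeriv_comp_le (𝕜 := ℝ) (g := Real.exp) (f := quadForm a b) (n := n)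
      (N := ((⊤ : ℕ∞) : WithTop ℕ∞)) Real.contDiff_exp (quadForm_hasTemperateGrowth a b).1
      (mod_cast le_top) x (C := Real.exp (quadForm a b x)) (D := max C 1 * (1 + ‖x‖) ^ N)
      (fun i _ => by
        rw [norm_iteratedFDeriv_eq_norm_iteratedDeriv, iteratedDeriv_eq_iterate,
          Real.iter_deriv_exp, Real.norm_eq_abs, Real.abs_exp])
      (fun i hi hin => by
        refine (hN i hin x).trans ?_
        have h1 : C * (1 + ‖x‖) ^ N ≤ max C 1 * (1 + ‖x‖) ^ N := by
          gcongr; exact le_max_left _ _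
        refine h1.trans (le_self_pow₀ ?_ (by omega))
        exact one_le_mul_of_one_le_of_one_le (le_max_right _ _) (one_le_pow₀ (by linarith)))
    calc ‖x‖ ^ k * ‖iteratedFDeriv ℝ n (Real.exp ∘ quadForm a b) x‖
        ≤ (1 + ‖x‖) ^ k * (n ! * Real.exp (-(min a b * ‖x‖ ^ 2)) *
            (max C 1 * (1 + ‖x‖) ^ N) ^ n) := by
          gcongr
          · linarith
          · exact h.trans (by gcongr; exact quadForm_le ha hb x)
      _ = n ! * (max C 1) ^ n * ((1 + ‖x‖) ^ (k + N * n) *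
            Real.exp (-(min a b * ‖x‖ ^ 2))) := by
          rw [pow_add, pow_mul, mul_pow]; ring
      _ ≤ _ := by
          exact mul_le_mul_of_nonneg_left (one_add_pow_mul_exp_le hm _ hx) (by positivity)

/-- The Gaussian function `exp (-(a x₁² + b x₂²))` as a complex Schwartz function. -/
noncomputable def gaussian {a b : ℝ} (ha : 0 < a) (hb : 0 < b) : Sch :=
  SchwartzMap.postcompCLM (𝕜 := ℝ) Complex.ofRealCLM (gaussianReal ha hb)

theorem gaussian_apply {a b : ℝ} (ha : 0 < a) (hb : 0 < b) (x : ℝ × ℝ) :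
    gaussian ha hb x = (Real.exp (quadForm a b x) : ℂ) := rfl

theorem hasFDerivAt_gaussian {a b : ℝ} (ha : 0 < a) (hb : 0 < b) (x : ℝ × ℝ) :
    HasFDerivAt (gaussian ha hb) (Complex.ofRealCLM ∘L (Real.exp (quadForm a b x) •
      ((-(2 * a * x.1)) • ContinuousLinearMap.fst ℝ ℝ ℝ +
        (-(2 * b * x.2)) • ContinuousLinearMap.snd ℝ ℝ ℝ))) x := by
  have h1 : HasFDerivAt (fun x : ℝ × ℝ => x.1) (ContinuousLinearMap.fst ℝ ℝ ℝ) x :=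
    hasFDerivAt_fst
  have h2 : HasFDerivAt (fun x : ℝ × ℝ => x.2) (ContinuousLinearMap.snd ℝ ℝ ℝ) x :=
    hasFDerivAt_snd
  have hq : HasFDerivAt (quadForm a b) ((-(2 * a * x.1)) • ContinuousLinearMap.fst ℝ ℝ ℝ +
        (-(2 * b * x.2)) • ContinuousLinearMap.snd ℝ ℝ ℝ) x := by
    have := (((h1.pow 2).const_mul a).add ((h2.pow 2).const_mul b)).neg
    refine this.congr_fderiv ?_
    ext <;> simp <;> ring
  exact Complex.ofRealCLM.hasFDerivAt.comp x hq.exp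

theorem der1_gaussian {a b : ℝ} (ha : 0 < a) (hb : 0 < b) :
    der1 (gaussian ha hb) = (-(2 * a) : ℂ) • mulX1 (gaussian ha hb) := by
  ext x
  rw [der1_apply, (hasFDerivAt_gaussian ha hb x).fderiv]
  simp [mulX1_apply, gaussian_apply]
  ring

theorem der2_gaussian {a b : ℝ} (ha : 0 < a) (hb : 0 < b) :
    der2 (gaussian ha hb) = (-(2 * b) : ℂ) • mulX2 (gaussian ha hb) := by
  ext x
  rw [der2_apply, (hasFDerivAt_gaussian ha hb x).fderiv]
  simp [mulX2_apply, gaussian_apply]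
  ring

/-- The (unnormalized) common ground state of the two oscillators. -/
noncomputable def ground {ħ ω₁ ω₂ : ℝ} (hħ : 0 < ħ) (hω₁ : 0 < ω₁) (hω₂ : 0 < ω₂) : Sch :=
  gaussian (a := ω₁ / (2 * ħ)) (b := ω₂ / (2 * ħ)) (by positivity) (by positivity)

section Ground

variable {ħ ω₁ ω₂ : ℝ} (hħ : 0 < ħ) (hω₁ : 0 < ω₁) (hω₂ : 0 < ω₂)

theorem b1_ground : b1 ħ ω₁ (ground hħ hω₁ hω₂) = 0 := by
  have hc : (ħ : ℂ) ≠ 0 := by exact_mod_cast hħ.ne'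
  rw [b1, LinearMap.smul_apply, LinearMap.add_apply, LinearMap.smul_apply, LinearMap.smul_apply,
    ground, der1_gaussian, smul_smul, ← add_smul]
  push_cast
  rw [show (ω₁ : ℂ) + ħ * -(2 * (ω₁ / (2 * ħ))) = 0 by field_simp; ring, zero_smul, smul_zero]

theorem b2_ground : b2 ħ ω₂ (ground hħ hω₁ hω₂) = 0 := by
  have hc : (ħ : ℂ) ≠ 0 := by exact_mod_cast hħ.ne'
  rw [b2, LinearMap.smul_apply, LinearMap.add_apply, LinearMap.smul_apply, LinearMap.smul_apply,
    ground, der2_gaussian, smul_smul, ← add_smul]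
  push_cast
  rw [show (ω₂ : ℂ) + ħ * -(2 * (ω₂ / (2 * ħ))) = 0 by field_simp; ring, zero_smul, smul_zero]

theorem ground_ne_zero : ground hħ hω₁ hω₂ ≠ 0 := fun h => by
  have h0 : ground hħ hω₁ hω₂ 0 = 0 := by rw [h]; rfl
  rw [ground, gaussian_apply] at h0
  exact (Real.exp_pos _).ne' (by exact_mod_cast h0)

end Ground

/-! ### Uniqueness in `L²`: totality of polynomials times a Gaussian function -/

/-- A real integrable function all of whose Fourier coefficients vanish is zero. -/
theorem ae_eq_zero_of_integral_exp_real {u : ℝ × ℝ → ℝ} (hu : Integrable u)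
    (h : ∀ L : StrongDual ℝ (ℝ × ℝ), ∫ x, Complex.exp (L x * Complex.I) * (u x : ℂ) = 0) :
    u =ᵐ[volume] 0 := by
  have hp : AEMeasurable (fun x => ENNReal.ofReal (u x)) volume :=
    hu.aestronglyMeasurable.aemeasurable.ennreal_ofReal
  have hn : AEMeasurable (fun x => ENNReal.ofReal (-u x)) volume :=
    hu.neg.aestronglyMeasurable.aemeasurable.ennreal_ofReal
  have hfp : ∫⁻ x, ENNReal.ofReal (u x) ≠ ⊤ := hu.lintegral_lt_top.ne
  have hfn : ∫⁻ x, ENNReal.ofReal (-u x) ≠ ⊤ := hu.neg.lintegral_lt_top.ne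
  have : IsFiniteMeasure (volume.withDensity fun x => ENNReal.ofReal (u x)) :=
    isFiniteMeasure_withDensity hfp
  have : IsFiniteMeasure (volume.withDensity fun x => ENNReal.ofReal (-u x)) :=
    isFiniteMeasure_withDensity hfn
  have hbd : ∀ (L : StrongDual ℝ (ℝ × ℝ)) (w : ℝ × ℝ → ℝ), Integrable w →
      Integrable fun x => (w x : ℂ) * Complex.exp (L x * Complex.I) := fun L w hw => by
    refine hw.ofReal.mul_bdd (c := 1) (Continuous.aestronglyMeasurable (by fun_prop)) ?_
    exact ae_of_all _ fun x => (Complex.norm_exp_ofReal_mul_I _).le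
  have heq : (volume.withDensity fun x => ENNReal.ofReal (u x)) =
      volume.withDensity fun x => ENNReal.ofReal (-u x) := by
    refine Measure.ext_of_charFunDual (funext fun L => ?_)
    rw [charFunDual_apply, charFunDual_apply,
      integral_withDensity_eq_integral_toReal_smul₀ hp (ae_of_all _ fun _ => ENNReal.ofReal_lt_top),
      integral_withDensity_eq_integral_toReal_smul₀ hn (ae_of_all _ fun _ => ENNReal.ofReal_lt_top),
      ← sub_eq_zero, ← integral_sub]
    · rw [← h L]
      refine integral_congr_ae (ae_of_all _ fun x => ?_)
      simp only [ENNReal.toReal_ofReal', Complex.real_smul]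
      rw [← sub_mul, mul_comm]
      congr 1
      rw [← Complex.ofReal_sub, max_zero_sub_max_neg_zero_eq_self]
    · simp only [ENNReal.toReal_ofReal', Complex.real_smul]
      exact hbd L _ hu.pos_part
    · simp only [ENNReal.toReal_ofReal', Complex.real_smul]
      exact hbd L _ hu.neg_part
  rw [withDensity_eq_iff hp hn hfp] at heq
  filter_upwards [heq] with x hx
  rcases le_total 0 (u x) with h0 | h0
  · rw [ENNReal.ofReal_of_nonpos (neg_nonpos.2 h0), ENNReal.ofReal_eq_zero] at hx
    exact le_antisymm hx h0
  · rw [ENNReal.ofReal_of_nonpos h0, eq_comm, ENNReal.ofReal_eq_zero] at hx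
    exact le_antisymm h0 (neg_nonpos.1 hx)

/-- An integrable function all of whose Fourier coefficients vanish is zero. -/
theorem ae_eq_zero_of_integral_exp {u : ℝ × ℝ → ℂ} (hu : Integrable u)
    (h : ∀ L : StrongDual ℝ (ℝ × ℝ), ∫ x, Complex.exp (L x * Complex.I) * u x = 0) :
    u =ᵐ[volume] 0 := by
  have hI : ∀ (L : StrongDual ℝ (ℝ × ℝ)) (w : ℝ × ℝ → ℂ), Integrable w →
      Integrable fun x => Complex.exp (L x * Complex.I) * w x := fun L w hw => by
    refine hw.bdd_mul (c := 1) (Continuous.aestronglyMeasurable (by fun_prop)) ?_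
    exact ae_of_all _ fun x => (Complex.norm_exp_ofReal_mul_I _).le
  have hc : ∀ L : StrongDual ℝ (ℝ × ℝ), ∫ x, Complex.exp (L x * Complex.I) * conj (u x) = 0 := by
    intro L
    rw [← map_zero (starRingEnd ℂ), ← h (-L), ← integral_conj]
    refine integral_congr_ae (ae_of_all _ fun x => ?_)
    simp [← Complex.exp_conj]
  have hci : Integrable fun x => conj (u x) :=
    (Complex.conjCLE.toContinuousLinearMap).integrable_comp hu
  have hre := ae_eq_zero_of_integral_exp_real hu.re fun L => by
    have := congrArg₂ (fun a b : ℂ => (1 / 2) * (a + b)) (h L) (hc L)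
    simp only [← integral_add (hI L _ hu) (hI L _ hci), ← integral_const_mul] at this
    rw [show (1 / 2 : ℂ) * (0 + 0) = 0 by ring] at this
    rw [← this]
    refine integral_congr_ae (ae_of_all _ fun x => ?_)
    change Complex.exp (L x * Complex.I) * ((u x).re : ℂ) = _
    rw [Complex.re_eq_add_conj]; ring
  have him := ae_eq_zero_of_integral_exp_real hu.im fun L => by
    have := congrArg₂ (fun a b : ℂ => (1 / (2 * Complex.I)) * (a - b)) (h L) (hc L)
    simp only [← integral_sub (hI L _ hu) (hI L _ hci), ← integral_const_mul] at this
    rw [show (1 / (2 * Complex.I) : ℂ) * (0 - 0) = 0 by ring] at this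
    rw [← this]
    refine integral_congr_ae (ae_of_all _ fun x => ?_)
    change Complex.exp (L x * Complex.I) * ((u x).im : ℂ) = _
    rw [Complex.im_eq_sub_conj]; ring
  filter_upwards [hre, him] with x h1 h2
  exact Complex.ext h1 h2

/-- Moments determine square integrable functions: `f` vanishes if its product with a Gaussian
function is orthogonal to all powers of linear forms. The Fourier transform of the product is the
sum of the series of its moments, by dominated convergence. -/
theorem eq_zero_of_gaussian_moments {a b : ℝ} (ha : 0 < a) (hb : 0 < b) (f : L2)
    (h : ∀ (L : StrongDual ℝ (ℝ × ℝ)) (n : ℕ),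
      ∫ x, (L x : ℂ) ^ n * gaussian ha hb x * f x = 0) : f = 0 := by
  have hf : MemLp f 2 volume := Lp.memLp f
  -- the Gaussian function absorbs exponential growth
  have hexp : ∀ L : StrongDual ℝ (ℝ × ℝ),
      MemLp (fun x => (Real.exp |L x| : ℂ) * gaussian ha hb x) 2 volume := by
    intro L
    have ha2 : 0 < a / 2 := by positivity
    have hb2 : 0 < b / 2 := by positivity
    have hc : 0 < min (a / 2) (b / 2) := lt_min ha2 hb2
    set c := min (a / 2) (b / 2)
    refine ((gaussian ha2 hb2).memLp 2 volume).of_le_mul (c := Real.exp (‖L‖ ^ 2 / (4 * c)))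
      (Continuous.aestronglyMeasurable (by fun_prop)) (ae_of_all _ fun x => ?_)
    rw [gaussian_apply, gaussian_apply, ← Complex.ofReal_mul, Complex.norm_real, Complex.norm_real,
      ← Real.exp_add, Real.norm_eq_abs, Real.norm_eq_abs, Real.abs_exp, Real.abs_exp,
      ← Real.exp_add, Real.exp_le_exp]
    have h1 := quadForm_le ha2 hb2 x
    have h2 : |L x| ≤ ‖L‖ * ‖x‖ := L.le_opNorm x
    have h3 : quadForm a b x = 2 * quadForm (a / 2) (b / 2) x := by unfold quadForm; ring
    have h4 : 0 ≤ c * (‖x‖ - ‖L‖ / (2 * c)) ^ 2 := by positivity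
    have h5 : c * (‖x‖ - ‖L‖ / (2 * c)) ^ 2 = c * ‖x‖ ^ 2 - ‖L‖ * ‖x‖ + ‖L‖ ^ 2 / (4 * c) := by
      field_simp; ring
    linarith
  have hint : ∀ L : StrongDual ℝ (ℝ × ℝ),
      Integrable fun x => Real.exp |L x| * ‖gaussian ha hb x * f x‖ := by
    intro L
    refine ((hexp L).integrable_mul hf).norm.congr (ae_of_all _ fun x => ?_)
    simp only [Pi.mul_apply, norm_mul, Complex.norm_real, Real.norm_eq_abs, Real.abs_exp]
    ring
  have hm : AEStronglyMeasurable (fun x => gaussian ha hb x * f x) volume :=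
    ((gaussian ha hb).continuous.aestronglyMeasurable).mul hf.1
  have h0 : (fun x => gaussian ha hb x * f x) =ᵐ[volume] 0 := by
    refine ae_eq_zero_of_integral_exp ?_ fun L => ?_
    · have := hint 0
      simp only [_root_.zero_apply, abs_zero, Real.exp_zero, one_mul] at this
      exact (integrable_norm_iff hm).1 this
    · have hs := hasSum_integral_of_dominated_convergence (μ := (volume : Measure (ℝ × ℝ)))
        (F := fun (n : ℕ) x => ((L x : ℂ) * Complex.I) ^ n / (n ! : ℂ) * (gaussian ha hb x * f x))
        (f := fun x => Complex.exp (L x * Complex.I) * (gaussian ha hb x * f x))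
        (fun n x => |L x| ^ n / n ! * ‖gaussian ha hb x * f x‖)
        (fun n => (Continuous.aestronglyMeasurable (by fun_prop)).mul hm)
        (fun n => ae_of_all _ fun x => by
          simp only [norm_mul, norm_div, norm_pow, Complex.norm_real, Real.norm_eq_abs,
            Complex.norm_I, mul_one, Complex.norm_natCast]; rfl)
        (ae_of_all _ fun x => ((Real.summable_pow_div_factorial _).mul_right _))
        (by
          refine (hint L).congr (ae_of_all _ fun x => ?_)
          change _ = ∑' n : ℕ, _
          rw [tsum_mul_right, Real.exp_eq_exp_ℝ, NormedSpace.exp_eq_tsum_div])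
        (ae_of_all _ fun x => by
          have := NormedSpace.expSeries_div_hasSum_exp ((L x : ℂ) * Complex.I)
          rw [← Complex.exp_eq_exp_ℂ] at this
          exact this.mul_right _)
      refine hs.unique ?_
      have hz : ∀ n : ℕ, ∫ x, ((L x : ℂ) * Complex.I) ^ n / (n ! : ℂ) *
          (gaussian ha hb x * f x) = 0 := fun n => by
        rw [← mul_zero (Complex.I ^ n / (n ! : ℂ)), ← h L n, ← integral_const_mul]
        congr 1; ext x; rw [mul_pow]; ring
      simp only [hz]
      exact hasSum_zero
  refine Lp.ext ?_
  filter_upwards [h0, Lp.coeFn_zero ℂ 2 (volume : Measure (ℝ × ℝ))] with x hx hx0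
  rw [hx0]
  rcases mul_eq_zero.1 hx with hg | hg
  · rw [gaussian_apply] at hg
    exact absurd (by exact_mod_cast hg) (Real.exp_pos _).ne'
  · exact hg

/-! ### Hermite functions -/

section Ladder

variable {B : Type*} [Ring B] [Algebra ℂ B] {b bs : B} {c : ℂ}

theorem number_mul_raise (h : b * bs = bs * b + algebraMap ℂ B c) (n : ℕ) :
    bs * b * bs ^ n = bs ^ n * (bs * b) + (n * c : ℂ) • bs ^ n := by
  induction n with
  | zero => simp
  | succ n ih =>
    rw [pow_succ, ← mul_assoc, ih, add_mul, mul_assoc (bs ^ n) (bs * b), mul_assoc bs b bs, h,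
      mul_add, mul_add, Algebra.algebraMap_eq_smul_one]
    simp only [mul_smul_comm, mul_one, smul_mul_assoc, ← mul_assoc]
    push_cast
    module

theorem lower_mul_raise (h : b * bs = bs * b + algebraMap ℂ B c) (n : ℕ) :
    b * bs ^ (n + 1) = bs ^ (n + 1) * b + ((n + 1 : ℂ) * c) • bs ^ n := by
  rw [pow_succ', ← mul_assoc, h, add_mul, number_mul_raise h, ← mul_assoc, ← pow_succ,
    ← pow_succ', Algebra.algebraMap_eq_smul_one, smul_mul_assoc, one_mul]
  module

end Ladder

section Hermite

variable {ħ ω₁ ω₂ : ℝ} (hħ : 0 < ħ) (hω₁ : 0 < ω₁) (hω₂ : 0 < ω₂)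

/-- The (unnormalized) Hermite functions, obtained from the ground state by the creation
operators. -/
noncomputable def herm (j k : ℕ) : Sch :=
  (b1s ħ ω₁ ^ j) ((b2s ħ ω₂ ^ k) (ground hħ hω₁ hω₂))

theorem herm_symm (j k : ℕ) :
    herm hħ hω₁ hω₂ j k = (b2s ħ ω₂ ^ k) ((b1s ħ ω₁ ^ j) (ground hħ hω₁ hω₂)) := by
  rw [herm, ← Module.End.mul_apply, ← Module.End.mul_apply,
    ((commute_b1s_b2s ħ ω₁ ω₂).pow_pow j k).eq]

theorem b1s_herm (j k : ℕ) :
    b1s ħ ω₁ (herm hħ hω₁ hω₂ j k) = herm hħ hω₁ hω₂ (j + 1) k := by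
  rw [herm, herm, pow_succ', Module.End.mul_apply]

theorem b2s_herm (j k : ℕ) :
    b2s ħ ω₂ (herm hħ hω₁ hω₂ j k) = herm hħ hω₁ hω₂ j (k + 1) := by
  rw [herm_symm, herm_symm, pow_succ', Module.End.mul_apply]

theorem b1_herm_zero (k : ℕ) : b1 ħ ω₁ (herm hħ hω₁ hω₂ 0 k) = 0 := by
  rw [herm_symm, pow_zero, Module.End.one_apply, ← Module.End.mul_apply,
    ((commute_b1_b2s ħ ω₁ ω₂).pow_right k).eq, Module.End.mul_apply, b1_ground, map_zero]

theorem b2_herm_zero (j : ℕ) : b2 ħ ω₂ (herm hħ hω₁ hω₂ j 0) = 0 := by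
  rw [herm, pow_zero, Module.End.one_apply, ← Module.End.mul_apply,
    ← ((commute_b1s_b2 ħ ω₁ ω₂).pow_left j).eq, Module.End.mul_apply, b2_ground, map_zero]

theorem b1_herm_succ (j k : ℕ) : b1 ħ ω₁ (herm hħ hω₁ hω₂ (j + 1) k) =
    ((j + 1 : ℂ) * ħ) • herm hħ hω₁ hω₂ j k := by
  have h0 := b1_herm_zero hħ hω₁ hω₂ k
  simp only [herm, pow_zero, Module.End.one_apply] at h0
  rw [herm, ← Module.End.mul_apply, lower_mul_raise (b1_mul_b1s ħ hω₁), LinearMap.add_apply,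
    Module.End.mul_apply, h0, map_zero, zero_add, LinearMap.smul_apply, herm]

theorem b2_herm_succ (j k : ℕ) : b2 ħ ω₂ (herm hħ hω₁ hω₂ j (k + 1)) =
    ((k + 1 : ℂ) * ħ) • herm hħ hω₁ hω₂ j k := by
  have h0 := b2_herm_zero hħ hω₁ hω₂ j
  simp only [herm_symm, pow_zero, Module.End.one_apply] at h0
  rw [herm_symm, ← Module.End.mul_apply, lower_mul_raise (b2_mul_b2s ħ hω₂), LinearMap.add_apply,
    Module.End.mul_apply, h0, map_zero, zero_add, LinearMap.smul_apply, herm_symm]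

theorem opA_one_herm (l m j k : ℕ) : opA ħ ω₁ ω₂ l m .one (herm hħ hω₁ hω₂ j k) =
    (ħ * j : ℂ) • herm hħ hω₁ hω₂ j k := by
  change b1s ħ ω₁ (b1 ħ ω₁ _) = _
  cases j with
  | zero => simp [b1_herm_zero]
  | succ j => rw [b1_herm_succ, map_smul, b1s_herm, mul_comm]; push_cast; rfl

theorem opA_two_herm (l m j k : ℕ) : opA ħ ω₁ ω₂ l m .two (herm hħ hω₁ hω₂ j k) =
    (ħ * k : ℂ) • herm hħ hω₁ hω₂ j k := by
  change b2s ħ ω₂ (b2 ħ ω₂ _) = _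
  cases k with
  | zero => simp [b2_herm_zero]
  | succ k => rw [b2_herm_succ, map_smul, b2s_herm, mul_comm]; push_cast; rfl

theorem herm_ne_zero (j k : ℕ) : herm hħ hω₁ hω₂ j k ≠ 0 := by
  have hc : ∀ n : ℕ, ((n + 1 : ℂ) * ħ) ≠ 0 := fun n =>
    mul_ne_zero (Nat.cast_add_one_ne_zero n) (by exact_mod_cast hħ.ne')
  induction j with
  | zero =>
    induction k with
    | zero => exact ground_ne_zero hħ hω₁ hω₂
    | succ k ih =>
      intro h
      have := b2_herm_succ hħ hω₁ hω₂ 0 k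
      rw [h, map_zero, eq_comm, smul_eq_zero] at this
      exact this.elim (hc k) ih
  | succ j ih =>
    intro h
    have := b1_herm_succ hħ hω₁ hω₂ j k
    rw [h, map_zero, eq_comm, smul_eq_zero] at this
    exact this.elim (hc j) ih

/-- The span of the Hermite functions. -/
noncomputable def hermSpan : Submodule ℂ Sch :=
  Submodule.span ℂ (range fun i : ℕ × ℕ => herm hħ hω₁ hω₂ i.1 i.2)

theorem herm_mem_hermSpan (j k : ℕ) : herm hħ hω₁ hω₂ j k ∈ hermSpan hħ hω₁ hω₂ :=
  Submodule.subset_span ⟨(j, k), rfl⟩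

theorem apply_mem_hermSpan (T : Module.End ℂ Sch)
    (hT : ∀ j k, T (herm hħ hω₁ hω₂ j k) ∈ hermSpan hħ hω₁ hω₂) {g : Sch}
    (hg : g ∈ hermSpan hħ hω₁ hω₂) : T g ∈ hermSpan hħ hω₁ hω₂ := by
  have : hermSpan hħ hω₁ hω₂ ≤ (hermSpan hħ hω₁ hω₂).comap T := by
    refine Submodule.span_le.2 ?_
    rintro _ ⟨⟨j, k⟩, rfl⟩
    exact hT j k
  exact this hg

theorem mulX1_mem_hermSpan {g : Sch} (hg : g ∈ hermSpan hħ hω₁ hω₂) :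
    mulX1 g ∈ hermSpan hħ hω₁ hω₂ := by
  refine apply_mem_hermSpan hħ hω₁ hω₂ mulX1 (fun j k => ?_) hg
  have hb : b1 ħ ω₁ (herm hħ hω₁ hω₂ j k) + b1s ħ ω₁ (herm hħ hω₁ hω₂ j k) ∈
      hermSpan hħ hω₁ hω₂ := by
    rw [b1s_herm]
    refine add_mem ?_ (herm_mem_hermSpan hħ hω₁ hω₂ _ _)
    cases j with
    | zero => rw [b1_herm_zero]; exact zero_mem _
    | succ j => rw [b1_herm_succ]; exact Submodule.smul_mem _ _ (herm_mem_hermSpan hħ hω₁ hω₂ _ _)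
  have hs : ((1 / √(2 * ω₁) : ℝ) : ℂ) * (2 * ω₁) ≠ 0 := by
    norm_cast; positivity
  rw [← Submodule.smul_mem_iff _ hs]
  convert hb using 1
  simp only [b1, b1s, LinearMap.smul_apply, LinearMap.add_apply, LinearMap.sub_apply]
  module

theorem mulX2_mem_hermSpan {g : Sch} (hg : g ∈ hermSpan hħ hω₁ hω₂) :
    mulX2 g ∈ hermSpan hħ hω₁ hω₂ := by
  refine apply_mem_hermSpan hħ hω₁ hω₂ mulX2 (fun j k => ?_) hg
  have hb : b2 ħ ω₂ (herm hħ hω₁ hω₂ j k) + b2s ħ ω₂ (herm hħ hω₁ hω₂ j k) ∈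
      hermSpan hħ hω₁ hω₂ := by
    rw [b2s_herm]
    refine add_mem ?_ (herm_mem_hermSpan hħ hω₁ hω₂ _ _)
    cases k with
    | zero => rw [b2_herm_zero]; exact zero_mem _
    | succ k => rw [b2_herm_succ]; exact Submodule.smul_mem _ _ (herm_mem_hermSpan hħ hω₁ hω₂ _ _)
  have hs : ((1 / √(2 * ω₂) : ℝ) : ℂ) * (2 * ω₂) ≠ 0 := by
    norm_cast; positivity
  rw [← Submodule.smul_mem_iff _ hs]
  convert hb using 1
  simp only [b2, b2s, LinearMap.smul_apply, LinearMap.add_apply, LinearMap.sub_apply]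
  module

theorem inner_toL2_left (g : Sch) (f : L2) : inner ℂ (toL2 g) f = ∫ x, conj (g x) * f x := by
  have h := L2.inner_def (𝕜 := ℂ) (μ := (volume : Measure (ℝ × ℝ))) (toL2 g) f
  rw [h]
  refine integral_congr_ae ?_
  filter_upwards [g.coeFn_toLp 2 volume] with x hg
  change inner ℂ ((g.toLp 2 volume) x) _ = _
  rw [hg, RCLike.inner_apply, mul_comm]

/-- The Hermite functions are total in `L²`. -/
theorem eq_zero_of_inner_herm (f : L2)
    (h : ∀ j k, inner ℂ (toL2 (herm hħ hω₁ hω₂ j k)) f = 0) : f = 0 := by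
  have hV : ∀ g ∈ hermSpan hħ hω₁ hω₂, inner ℂ (toL2 g) f = 0 := by
    intro g hg
    induction hg using Submodule.span_induction with
    | mem x hx => obtain ⟨⟨j, k⟩, rfl⟩ := hx; exact h j k
    | zero => simp
    | add x y _ _ hx hy => rw [map_add, inner_add_left, hx, hy, add_zero]
    | smul c x _ hx => rw [map_smul, inner_smul_left, hx, mul_zero]
  refine eq_zero_of_gaussian_moments (a := ω₁ / (2 * ħ)) (b := ω₂ / (2 * ħ)) (by positivity)
    (by positivity) f fun L n => ?_
  have hL : ∀ x : ℝ × ℝ, L x = L (1, 0) * x.1 + L (0, 1) * x.2 := fun x => by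
    conv_lhs => rw [show x = x.1 • ((1, 0) : ℝ × ℝ) + x.2 • ((0, 1) : ℝ × ℝ) by ext <;> simp]
    rw [map_add, map_smul, map_smul, smul_eq_mul, smul_eq_mul]; ring
  have hmem : ∀ n : ℕ, (((L (1, 0) : ℂ) • mulX1 + (L (0, 1) : ℂ) • mulX2) ^ n)
      (ground hħ hω₁ hω₂) ∈ hermSpan hħ hω₁ hω₂ := fun n => by
    induction n with
    | zero => exact herm_mem_hermSpan hħ hω₁ hω₂ 0 0
    | succ n ih =>
      rw [pow_succ', Module.End.mul_apply]
      exact add_mem (Submodule.smul_mem _ _ (mulX1_mem_hermSpan _ _ _ ih))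
        (Submodule.smul_mem _ _ (mulX2_mem_hermSpan _ _ _ ih))
  have hval : ∀ (n : ℕ) (x : ℝ × ℝ), (((L (1, 0) : ℂ) • mulX1 + (L (0, 1) : ℂ) • mulX2) ^ n)
      (ground hħ hω₁ hω₂) x = (L x : ℂ) ^ n * ground hħ hω₁ hω₂ x := fun n x => by
    induction n with
    | zero => simp
    | succ n ih =>
      rw [pow_succ', Module.End.mul_apply, LinearMap.add_apply, LinearMap.smul_apply,
        LinearMap.smul_apply, _root_.add_apply, _root_.smul_apply,
        _root_.smul_apply, mulX1_apply, mulX2_apply, ih, hL x, smul_eq_mul, smul_eq_mul]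
      push_cast; ring
  rw [← hV _ (hmem n), inner_toL2_left]
  congr 1; ext x
  rw [hval, map_mul, map_pow, Complex.conj_ofReal, ground, gaussian_apply, Complex.conj_ofReal]

theorem isAdj_one (ħ ω₁ ω₂ : ℝ) (l m : ℕ) : IsAdj (opA ħ ω₁ ω₂ l m .one) (opA ħ ω₁ ω₂ l m .one) :=
  (isAdj_b1s ħ ω₁).mul (isAdj_b1s ħ ω₁).symm

theorem isAdj_two (ħ ω₁ ω₂ : ℝ) (l m : ℕ) : IsAdj (opA ħ ω₁ ω₂ l m .two) (opA ħ ω₁ ω₂ l m .two) :=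
  (isAdj_b2s ħ ω₂).mul (isAdj_b2s ħ ω₂).symm

/-- Eigenvectors of a symmetric operator with distinct real eigenvalues are orthogonal. -/
theorem IsAdj.inner_eq_zero {T : Module.End ℂ Sch} (hT : IsAdj T T) {f g : Sch} {s t : ℝ}
    (hf : T f = (s : ℂ) • f) (hg : T g = (t : ℂ) • g) (hst : s ≠ t) :
    inner ℂ (toL2 f) (toL2 g) = 0 := by
  have h := hT f g
  rw [hf, hg, map_smul, map_smul, inner_smul_left, inner_smul_right, Complex.conj_ofReal,
    ← sub_eq_zero, ← sub_mul, mul_eq_zero] at h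
  refine h.resolve_left fun h0 => hst ?_
  exact_mod_cast sub_eq_zero.1 h0

/-- The joint eigenspaces of `A₁`, `A₂` are spanned by Hermite functions. -/
theorem exists_eq_smul_herm {l m j k : ℕ} {χ : Sch}
    (h1 : opA ħ ω₁ ω₂ l m .one χ = (ħ * j : ℂ) • χ)
    (h2 : opA ħ ω₁ ω₂ l m .two χ = (ħ * k : ℂ) • χ) :
    ∃ c : ℂ, toL2 χ = c • toL2 (herm hħ hω₁ hω₂ j k) := by
  set e := herm hħ hω₁ hω₂ with he
  have hne : inner ℂ (toL2 (e j k)) (toL2 (e j k)) ≠ (0 : ℂ) :=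
    inner_self_ne_zero.2 fun h => herm_ne_zero hħ hω₁ hω₂ j k
      (toL2_injective (h.trans (map_zero toL2).symm))
  refine ⟨inner ℂ (toL2 (e j k)) (toL2 χ) / inner ℂ (toL2 (e j k)) (toL2 (e j k)), ?_⟩
  rw [← sub_eq_zero]
  refine eq_zero_of_inner_herm hħ hω₁ hω₂ _ fun j' k' => ?_
  rw [inner_sub_right, inner_smul_right, ← he]
  by_cases hjk : j' = j ∧ k' = k
  · rw [hjk.1, hjk.2, div_mul_cancel₀ _ hne, sub_self]
  · have key : ∀ g : Sch, opA ħ ω₁ ω₂ l m .one g = (ħ * j : ℂ) • g →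
        opA ħ ω₁ ω₂ l m .two g = (ħ * k : ℂ) • g → inner ℂ (toL2 (e j' k')) (toL2 g) = 0 := by
      intro g hg1 hg2
      rw [not_and_or] at hjk
      rcases hjk with hj | hk
      · refine (isAdj_one ħ ω₁ ω₂ l m).inner_eq_zero (s := ħ * j') (t := ħ * j) ?_ ?_
          fun h => hj (by exact_mod_cast mul_left_cancel₀ hħ.ne' h)
        · rw [he, opA_one_herm]; push_cast; rfl
        · rw [hg1]; push_cast; rfl
      · refine (isAdj_two ħ ω₁ ω₂ l m).inner_eq_zero (s := ħ * k') (t := ħ * k) ?_ ?_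
          fun h => hk (by exact_mod_cast mul_left_cancel₀ hħ.ne' h)
        · rw [he, opA_two_herm]; push_cast; rfl
        · rw [hg2]; push_cast; rfl
    rw [key χ h1 h2, key (e j k) (opA_one_herm ..) (opA_two_herm ..), mul_zero, sub_zero]

end Hermite

/-! ### Representations of the resonance algebra -/

/-- The four elements `x` satisfy the relations of the resonance algebra. -/
structure IsResRep {B : Type*} [Ring B] [Algebra ℂ B] (ħ : ℝ) (l m : ℕ) (x : Gen → B) : Prop where
  one_two : x .one * x .two = x .two * x .one
  one_plus : x .one * x .plus = x .plus * x .one - (ħ * m : ℂ) • x .plus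
  one_minus : x .one * x .minus = x .minus * x .one + (ħ * m : ℂ) • x .minus
  two_plus : x .two * x .plus = x .plus * x .two + (ħ * l : ℂ) • x .plus
  two_minus : x .two * x .minus = x .minus * x .two - (ħ * l : ℂ) • x .minus
  minus_plus : x .minus * x .plus = x .plus * x .minus +
    (rho ħ l m (x .one - algebraMap ℂ B (ħ * m)) (x .two + algebraMap ℂ B (ħ * l))
      - rho ħ l m (x .one) (x .two))

section Abstract

variable {ħ : ℝ} {l m : ℕ}

theorem map_rho {B C : Type*} [Ring B] [Algebra ℂ B] [Ring C] [Algebra ℂ C] (f : B →ₐ[ℂ] C)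
    (x y : B) : f (rho ħ l m x y) = rho ħ l m (f x) (f y) := by
  simp only [rho, map_mul, Polynomial.aeval_algHom_apply]

theorem isResRep_gen : IsResRep ħ l m (gen ħ l m) := by
  have h : ∀ {a b : FreeAlgebra ℂ Gen}, ResRel ħ l m a b →
      RingQuot.mkAlgHom ℂ (ResRel ħ l m) a = RingQuot.mkAlgHom ℂ (ResRel ħ l m) b :=
    fun hr => RingQuot.mkAlgHom_rel ℂ hr
  have h1 := h .comm12
  have h2 := h .comm1p
  have h3 := h .comm1m
  have h4 := h .comm2p
  have h5 := h .comm2m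
  have h6 := h .commmp
  simp only [Ring.lie_def, map_sub, map_mul, map_zero, map_smul, map_rho, map_add,
    AlgHom.commutes, neg_smul, map_neg] at h1 h2 h3 h4 h5 h6
  exact ⟨sub_eq_zero.1 h1, by rw [sub_eq_iff_eq_add] at h2; rw [gen, gen, h2]; abel,
    by rw [sub_eq_iff_eq_add] at h3; rw [gen, gen, h3]; abel,
    by rw [sub_eq_iff_eq_add] at h4; rw [gen, gen, h4]; abel,
    by rw [sub_eq_iff_eq_add] at h5; rw [gen, gen, h5]; abel,
    by rw [sub_eq_iff_eq_add] at h6; simp only [gen, h6, map_mul]; abel⟩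

/-- Induction on elements of the resonance algebra. -/
theorem resAlg_induction {C : ResAlg ħ l m → Prop} (hs : ∀ c : ℂ, C (algebraMap ℂ _ c))
    (hg : ∀ g, C (gen ħ l m g)) (hm : ∀ a b, C a → C b → C (a * b))
    (ha : ∀ a b, C a → C b → C (a + b)) (F : ResAlg ħ l m) : C F := by
  obtain ⟨x, rfl⟩ := RingQuot.mkAlgHom_surjective ℂ (ResRel ħ l m) F
  induction x using FreeAlgebra.induction with
  | grade0 c => rw [AlgHom.commutes]; exact hs c
  | grade1 g => exact hg g
  | mul a b iha ihb => rw [map_mul]; exact hm _ _ iha ihb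
  | add a b iha ihb => rw [map_add]; exact ha _ _ iha ihb

/-- Elements satisfying the relations define a unique representation. -/
theorem IsResRep.existsUnique {B : Type*} [Ring B] [Algebra ℂ B] {x : Gen → B}
    (hx : IsResRep ħ l m x) : ∃! π : ResAlg ħ l m →ₐ[ℂ] B, ∀ g, π (gen ħ l m g) = x g := by
  have hι : ∀ g, FreeAlgebra.lift ℂ x (fgen g) = x g := fun g => FreeAlgebra.lift_ι_apply x g
  refine ⟨RingQuot.liftAlgHom ℂ ⟨FreeAlgebra.lift ℂ x, fun {a b} hr => ?_⟩, fun g => ?_,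
    fun π hπ => ?_⟩
  · obtain ⟨h1, h2, h3, h4, h5, h6⟩ := hx
    cases hr <;> simp only [Ring.lie_def, map_sub, map_mul, map_zero, map_smul, map_rho, map_add,
      AlgHom.commutes, neg_smul, map_neg, hι]
    · rw [h1, sub_self]
    · rw [h2]; abel
    · rw [h3]; abel
    · rw [h4]; abel
    · rw [h5]; abel
    · rw [h6]; simp only [← map_mul]; abel
  · rw [gen, RingQuot.liftAlgHom_mkAlgHom_apply, hι]
  · refine AlgHom.ext fun F => ?_
    induction F using resAlg_induction with
    | hs c => rw [AlgHom.commutes, AlgHom.commutes]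
    | hg g => rw [hπ, gen, RingQuot.liftAlgHom_mkAlgHom_apply, hι]
    | hm a b ha hb => rw [map_mul, map_mul, ha, hb]
    | ha a b ha hb => rw [map_add, map_add, ha, hb]

/-- The ordered monomials. -/
def ordMono {B : Type*} [Ring B] (x : Gen → B) (s : Gen →₀ ℕ) : B :=
  x .plus ^ s .plus * x .one ^ s .one * x .two ^ s .two * x .minus ^ s .minus

theorem ordEval_eq_constr {B : Type*} [Ring B] [Algebra ℂ B] (x : Gen → B)
    (P : MvPolynomial Gen ℂ) :
    ordEval x P = (MvPolynomial.basisMonomials Gen ℂ).constr ℂ (ordMono x) P := by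
  rw [Module.Basis.constr_apply]
  rfl

theorem map_ordEval {B C : Type*} [Ring B] [Algebra ℂ B] [Ring C] [Algebra ℂ C] (f : B →ₐ[ℂ] C)
    (x : Gen → B) (P : MvPolynomial Gen ℂ) : f (ordEval x P) = ordEval (fun g => f (x g)) P := by
  simp only [ordEval, map_sum, map_smul, map_mul, map_pow]

/-- The span of the ordered monomials. -/
def ordSpan {B : Type*} [Ring B] [Algebra ℂ B] (x : Gen → B) : Submodule ℂ B :=
  Submodule.span ℂ (range fun i : ℕ × ℕ × ℕ × ℕ =>
    x .plus ^ i.1 * x .one ^ i.2.1 * x .two ^ i.2.2.1 * x .minus ^ i.2.2.2)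

theorem exists_ordEval_of_mem_ordSpan {B : Type*} [Ring B] [Algebra ℂ B] {x : Gen → B} {F : B}
    (hF : F ∈ ordSpan x) : ∃ P : MvPolynomial Gen ℂ, F = ordEval x P := by
  have h : ordSpan x ≤ LinearMap.range ((MvPolynomial.basisMonomials Gen ℂ).constr ℂ
      (ordMono x)) := by
    refine Submodule.span_le.2 ?_
    rintro _ ⟨⟨a, b, c, d⟩, rfl⟩
    classical
    rw [Module.Basis.constr_range]
    refine Submodule.subset_span ⟨Finsupp.single .plus a + Finsupp.single .one b +
      Finsupp.single .two c + Finsupp.single .minus d, ?_⟩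
    simp [ordMono]
  obtain ⟨P, hP⟩ := h hF
  exact ⟨P, by rw [ordEval_eq_constr, hP]⟩

/-- Left multiplication preserves the ordered span if it maps the ordered monomials into it. -/
theorem mul_mem_ordSpan {B : Type*} [Ring B] [Algebra ℂ B] {x : Gen → B} {y F : B}
    (h : ∀ a b c d : ℕ,
      y * (x .plus ^ a * x .one ^ b * x .two ^ c * x .minus ^ d) ∈ ordSpan x)
    (hF : F ∈ ordSpan x) : y * F ∈ ordSpan x := by
  have : ordSpan x ≤ (ordSpan x).comap (LinearMap.mulLeft ℂ y) := by
    refine Submodule.span_le.2 ?_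
    rintro _ ⟨⟨a, b, c, d⟩, rfl⟩
    exact h a b c d
  exact this hF

theorem aeval_mul_mem_ordSpan {B : Type*} [Ring B] [Algebra ℂ B] {x : Gen → B} {y F : B}
    (P : ℂ[X]) (h : ∀ X ∈ ordSpan x, y * X ∈ ordSpan x) (hF : F ∈ ordSpan x) :
    Polynomial.aeval y P * F ∈ ordSpan x := by
  have hp : ∀ (n : ℕ), y ^ n * F ∈ ordSpan x := fun n => by
    induction n with
    | zero => simpa using hF
    | succ n ih => rw [pow_succ', mul_assoc]; exact h _ ih
  rw [Polynomial.aeval_eq_sum_range, Finset.sum_mul]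
  refine Submodule.sum_mem _ fun n _ => ?_
  rw [smul_mul_assoc]
  exact Submodule.smul_mem _ _ (hp n)

/-- The span of the ordered monomials is a left ideal of the algebra generated by `x`. -/
theorem IsResRep.gen_mul_mem_ordSpan {B : Type*} [Ring B] [Algebra ℂ B] {x : Gen → B}
    (hx : IsResRep ħ l m x) (g : Gen) {F : B} (hF : F ∈ ordSpan x) : x g * F ∈ ordSpan x := by
  have hmono : ∀ a b c d : ℕ,
      x .plus ^ a * x .one ^ b * x .two ^ c * x .minus ^ d ∈ ordSpan x :=
    fun a b c d => Submodule.subset_span ⟨(a, b, c, d), rfl⟩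
  have hplus : ∀ X ∈ ordSpan x, x .plus * X ∈ ordSpan x := fun X hX =>
    mul_mem_ordSpan (fun a b c d => by
      simpa only [pow_succ', mul_assoc] using hmono (a + 1) b c d) hX
  have hone : ∀ X ∈ ordSpan x, x .one * X ∈ ordSpan x := fun X hX => by
    refine mul_mem_ordSpan (fun a => ?_) hX
    induction a with
    | zero =>
      intro b c d
      simpa only [pow_succ', mul_assoc, pow_zero, one_mul] using hmono 0 (b + 1) c d
    | succ a ih =>
      intro b c d
      have h := sub_mem (hplus _ (ih b c d))
        (Submodule.smul_mem _ (ħ * m : ℂ) (hplus _ (hmono a b c d)))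
      convert h using 1
      simp only [pow_succ', ← mul_assoc, hx.one_plus, sub_mul, smul_mul_assoc]
  have htwo : ∀ X ∈ ordSpan x, x .two * X ∈ ordSpan x := fun X hX => by
    have hc : ∀ b : ℕ, x .two * x .one ^ b = x .one ^ b * x .two := fun b =>
      (Commute.pow_right (show Commute (x .two) (x .one) from hx.one_two.symm) b).eq
    refine mul_mem_ordSpan (fun a => ?_) hX
    induction a with
    | zero =>
      intro b c d
      have h := hmono 0 b (c + 1) d
      convert h using 1
      simp only [pow_zero, one_mul, pow_succ', ← mul_assoc, hc]
    | succ a ih =>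
      intro b c d
      have h := add_mem (hplus _ (ih b c d))
        (Submodule.smul_mem _ (ħ * l : ℂ) (hplus _ (hmono a b c d)))
      convert h using 1
      simp only [pow_succ', ← mul_assoc, hx.two_plus, add_mul, smul_mul_assoc]
  have hshift : ∀ (y : B) (c : ℂ), (∀ X ∈ ordSpan x, y * X ∈ ordSpan x) →
      ∀ X ∈ ordSpan x, (y + algebraMap ℂ B c) * X ∈ ordSpan x := fun y c hy X hX => by
    rw [add_mul, ← Algebra.smul_def]
    exact add_mem (hy X hX) (Submodule.smul_mem _ _ hX)
  have hminus : ∀ X ∈ ordSpan x, x .minus * X ∈ ordSpan x := fun X hX => by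
    refine mul_mem_ordSpan (fun a => ?_) hX
    induction a with
    | zero =>
      intro b
      simp only [pow_zero, one_mul]
      induction b with
      | zero =>
        intro c
        simp only [pow_zero, one_mul]
        induction c with
        | zero =>
          intro d
          simpa only [pow_succ', mul_assoc, pow_zero, one_mul] using hmono 0 0 0 (d + 1)
        | succ c ih =>
          intro d
          have h := add_mem (htwo _ (ih d)) (Submodule.smul_mem _ (ħ * l : ℂ) (ih d))
          convert h using 1
          simp only [pow_succ', ← mul_assoc, hx.two_minus, sub_mul, smul_mul_assoc,
            sub_add_cancel]
      | succ b ih =>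
        intro c d
        have h := sub_mem (hone _ (ih c d)) (Submodule.smul_mem _ (ħ * m : ℂ) (ih c d))
        convert h using 1
        simp only [pow_succ', ← mul_assoc, hx.one_minus, add_mul, smul_mul_assoc,
          add_sub_cancel_right]
    | succ a ih =>
      intro b c d
      have hM := hmono a b c d
      have h1 : rho ħ l m (x .one) (x .two) *
          (x .plus ^ a * x .one ^ b * x .two ^ c * x .minus ^ d) ∈ ordSpan x := by
        rw [rho, mul_assoc]
        exact aeval_mul_mem_ordSpan _ hone (aeval_mul_mem_ordSpan _ htwo hM)
      have h2 : rho ħ l m (x .one - algebraMap ℂ B (ħ * m)) (x .two + algebraMap ℂ B (ħ * l)) *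
          (x .plus ^ a * x .one ^ b * x .two ^ c * x .minus ^ d) ∈ ordSpan x := by
        rw [rho, mul_assoc, sub_eq_add_neg, ← map_neg]
        exact aeval_mul_mem_ordSpan _ (hshift _ _ hone)
          (aeval_mul_mem_ordSpan _ (hshift _ _ htwo) hM)
      have h := add_mem (hplus _ (ih b c d)) (sub_mem h2 h1)
      convert h using 1
      rw [← sub_mul, ← mul_assoc (x .plus) (x .minus), ← add_mul, ← hx.minus_plus]
      simp only [pow_succ', mul_assoc]
  cases g
  exacts [hone F hF, htwo F hF, hplus F hF, hminus F hF]

/-- Every element of the resonance algebra is an ordered polynomial in the generators. -/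
theorem exists_ordEval (F : ResAlg ħ l m) :
    ∃ P : MvPolynomial Gen ℂ, F = ordEval (gen ħ l m) P := by
  refine exists_ordEval_of_mem_ordSpan ?_
  have h : ∀ X ∈ ordSpan (gen ħ l m), F * X ∈ ordSpan (gen ħ l m) := by
    induction F using resAlg_induction with
    | hs c => intro X hX; rw [← Algebra.smul_def]; exact Submodule.smul_mem _ _ hX
    | hg g => exact fun X hX => isResRep_gen.gen_mul_mem_ordSpan g hX
    | hm a b ha hb => intro X hX; rw [mul_assoc]; exact ha _ (hb _ hX)
    | ha a b ha hb => intro X hX; rw [add_mul]; exact add_mem (ha _ hX) (hb _ hX)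
  have h1 := h 1 (Submodule.subset_span ⟨(0, 0, 0, 0), by simp⟩)
  rwa [mul_one] at h1

end Abstract

/-! ### The polynomials `ρ₊`, `ρ₋` -/

theorem rhoPlusPoly_eval (ħ : ℝ) (m : ℕ) (x : ℂ) :
    (rhoPlusPoly ħ m).eval x = ∏ j ∈ Finset.range m, (x + ((j : ℂ) + 1) * ħ) := by
  simp [rhoPlusPoly, Polynomial.eval_prod]

theorem rhoMinusPoly_eval (ħ : ℝ) (l : ℕ) (x : ℂ) :
    (rhoMinusPoly ħ l).eval x = ∏ s ∈ Finset.range l, (x - (s : ℂ) * ħ) := by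
  simp [rhoMinusPoly, Polynomial.eval_prod]

theorem rhoPlusPoly_comp (ħ : ℝ) (m : ℕ) :
    (rhoPlusPoly ħ m).comp (Polynomial.X - Polynomial.C (ħ * m : ℂ)) = rhoMinusPoly ħ m := by
  refine Polynomial.funext fun x => ?_
  rw [Polynomial.eval_comp, rhoPlusPoly_eval, rhoMinusPoly_eval, ← Finset.prod_range_reflect]
  refine Finset.prod_congr rfl fun j hj => ?_
  have hj' : j + 1 ≤ m := Finset.mem_range.1 hj
  rw [Nat.sub_sub, Nat.cast_sub (by omega)]
  simp only [Polynomial.eval_sub, Polynomial.eval_X, Polynomial.eval_C]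
  push_cast; ring

theorem rhoMinusPoly_comp (ħ : ℝ) (l : ℕ) :
    (rhoMinusPoly ħ l).comp (Polynomial.X + Polynomial.C (ħ * l : ℂ)) = rhoPlusPoly ħ l := by
  refine Polynomial.funext fun x => ?_
  rw [Polynomial.eval_comp, rhoPlusPoly_eval, rhoMinusPoly_eval, ← Finset.prod_range_reflect]
  refine Finset.prod_congr rfl fun j hj => ?_
  have hj' : j + 1 ≤ l := Finset.mem_range.1 hj
  rw [Nat.sub_sub, Nat.cast_sub (by omega)]
  simp only [Polynomial.eval_add, Polynomial.eval_X, Polynomial.eval_C]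
  push_cast; ring

/-- The value of `ρ` at shifted arguments, in the form in which it comes from oscillators. -/
theorem rho_shift {B : Type*} [Ring B] [Algebra ℂ B] (ħ : ℝ) (l m : ℕ) (x y : B) :
    rho ħ l m (x - algebraMap ℂ B (ħ * m)) (y + algebraMap ℂ B (ħ * l)) =
      Polynomial.aeval x (rhoMinusPoly ħ m) * Polynomial.aeval y (rhoPlusPoly ħ l) := by
  rw [rho, ← rhoPlusPoly_comp, ← rhoMinusPoly_comp, Polynomial.aeval_comp, Polynomial.aeval_comp]
  simp

section Ladder

variable {B : Type*} [Ring B] [Algebra ℂ B] {b bs : B} {c : ℂ}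

theorem number_mul_lower (h : b * bs = bs * b + algebraMap ℂ B c) (n : ℕ) :
    bs * b * b ^ n = b ^ n * (bs * b) - (n * c : ℂ) • b ^ n := by
  induction n with
  | zero => simp
  | succ n ih =>
    have h1 : bs * b = b * bs - algebraMap ℂ B c := by rw [h]; abel
    have h2 : bs * b * b = b * (bs * b) - c • b := by
      conv_lhs => rw [h1]
      rw [sub_mul, mul_assoc, ← Algebra.smul_def]
    rw [pow_succ, ← mul_assoc, ih, sub_mul, mul_assoc (b ^ n) (bs * b), h2, mul_sub]
    simp only [mul_smul_comm, smul_mul_assoc, ← mul_assoc]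
    push_cast
    module

theorem raise_pow_mul_lower_pow {ħ : ℝ} (h : b * bs = bs * b + algebraMap ℂ B (ħ : ℂ)) (n : ℕ) :
    bs ^ n * b ^ n = Polynomial.aeval (bs * b) (rhoMinusPoly ħ n) := by
  induction n with
  | zero => simp [rhoMinusPoly]
  | succ n ih =>
    have h1 : bs ^ n * (bs * b) = (bs * b - algebraMap ℂ B (n * ħ)) * bs ^ n := by
      rw [sub_mul, ← Algebra.smul_def, number_mul_raise h]; abel
    rw [rhoMinusPoly, Finset.prod_range_succ_comm, ← rhoMinusPoly, map_mul, ← ih, pow_succ,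
      pow_succ' b, mul_assoc, ← mul_assoc bs, ← mul_assoc, h1, mul_assoc]
    simp

theorem lower_pow_mul_raise_pow {ħ : ℝ} (h : b * bs = bs * b + algebraMap ℂ B (ħ : ℂ)) (n : ℕ) :
    b ^ n * bs ^ n = Polynomial.aeval (bs * b) (rhoPlusPoly ħ n) := by
  induction n with
  | zero => simp [rhoPlusPoly]
  | succ n ih =>
    have h1 : b ^ n * (bs * b + algebraMap ℂ B (ħ : ℂ)) =
        (bs * b + algebraMap ℂ B ((n + 1) * ħ)) * b ^ n := by
      rw [add_mul, ← Algebra.smul_def, number_mul_lower h, mul_add, ← Algebra.commutes,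
        ← Algebra.smul_def]
      module
    rw [rhoPlusPoly, Finset.prod_range_succ_comm, ← rhoPlusPoly, map_mul, ← ih, pow_succ b,
      pow_succ' bs, mul_assoc, ← mul_assoc b, h, ← mul_assoc, h1, mul_assoc]
    simp

end Ladder

/-! ### The oscillator representation -/

section Oscillator

variable {ħ ω₁ ω₂ : ℝ} (hω₁ : 0 < ω₁) (hω₂ : 0 < ω₂) (l m : ℕ)

include hω₁ hω₂

theorem opA_minus_mul_plus : opA ħ ω₁ ω₂ l m .minus * opA ħ ω₁ ω₂ l m .plus =
    rho ħ l m (opA ħ ω₁ ω₂ l m .one - algebraMap ℂ _ (ħ * m))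
      (opA ħ ω₁ ω₂ l m .two + algebraMap ℂ _ (ħ * l)) := by
  have hc : b2 ħ ω₂ ^ l * b2s ħ ω₂ ^ l * b1 ħ ω₁ ^ m =
      b1 ħ ω₁ ^ m * (b2 ħ ω₂ ^ l * b2s ħ ω₂ ^ l) :=
    (((commute_b1_b2 ħ ω₁ ω₂).pow_pow m l).mul_right
      ((commute_b1_b2s ħ ω₁ ω₂).pow_pow m l)).eq.symm
  rw [rho_shift]
  simp only [opA]
  rw [← raise_pow_mul_lower_pow (b1_mul_b1s ħ hω₁), ← lower_pow_mul_raise_pow (b2_mul_b2s ħ hω₂),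
    mul_assoc, ← mul_assoc (b2 ħ ω₂ ^ l), hc, mul_assoc]

theorem opA_plus_mul_minus : opA ħ ω₁ ω₂ l m .plus * opA ħ ω₁ ω₂ l m .minus =
    rho ħ l m (opA ħ ω₁ ω₂ l m .one) (opA ħ ω₁ ω₂ l m .two) := by
  have hc : b1 ħ ω₁ ^ m * b1s ħ ω₁ ^ m * b2 ħ ω₂ ^ l =
      b2 ħ ω₂ ^ l * (b1 ħ ω₁ ^ m * b1s ħ ω₁ ^ m) :=
    (((commute_b1_b2 ħ ω₁ ω₂).pow_pow m l).mul_left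
      ((commute_b1s_b2 ħ ω₁ ω₂).pow_pow m l)).eq
  have hc' : b2s ħ ω₂ ^ l * (b2 ħ ω₂ ^ l * (b1 ħ ω₁ ^ m * b1s ħ ω₁ ^ m)) =
      b1 ħ ω₁ ^ m * b1s ħ ω₁ ^ m * (b2s ħ ω₂ ^ l * b2 ħ ω₂ ^ l) := by
    rw [← mul_assoc]
    refine (Commute.mul_right (Commute.mul_left ?_ ?_) (Commute.mul_left ?_ ?_)).eq
    · exact ((commute_b1_b2s ħ ω₁ ω₂).pow_pow m l).symm
    · exact ((commute_b1_b2 ħ ω₁ ω₂).pow_pow m l).symm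
    · exact ((commute_b1s_b2s ħ ω₁ ω₂).pow_pow m l).symm
    · exact ((commute_b1s_b2 ħ ω₁ ω₂).pow_pow m l).symm
  rw [rho]
  simp only [opA]
  rw [← raise_pow_mul_lower_pow (b2_mul_b2s ħ hω₂), ← lower_pow_mul_raise_pow (b1_mul_b1s ħ hω₁),
    mul_assoc, ← mul_assoc (b1 ħ ω₁ ^ m), hc, hc']

theorem isResRep_opA : IsResRep ħ l m (opA ħ ω₁ ω₂ l m) where
  one_two := by
    refine (Commute.mul_right (Commute.mul_left ?_ ?_) (Commute.mul_left ?_ ?_)).eq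
    · exact commute_b1s_b2s ħ ω₁ ω₂
    · exact commute_b1_b2s ħ ω₁ ω₂
    · exact commute_b1s_b2 ħ ω₁ ω₂
    · exact commute_b1_b2 ħ ω₁ ω₂
  one_plus := by
    have hc : b1s ħ ω₁ * b1 ħ ω₁ * b2s ħ ω₂ ^ l = b2s ħ ω₂ ^ l * (b1s ħ ω₁ * b1 ħ ω₁) :=
      (((commute_b1s_b2s ħ ω₁ ω₂).pow_right l).mul_left
        ((commute_b1_b2s ħ ω₁ ω₂).pow_right l)).eq
    simp only [opA]
    rw [← mul_assoc, hc, mul_assoc, number_mul_lower (b1_mul_b1s ħ hω₁), mul_sub, mul_smul_comm,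
      mul_comm (m : ℂ), mul_assoc]
  one_minus := by
    have hc : b1s ħ ω₁ * b1 ħ ω₁ * b2 ħ ω₂ ^ l = b2 ħ ω₂ ^ l * (b1s ħ ω₁ * b1 ħ ω₁) :=
      (((commute_b1s_b2 ħ ω₁ ω₂).pow_right l).mul_left
        ((commute_b1_b2 ħ ω₁ ω₂).pow_right l)).eq
    simp only [opA]
    rw [← mul_assoc, number_mul_raise (b1_mul_b1s ħ hω₁), add_mul, smul_mul_assoc, mul_assoc, hc,
      mul_comm (m : ℂ), mul_assoc (b1s ħ ω₁ ^ m) (b2 ħ ω₂ ^ l)]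
  two_plus := by
    have hc : b1 ħ ω₁ ^ m * (b2s ħ ω₂ * b2 ħ ω₂) = b2s ħ ω₂ * b2 ħ ω₂ * b1 ħ ω₁ ^ m :=
      (((commute_b1_b2s ħ ω₁ ω₂).pow_left m).mul_right
        ((commute_b1_b2 ħ ω₁ ω₂).pow_left m)).eq
    simp only [opA]
    rw [← mul_assoc, number_mul_raise (b2_mul_b2s ħ hω₂), add_mul, smul_mul_assoc, mul_assoc, ← hc,
      mul_comm (l : ℂ), mul_assoc (b2s ħ ω₂ ^ l) (b1 ħ ω₁ ^ m)]
  two_minus := by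
    have hc : b2s ħ ω₂ * b2 ħ ω₂ * b1s ħ ω₁ ^ m = b1s ħ ω₁ ^ m * (b2s ħ ω₂ * b2 ħ ω₂) :=
      (((commute_b1s_b2s ħ ω₁ ω₂).pow_left m).mul_right
        ((commute_b1s_b2 ħ ω₁ ω₂).pow_left m)).eq.symm
    simp only [opA]
    rw [← mul_assoc, hc, mul_assoc, number_mul_lower (b2_mul_b2s ħ hω₂), mul_sub, mul_smul_comm,
      mul_comm (l : ℂ), mul_assoc]
  minus_plus := by
    rw [opA_minus_mul_plus hω₁ hω₂, opA_plus_mul_minus hω₁ hω₂]; abel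

end Oscillator

theorem isAdj_minus (ħ ω₁ ω₂ : ℝ) (l m : ℕ) :
    IsAdj (opA ħ ω₁ ω₂ l m .minus) (opA ħ ω₁ ω₂ l m .plus) :=
  ((isAdj_b1s ħ ω₁).pow m).mul ((isAdj_b2s ħ ω₂).symm.pow l)

/-! ### The representation on polynomials -/

theorem aeval_coeff_of_diag {T : Module.End ℂ ℂ[X]} {e : ℕ → ℂ}
    (hT : ∀ phi n, (T phi).coeff n = e n * phi.coeff n) (P phi : ℂ[X]) (n : ℕ) :
    (Polynomial.aeval T P phi).coeff n = P.eval (e n) * phi.coeff n := by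
  induction P using Polynomial.induction_on' generalizing phi with
  | add f g hf hg => simp [hf, hg, add_mul]
  | monomial k c =>
    induction k generalizing phi with
    | zero => simp [Module.algebraMap_end_apply]
    | succ k ih =>
      have h := ih (T phi)
      simp only [Polynomial.aeval_monomial, Polynomial.eval_monomial, pow_succ,
        Module.End.mul_apply] at h ⊢
      rw [h, hT]
      ring

/-- The eigenvalues of `a₁` on `z̄ⁿ`, which are those of `A₁` on `A₊ⁿ P0`. -/
noncomputable def eig1 (ħ : ℝ) (m r p n : ℕ) : ℂ := ħ * (r * m + p) - ħ * m * n

/-- The eigenvalues of `a₂` on `z̄ⁿ`, which are those of `A₂` on `A₊ⁿ P0`. -/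
noncomputable def eig2 (ħ : ℝ) (l q n : ℕ) : ℂ := ħ * q + ħ * l * n

section PolRep

variable {ħ : ℝ} {l m r q p : ℕ}

theorem euler_coeff (phi : ℂ[X]) (n : ℕ) : (euler phi).coeff n = n * phi.coeff n := by
  simpa using aeval_euler_coeff Polynomial.X phi n

theorem opPol_one_coeff (phi : ℂ[X]) (n : ℕ) :
    (opPol ħ l m r q p .one phi).coeff n = eig1 ħ m r p n * phi.coeff n := by
  simp [opPol, euler_coeff, eig1]; ring

theorem opPol_two_coeff (phi : ℂ[X]) (n : ℕ) :
    (opPol ħ l m r q p .two phi).coeff n = eig2 ħ l q n * phi.coeff n := by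
  simp [opPol, euler_coeff, eig2]; ring

theorem opPol_plus_coeff_zero (phi : ℂ[X]) : (opPol ħ l m r q p .plus phi).coeff 0 = 0 := by
  simp [opPol, aeval_euler_coeff, mulVar]

theorem opPol_plus_coeff_succ (phi : ℂ[X]) (n : ℕ) :
    (opPol ħ l m r q p .plus phi).coeff (n + 1) =
      (rhoPlusPoly ħ m).eval (eig1 ħ m r p (n + 1)) * phi.coeff n := by
  simp only [opPol, LinearMap.smul_apply, Module.End.mul_apply, Polynomial.coeff_smul,
    aeval_euler_coeff, mulVar, LinearMap.mulLeft_apply, Polynomial.coeff_X_mul, smul_eq_mul,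
    rhoPlusPoly_eval, Polynomial.eval_prod]
  rw [← mul_assoc]
  congr 1
  rw [show (ħ : ℂ) ^ m = ∏ _j ∈ Finset.range m, (ħ : ℂ) by simp, ← Finset.prod_mul_distrib]
  refine Finset.prod_congr rfl fun j _ => ?_
  simp [eig1]; ring

theorem opPol_minus_coeff (phi : ℂ[X]) (n : ℕ) :
    (opPol ħ l m r q p .minus phi).coeff n =
      (rhoMinusPoly ħ l).eval (eig2 ħ l q (n + 1)) * phi.coeff (n + 1) := by
  simp only [opPol, LinearMap.smul_apply, Module.End.mul_apply, Polynomial.coeff_smul,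
    divVar, LinearMap.coe_mk, AddHom.coe_mk, Polynomial.coeff_divX, aeval_euler_coeff, smul_eq_mul,
    rhoMinusPoly_eval, Polynomial.eval_prod]
  rw [← mul_assoc]
  congr 1
  rw [show (ħ : ℂ) ^ l = ∏ _j ∈ Finset.range l, (ħ : ℂ) by simp, ← Finset.prod_mul_distrib]
  refine Finset.prod_congr rfl fun j _ => ?_
  simp [eig2]; ring

theorem rhoMinusPoly_eval_eig2_zero (hq : q < l) :
    (rhoMinusPoly ħ l).eval (eig2 ħ l q 0) = 0 := by
  rw [rhoMinusPoly_eval]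
  exact Finset.prod_eq_zero (Finset.mem_range.2 hq) (by simp [eig2]; ring)

theorem eig1_succ (n : ℕ) : eig1 ħ m r p (n + 1) = eig1 ħ m r p n - ħ * m := by
  simp [eig1]; ring

theorem eig2_succ (n : ℕ) : eig2 ħ l q (n + 1) = eig2 ħ l q n + ħ * l := by
  simp [eig2]; ring

theorem isResRep_opPol (hq : q < l) : IsResRep ħ l m (opPol ħ l m r q p) := by
  refine ⟨?_, ?_, ?_, ?_, ?_, ?_⟩ <;> refine LinearMap.ext fun phi => Polynomial.ext fun n => ?_
  · simp only [Module.End.mul_apply, opPol_one_coeff, opPol_two_coeff]; ring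
  · cases n with
    | zero => simp [opPol_one_coeff, opPol_plus_coeff_zero]
    | succ n =>
      simp only [Module.End.mul_apply, LinearMap.sub_apply, LinearMap.smul_apply,
        Polynomial.coeff_sub, Polynomial.coeff_smul, opPol_one_coeff, opPol_plus_coeff_succ,
        eig1_succ, smul_eq_mul]
      ring
  · simp only [Module.End.mul_apply, LinearMap.add_apply, LinearMap.smul_apply,
      Polynomial.coeff_add, Polynomial.coeff_smul, opPol_one_coeff, opPol_minus_coeff,
      eig1_succ, smul_eq_mul]
    ring
  · cases n with
    | zero => simp [opPol_two_coeff, opPol_plus_coeff_zero]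
    | succ n =>
      simp only [Module.End.mul_apply, LinearMap.add_apply, LinearMap.smul_apply,
        Polynomial.coeff_add, Polynomial.coeff_smul, opPol_two_coeff, opPol_plus_coeff_succ,
        eig2_succ, smul_eq_mul]
      ring
  · simp only [Module.End.mul_apply, LinearMap.sub_apply, LinearMap.smul_apply,
      Polynomial.coeff_sub, Polynomial.coeff_smul, opPol_two_coeff, opPol_minus_coeff,
      eig2_succ, smul_eq_mul]
    ring
  · have h1 : ∀ phi n, ((opPol ħ l m r q p .one - algebraMap ℂ (Module.End ℂ ℂ[X]) (ħ * m))
        phi).coeff n = eig1 ħ m r p (n + 1) * phi.coeff n := fun phi n => by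
      simp only [LinearMap.sub_apply, Module.algebraMap_end_apply, Polynomial.coeff_sub,
        opPol_one_coeff, Polynomial.coeff_smul, eig1_succ, smul_eq_mul]; ring
    have h2 : ∀ phi n, ((opPol ħ l m r q p .two + algebraMap ℂ (Module.End ℂ ℂ[X]) (ħ * l))
        phi).coeff n = eig2 ħ l q (n + 1) * phi.coeff n := fun phi n => by
      simp only [LinearMap.add_apply, Module.algebraMap_end_apply, Polynomial.coeff_add,
        opPol_two_coeff, Polynomial.coeff_smul, eig2_succ, smul_eq_mul]; ring
    simp only [rho, Module.End.mul_apply, LinearMap.add_apply, LinearMap.sub_apply,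
      Polynomial.coeff_add, Polynomial.coeff_sub, opPol_minus_coeff, opPol_plus_coeff_succ,
      aeval_coeff_of_diag h1, aeval_coeff_of_diag h2, aeval_coeff_of_diag opPol_one_coeff,
      aeval_coeff_of_diag opPol_two_coeff]
    cases n with
    | zero => rw [opPol_plus_coeff_zero, rhoMinusPoly_eval_eig2_zero hq]; ring
    | succ n => rw [opPol_plus_coeff_succ, opPol_minus_coeff]; ring

end PolRep

/-! ### The vectors generated from a vacuum vector -/

theorem aeval_apply_eig {V : Type*} [AddCommGroup V] [Module ℂ V] {T : Module.End ℂ V} {v : V}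
    {c : ℂ} (h : T v = c • v) (P : ℂ[X]) : Polynomial.aeval T P v = P.eval c • v := by
  induction P using Polynomial.induction_on' with
  | add f g hf hg => simp [hf, hg, add_smul]
  | monomial k a =>
    have hk : (T ^ k) v = c ^ k • v := by
      induction k with
      | zero => simp
      | succ k ih => rw [pow_succ', Module.End.mul_apply, ih, map_smul, h, smul_smul, pow_succ]
    simp [Polynomial.aeval_monomial, hk, smul_smul, mul_comm]

theorem eig1_eq {ħ : ℝ} {m r p n : ℕ} (hn : n ≤ r) :
    eig1 ħ m r p n = ((ħ * ((r - n) * m + p : ℕ) : ℝ) : ℂ) := by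
  simp [eig1, Nat.cast_sub hn]; ring

theorem eig2_eq (ħ : ℝ) (l q n : ℕ) : eig2 ħ l q n = ((ħ * (q + n * l : ℕ) : ℝ) : ℂ) := by
  simp [eig2]; ring

/-- Values of `ρ₊` at the eigenvalues of `A₁` are ratios of factorials. -/
theorem rhoPlus_eval_nat (ħ : ℝ) (m j : ℕ) :
    (rhoPlusPoly ħ m).eval ((ħ * (j : ℕ) : ℝ) : ℂ) = ((ħ ^ m * ((j + m)! / j !) : ℝ) : ℂ) := by
  have hj : (j ! : ℂ) ≠ 0 := by exact_mod_cast j.factorial_ne_zero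
  rw [rhoPlusPoly_eval]
  push_cast
  induction m with
  | zero => simp [hj]
  | succ m ih =>
    rw [Finset.prod_range_succ, ih, ← add_assoc, Nat.factorial_succ]
    push_cast
    field_simp
    ring

theorem rhoMinus_eval_nat (ħ : ℝ) (l k : ℕ) :
    (rhoMinusPoly ħ l).eval ((ħ * (k + l : ℕ) : ℝ) : ℂ) = ((ħ ^ l * ((k + l)! / k !) : ℝ) : ℂ) := by
  rw [← rhoPlus_eval_nat, ← rhoMinusPoly_comp, Polynomial.eval_comp]
  congr 1
  simp; ring

/-- The eigenvalue of `A₊ A₋ = ρ(A₁, A₂)` on `A₊ⁿ P0`. -/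
noncomputable def mu (ħ : ℝ) (l m r q p n : ℕ) : ℂ :=
  (rhoPlusPoly ħ m).eval (eig1 ħ m r p n) * (rhoMinusPoly ħ l).eval (eig2 ħ l q n)

theorem mu_succ {ħ : ℝ} {l m r q p n : ℕ} (hn : n < r) : mu ħ l m r q p (n + 1) =
    ((ħ ^ m * ((p + (r - n) * m)! / (p + (r - (n + 1)) * m)!) *
      (ħ ^ l * ((q + (n + 1) * l)! / (q + n * l)!)) : ℝ) : ℂ) := by
  have h1 : (r - (n + 1)) * m + p + m = p + (r - n) * m := by
    obtain ⟨d, rfl⟩ := Nat.exists_eq_add_of_lt hn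
    rw [show n + d + 1 - (n + 1) = d by omega, show n + d + 1 - n = d + 1 by omega]; ring
  have h2 : q + (n + 1) * l = q + n * l + l := by ring
  rw [mu, eig1_eq (by omega), eig2_eq, h2, rhoPlus_eval_nat, rhoMinus_eval_nat, h1,
    add_comm _ p]
  push_cast
  rfl

/-- Since `p < m`, one factor of `ρ₊` vanishes at the (virtual) eigenvalue number `r + 1`. -/
theorem rhoPlus_eval_last {ħ : ℝ} {m r p : ℕ} (hp : p < m) :
    (rhoPlusPoly ħ m).eval (eig1 ħ m r p (r + 1)) = 0 := by
  rw [rhoPlusPoly_eval]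
  refine Finset.prod_eq_zero (i := m - 1 - p) (Finset.mem_range.2 (by omega)) ?_
  rw [Nat.sub_sub, Nat.cast_sub (by omega)]
  simp [eig1]; ring

theorem mu_last {ħ : ℝ} {l m r q p : ℕ} (hp : p < m) : mu ħ l m r q p (r + 1) = 0 := by
  rw [mu, rhoPlus_eval_last hp, zero_mul]

/-- The squared norms of the vectors `A₊ⁿ P0`. -/
noncomputable def towerSq (ħ : ℝ) (l m r q p n : ℕ) : ℝ :=
  (ħ ^ m * ħ ^ l) ^ n * ((p + r * m)! / (p + (r - n) * m)! * ((q + n * l)! / q !))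

theorem towerSq_pos {ħ : ℝ} (hħ : 0 < ħ) (l m r q p n : ℕ) : 0 < towerSq ħ l m r q p n := by
  unfold towerSq; positivity

theorem towerSq_succ {ħ : ℝ} {l m r q p n : ℕ} (hn : n < r) :
    (towerSq ħ l m r q p (n + 1) : ℂ) = mu ħ l m r q p (n + 1) * towerSq ħ l m r q p n := by
  rw [mu_succ hn, ← Complex.ofReal_mul]
  congr 1
  unfold towerSq
  have h : ∀ n : ℕ, (n ! : ℝ) ≠ 0 := fun n => by exact_mod_cast n.factorial_ne_zero
  have h1 := h (p + (r - n) * m)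
  have h2 := h (p + (r - (n + 1)) * m)
  have h3 := h (q + n * l)
  have h4 := h q
  field_simp
  ring

theorem mu_ne_zero {ħ : ℝ} (hħ : 0 < ħ) {l m r q p n : ℕ} (hn : n < r) :
    mu ħ l m r q p (n + 1) ≠ 0 := by
  rw [mu_succ hn]
  have : 0 < ħ ^ m * ((p + (r - n) * m)! / (p + (r - (n + 1)) * m)! : ℝ) *
      (ħ ^ l * ((q + (n + 1) * l)! / (q + n * l)!)) := by positivity
  exact_mod_cast this.ne'

/-- The coefficients of the coherent states. -/
noncomputable def dcoef (ħ : ℝ) (l q n : ℕ) : ℝ := q ! / (q + l * n)! * (1 / ħ ^ l) ^ n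

theorem dcoef_pos {ħ : ℝ} (hħ : 0 < ħ) (l q n : ℕ) : 0 < dcoef ħ l q n := by
  unfold dcoef; positivity

theorem dcoef_succ {ħ : ℝ} (hħ : 0 < ħ) (l q n : ℕ) :
    (dcoef ħ l q (n + 1) : ℂ) * (rhoMinusPoly ħ l).eval (eig2 ħ l q (n + 1)) =
      (dcoef ħ l q n : ℂ) := by
  have h2 : q + (n + 1) * l = q + n * l + l := by ring
  rw [eig2_eq, h2, rhoMinus_eval_nat, ← Complex.ofReal_mul]
  congr 1
  have h : ∀ n : ℕ, (n ! : ℝ) ≠ 0 := fun n => by exact_mod_cast n.factorial_ne_zero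
  have h3 := h (q + n * l + l)
  have h4 := h (q + n * l)
  have h5 : ħ ^ l ≠ 0 := (pow_pos hħ l).ne'
  rw [dcoef, dcoef, pow_succ, mul_comm l (n + 1), mul_comm l n, h2]
  field_simp

theorem kcoef_pos {ħ : ℝ} (hħ : 0 < ħ) (l m r q p n : ℕ) : 0 < kcoef ħ l m r q p n := by
  unfold kcoef; positivity

theorem dcoef_sq_mul_towerSq {ħ : ℝ} (hħ : 0 < ħ) (l m r q p n : ℕ) :
    dcoef ħ l q n ^ 2 * towerSq ħ l m r q p n = kcoef ħ l m r q p n := by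
  unfold dcoef towerSq kcoef
  have h : ∀ n : ℕ, (n ! : ℝ) ≠ 0 := fun n => by exact_mod_cast n.factorial_ne_zero
  have h1 := h (p + (r - n) * m)
  have h3 := h (q + n * l)
  have h4 := h q
  have hz : ħ ^ (((m : ℤ) - l) * n) = (ħ ^ m / ħ ^ l) ^ n := by
    rw [zpow_mul, zpow_sub₀ hħ.ne', zpow_natCast, zpow_natCast, zpow_natCast]
  have hl : ħ ^ l ≠ 0 := (pow_pos hħ l).ne'
  have h5 : ((1 / ħ ^ l) ^ n) ^ 2 * (ħ ^ m * ħ ^ l) ^ n = (ħ ^ m / ħ ^ l) ^ n := by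
    rw [← pow_mul, mul_comm n 2, pow_mul, ← mul_pow]
    congr 1
    field_simp
  rw [hz, mul_comm l n, ← h5]
  field_simp

theorem weight_mul_kcoef {ħ : ℝ} (hħ : 0 < ħ) (l m r q p n : ℕ) :
    weight ħ l m r q p n * kcoef ħ l m r q p n = 1 := by
  unfold weight kcoef
  have h : ∀ n : ℕ, (n ! : ℝ) ≠ 0 := fun n => by exact_mod_cast n.factorial_ne_zero
  have h1 := h (p + (r - n) * m)
  have h2 := h (p + r * m)
  have h3 := h (q + n * l)
  have h4 := h q
  have hz : ħ ^ (((l : ℤ) - m) * n) * ħ ^ (((m : ℤ) - l) * n) = 1 := by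
    rw [← zpow_add₀ hħ.ne']; ring_nf; simp
  field_simp
  exact hz

section Vacuum

variable {ħ ω₁ ω₂ : ℝ} {l m r q p : ℕ} {P0 : Sch}

theorem tower_zero : tower ħ ω₁ ω₂ l m P0 0 = P0 := rfl

theorem tower_succ (n : ℕ) :
    tower ħ ω₁ ω₂ l m P0 (n + 1) = opA ħ ω₁ ω₂ l m .plus (tower ħ ω₁ ω₂ l m P0 n) := by
  rw [tower, tower, pow_succ', Module.End.mul_apply]

theorem coh_eq (z : ℂ) : coh ħ ω₁ ω₂ l m r q P0 z =
    ∑ n ∈ Finset.range (r + 1), ((dcoef ħ l q n : ℂ) * z ^ n) • tower ħ ω₁ ω₂ l m P0 n := by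
  refine Finset.sum_congr rfl fun n _ => ?_
  congr 1
  simp only [dcoef, div_pow]
  push_cast
  rw [one_pow]
  ring

theorem mem_Lsub_iff {ψ : L2} : ψ ∈ Lsub ħ ω₁ ω₂ l m r P0 ↔
    ∃ x : ℕ → ℂ, ψ = ∑ n ∈ Finset.range (r + 1), x n • toL2 (tower ħ ω₁ ω₂ l m P0 n) := by
  rw [Lsub, Submodule.mem_span_range_iff_exists_fun]
  constructor
  · rintro ⟨c, rfl⟩
    refine ⟨fun n => if h : n < r + 1 then c ⟨n, h⟩ else 0, ?_⟩
    rw [Finset.sum_range]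
    refine Finset.sum_congr rfl fun n _ => ?_
    change c n • _ = (if h : (n : ℕ) < r + 1 then c ⟨n, h⟩ else 0) • _
    rw [dif_pos n.2]
  · rintro ⟨x, rfl⟩
    exact ⟨fun n => x n, by rw [Finset.sum_range]⟩

theorem tower_mem_Lsub {n : ℕ} (hn : n ≤ r) :
    toL2 (tower ħ ω₁ ω₂ l m P0 n) ∈ Lsub ħ ω₁ ω₂ l m r P0 :=
  Submodule.subset_span ⟨⟨n, Nat.lt_succ_of_le hn⟩, rfl⟩

theorem coh_mem_Lsub (z : ℂ) : toL2 (coh ħ ω₁ ω₂ l m r q P0 z) ∈ Lsub ħ ω₁ ω₂ l m r P0 :=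
  mem_Lsub_iff.2 ⟨fun n => (dcoef ħ l q n : ℂ) * z ^ n, by simp only [coh_eq, map_sum, map_smul]⟩

variable (hω₁ : 0 < ω₁) (hω₂ : 0 < ω₂) (hv : IsVacuum ħ ω₁ ω₂ l m r q p P0)

include hω₁ hω₂ hv

theorem opA_one_tower (n : ℕ) : opA ħ ω₁ ω₂ l m .one (tower ħ ω₁ ω₂ l m P0 n) =
    eig1 ħ m r p n • tower ħ ω₁ ω₂ l m P0 n := by
  induction n with
  | zero => rw [tower_zero, hv.eig_one]; simp [eig1]
  | succ n ih =>
    rw [tower_succ, ← Module.End.mul_apply, (isResRep_opA hω₁ hω₂ l m).one_plus,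
      LinearMap.sub_apply, Module.End.mul_apply, ih, map_smul, LinearMap.smul_apply, ← sub_smul,
      eig1_succ]

theorem opA_two_tower (n : ℕ) : opA ħ ω₁ ω₂ l m .two (tower ħ ω₁ ω₂ l m P0 n) =
    eig2 ħ l q n • tower ħ ω₁ ω₂ l m P0 n := by
  induction n with
  | zero => rw [tower_zero, hv.eig_two]; simp [eig2]
  | succ n ih =>
    rw [tower_succ, ← Module.End.mul_apply, (isResRep_opA hω₁ hω₂ l m).two_plus,
      LinearMap.add_apply, Module.End.mul_apply, ih, map_smul, LinearMap.smul_apply, ← add_smul,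
      eig2_succ]

theorem opA_minus_tower (n : ℕ) : opA ħ ω₁ ω₂ l m .minus (tower ħ ω₁ ω₂ l m P0 (n + 1)) =
    mu ħ l m r q p (n + 1) • tower ħ ω₁ ω₂ l m P0 n := by
  have h1 : (opA ħ ω₁ ω₂ l m .one - algebraMap ℂ (Module.End ℂ Sch) (ħ * m))
      (tower ħ ω₁ ω₂ l m P0 n) = eig1 ħ m r p (n + 1) • tower ħ ω₁ ω₂ l m P0 n := by
    rw [LinearMap.sub_apply, Module.algebraMap_end_apply, opA_one_tower hω₁ hω₂ hv, ← sub_smul,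
      eig1_succ]
  have h2 : (opA ħ ω₁ ω₂ l m .two + algebraMap ℂ (Module.End ℂ Sch) (ħ * l))
      (tower ħ ω₁ ω₂ l m P0 n) = eig2 ħ l q (n + 1) • tower ħ ω₁ ω₂ l m P0 n := by
    rw [LinearMap.add_apply, Module.algebraMap_end_apply, opA_two_tower hω₁ hω₂ hv, ← add_smul,
      eig2_succ]
  rw [tower_succ, ← Module.End.mul_apply, opA_minus_mul_plus hω₁ hω₂, rho, Module.End.mul_apply,
    aeval_apply_eig h2, map_smul, aeval_apply_eig h1, smul_smul, mul_comm, mu]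

theorem inner_tower_succ (n : ℕ) :
    inner ℂ (toL2 (tower ħ ω₁ ω₂ l m P0 (n + 1))) (toL2 (tower ħ ω₁ ω₂ l m P0 (n + 1))) =
      mu ħ l m r q p (n + 1) *
        inner ℂ (toL2 (tower ħ ω₁ ω₂ l m P0 n)) (toL2 (tower ħ ω₁ ω₂ l m P0 n)) := by
  conv_lhs => rw [tower_succ, (isAdj_minus ħ ω₁ ω₂ l m).symm, ← tower_succ]
  rw [opA_minus_tower hω₁ hω₂ hv, map_smul, inner_smul_right]

theorem inner_tower_self {n : ℕ} (hn : n ≤ r) :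
    inner ℂ (toL2 (tower ħ ω₁ ω₂ l m P0 n)) (toL2 (tower ħ ω₁ ω₂ l m P0 n)) =
      (towerSq ħ l m r q p n : ℂ) := by
  induction n with
  | zero =>
    rw [tower_zero, inner_self_eq_norm_sq_to_K, hv.norm_one]
    have h1 : ((p + r * m)! : ℂ) ≠ 0 := by exact_mod_cast (p + r * m).factorial_ne_zero
    have h2 : (q ! : ℂ) ≠ 0 := by exact_mod_cast q.factorial_ne_zero
    simp [towerSq, h1, h2]
  | succ n ih =>
    rw [inner_tower_succ hω₁ hω₂ hv, ih (by omega), towerSq_succ hn]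

/-- The vectors `A₊ⁿ P0` end at `n = r`, as the norm of the next one vanishes. -/
theorem tower_last (hp : p < m) : tower ħ ω₁ ω₂ l m P0 (r + 1) = 0 := by
  have h := inner_tower_succ hω₁ hω₂ hv r
  rw [mu_last hp, zero_mul, inner_self_eq_zero] at h
  exact toL2_injective (h.trans (map_zero toL2).symm)

theorem inner_tower_of_ne (hħ : 0 < ħ) (hl : 0 < l) {n k : ℕ} (hnk : n ≠ k) :
    inner ℂ (toL2 (tower ħ ω₁ ω₂ l m P0 n)) (toL2 (tower ħ ω₁ ω₂ l m P0 k)) = 0 := by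
  refine (isAdj_two ħ ω₁ ω₂ l m).inner_eq_zero (s := ħ * (q + n * l : ℕ))
    (t := ħ * (q + k * l : ℕ)) ?_ ?_ fun h => hnk ?_
  · rw [opA_two_tower hω₁ hω₂ hv, eig2_eq]
  · rw [opA_two_tower hω₁ hω₂ hv, eig2_eq]
  · have h1 : q + n * l = q + k * l := by exact_mod_cast mul_left_cancel₀ hħ.ne' h
    exact Nat.eq_of_mul_eq_mul_right hl (by omega)

theorem inner_tower_sum (hħ : 0 < ħ) (hl : 0 < l) (x : ℕ → ℂ) {n : ℕ} (hn : n ≤ r) :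
    inner ℂ (toL2 (tower ħ ω₁ ω₂ l m P0 n))
      (∑ k ∈ Finset.range (r + 1), x k • toL2 (tower ħ ω₁ ω₂ l m P0 k)) =
        x n * (towerSq ħ l m r q p n : ℂ) := by
  rw [inner_sum, Finset.sum_eq_single n]
  · rw [inner_smul_right, inner_tower_self hω₁ hω₂ hv hn]
  · intro k _ hk
    rw [inner_smul_right, inner_tower_of_ne hω₁ hω₂ hv hħ hl hk.symm, mul_zero]
  · intro h; exact absurd (Finset.mem_range.2 (by omega)) h

theorem inner_sum_tower_sum (hħ : 0 < ħ) (hl : 0 < l) (x y : ℕ → ℂ) :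
    inner ℂ (∑ k ∈ Finset.range (r + 1), x k • toL2 (tower ħ ω₁ ω₂ l m P0 k))
      (∑ k ∈ Finset.range (r + 1), y k • toL2 (tower ħ ω₁ ω₂ l m P0 k)) =
        ∑ n ∈ Finset.range (r + 1), conj (x n) * y n * (towerSq ħ l m r q p n : ℂ) := by
  rw [sum_inner]
  refine Finset.sum_congr rfl fun n hn => ?_
  rw [inner_smul_left, inner_tower_sum hω₁ hω₂ hv hħ hl y (by have := Finset.mem_range.1 hn; omega),
    mul_assoc]

/-- The coherent states reproduce the kernel. -/
theorem inner_coh (hħ : 0 < ħ) (hl : 0 < l) (w z : ℂ) :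
    inner ℂ (toL2 (coh ħ ω₁ ω₂ l m r q P0 w)) (toL2 (coh ħ ω₁ ω₂ l m r q P0 z)) =
      Ksharp ħ l m r q p w z := by
  simp only [coh_eq, map_sum, map_smul, Ksharp, kfun]
  rw [inner_sum_tower_sum hω₁ hω₂ hv hħ hl]
  refine Finset.sum_congr rfl fun n _ => ?_
  rw [← dcoef_sq_mul_towerSq hħ]
  simp only [map_mul, map_pow, Complex.conj_ofReal, Complex.ofReal_mul, Complex.ofReal_pow]
  ring

end Vacuum

theorem Ksharp_self (ħ : ℝ) (l m r q p : ℕ) (z : ℂ) :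
    Ksharp ħ l m r q p z z = (Kern ħ l m r q p z : ℂ) := by
  simp only [Ksharp, kfun, Kern, Complex.conj_mul']
  push_cast
  rfl

theorem Kern_pos {ħ : ℝ} (hħ : 0 < ħ) (l m r q p : ℕ) (z : ℂ) : 0 < Kern ħ l m r q p z := by
  rw [Kern, Finset.sum_range_succ']
  refine add_pos_of_nonneg_of_pos (Finset.sum_nonneg fun n _ => ?_) ?_
  · exact mul_nonneg (kcoef_pos hħ ..).le (by positivity)
  · simpa using kcoef_pos hħ l m r q p 0

theorem norm_sq_coh {ħ ω₁ ω₂ : ℝ} {l m r q p : ℕ} {P0 : Sch} (hω₁ : 0 < ω₁) (hω₂ : 0 < ω₂)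
    (hv : IsVacuum ħ ω₁ ω₂ l m r q p P0) (hħ : 0 < ħ) (hl : 0 < l) (z : ℂ) :
    ‖toL2 (coh ħ ω₁ ω₂ l m r q P0 z)‖ ^ 2 = Kern ħ l m r q p z := by
  have h := inner_coh hω₁ hω₂ hv hħ hl z z
  rw [Ksharp_self, inner_self_eq_norm_sq_to_K] at h
  exact Complex.ofReal_injective (by rw [← h]; push_cast; rfl)

/-- A normalized Hermite function is a vacuum vector. -/
theorem exists_isVacuum {ħ ω₁ ω₂ : ℝ} (hħ : 0 < ħ) (hω₁ : 0 < ω₁) (hω₂ : 0 < ω₂) (m r p : ℕ)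
    {l q : ℕ} (hq : q < l) : ∃ P0 : Sch, IsVacuum ħ ω₁ ω₂ l m r q p P0 := by
  set e := herm hħ hω₁ hω₂ (r * m + p) q with he
  have hne : ‖toL2 e‖ ≠ 0 := norm_ne_zero_iff.2 fun h => herm_ne_zero hħ hω₁ hω₂ (r * m + p) q
      (toL2_injective (h.trans (map_zero toL2).symm))
  have h2 := opA_two_herm hħ hω₁ hω₂ l m (r * m + p) q
  refine ⟨((‖toL2 e‖⁻¹ : ℝ) : ℂ) • e, ⟨?_, ?_, ?_, ?_⟩⟩
  · rw [map_smul, norm_smul, Complex.norm_real, norm_inv, norm_norm, inv_mul_cancel₀ hne]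
  · rw [map_smul, he, opA_one_herm, smul_comm]; push_cast; rfl
  · rw [map_smul, he, opA_two_herm, smul_comm]
  · have h0 : opA ħ ω₁ ω₂ l m .minus e = 0 := by
      have h : inner ℂ (toL2 (opA ħ ω₁ ω₂ l m .minus e)) (toL2 (opA ħ ω₁ ω₂ l m .minus e)) =
          (0 : ℂ) := by
        rw [isAdj_minus, ← Module.End.mul_apply, opA_plus_mul_minus hω₁ hω₂, rho,
          Module.End.mul_apply, he, aeval_apply_eig h2]
        have := rhoMinusPoly_eval_eig2_zero (ħ := ħ) hq
        simp only [eig2, CharP.cast_eq_zero, mul_zero, add_zero] at this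
        rw [this, zero_smul, map_zero, map_zero, inner_zero_right]
      exact toL2_injective ((inner_self_eq_zero.1 h).trans (map_zero toL2).symm)
    rw [map_smul, h0, smul_zero]

/-! ### Decomposition into irreducible subspaces -/

section Decomposition

variable {ħ ω₁ ω₂ : ℝ} {l m : ℕ}

/-- Vectors generated from vacuum vectors with different labels are orthogonal. -/
theorem inner_tower_tower (hω₁ : 0 < ω₁) (hω₂ : 0 < ω₂) (hħ : 0 < ħ)
    {r q p r' q' p' : ℕ} {P0 P0' : Sch} (hq : q < l) (hp : p < m) (hq' : q' < l) (hp' : p' < m)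
    (hv : IsVacuum ħ ω₁ ω₂ l m r q p P0) (hv' : IsVacuum ħ ω₁ ω₂ l m r' q' p' P0')
    (hne : ¬(r = r' ∧ q = q' ∧ p = p')) {n k : ℕ} (hn : n ≤ r) (hk : k ≤ r') :
    inner ℂ (toL2 (tower ħ ω₁ ω₂ l m P0 n)) (toL2 (tower ħ ω₁ ω₂ l m P0' k)) = 0 := by
  by_cases h1 : (r - n) * m + p = (r' - k) * m + p'
  · refine (isAdj_two ħ ω₁ ω₂ l m).inner_eq_zero (s := ħ * (q + n * l : ℕ))
      (t := ħ * (q' + k * l : ℕ)) ?_ ?_ fun h => hne ?_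
    · rw [opA_two_tower hω₁ hω₂ hv, eig2_eq]
    · rw [opA_two_tower hω₁ hω₂ hv', eig2_eq]
    · have h2 : q + n * l = q' + k * l := by exact_mod_cast mul_left_cancel₀ hħ.ne' h
      have d1 := congrArg (· / m) h1
      have d2 := congrArg (· / l) h2
      simp only [Nat.add_mul_div_right _ _ (by omega : 0 < l), Nat.div_eq_of_lt hq,
        Nat.div_eq_of_lt hq', zero_add] at d2
      rw [add_comm _ p, add_comm _ p'] at d1
      simp only [Nat.add_mul_div_right _ _ (by omega : 0 < m), Nat.div_eq_of_lt hp,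
        Nat.div_eq_of_lt hp', zero_add] at d1
      rw [d1] at h1
      rw [d2] at h2
      omega
  · refine (isAdj_one ħ ω₁ ω₂ l m).inner_eq_zero (s := ħ * ((r - n) * m + p : ℕ))
      (t := ħ * ((r' - k) * m + p' : ℕ)) ?_ ?_ fun h => h1 ?_
    · rw [opA_one_tower hω₁ hω₂ hv, eig1_eq hn]
    · rw [opA_one_tower hω₁ hω₂ hv', eig1_eq hk]
    · exact_mod_cast mul_left_cancel₀ hħ.ne' h

/-- `L²` is the Hilbert sum of the subspaces generated from the vacuum vectors: the vectors
`A₊ⁿ P0` exhaust the joint eigenspaces of `A₁`, `A₂`, so that together they are as total as the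
Hermite functions. -/
theorem isHilbertSum_Lsub (hω₁ : 0 < ω₁) (hω₂ : 0 < ω₂) (hħ : 0 < ħ) (hl : 0 < l) (hm : 0 < m)
    (P0 : ℕ → Fin l → Fin m → Sch)
    (hv : ∀ (r : ℕ) (q : Fin l) (p : Fin m), IsVacuum ħ ω₁ ω₂ l m r q p (P0 r q p)) :
    IsHilbertSum ℂ
      (fun i : ℕ × Fin l × Fin m => Lsub ħ ω₁ ω₂ l m i.1 (P0 i.1 i.2.1 i.2.2))
      (fun i => (Lsub ħ ω₁ ω₂ l m i.1 (P0 i.1 i.2.1 i.2.2)).subtypeₗᵢ) := by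
  refine IsHilbertSum.mkInternal (E := L2)
    (F := fun i : ℕ × Fin l × Fin m => Lsub ħ ω₁ ω₂ l m i.1 (P0 i.1 i.2.1 i.2.2)) ?_ ?_
  · rintro ⟨r, q, p⟩ ⟨r', q', p'⟩ hne ⟨v, hv1⟩ ⟨w, hw1⟩
    obtain ⟨x, rfl⟩ := mem_Lsub_iff.1 hv1
    obtain ⟨y, rfl⟩ := mem_Lsub_iff.1 hw1
    change inner ℂ (∑ n ∈ Finset.range (r + 1), _) (∑ n ∈ Finset.range (r' + 1), _) = (0 : ℂ)
    rw [sum_inner]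
    refine Finset.sum_eq_zero fun n hn => ?_
    rw [inner_sum]
    refine Finset.sum_eq_zero fun k hk => ?_
    rw [inner_smul_left, inner_smul_right, inner_tower_tower hω₁ hω₂ hħ q.2 p.2 q'.2 p'.2
      (hv r q p) (hv r' q' p') (fun h => hne ?_) (Nat.lt_succ_iff.1 (Finset.mem_range.1 hn))
      (Nat.lt_succ_iff.1 (Finset.mem_range.1 hk)), mul_zero, mul_zero]
    obtain ⟨rfl, h2, h3⟩ := h
    rw [Fin.ext h2, Fin.ext h3]
  · rw [top_le_iff, Submodule.topologicalClosure_eq_top_iff, Submodule.eq_bot_iff]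
    intro f hf
    rw [Submodule.mem_orthogonal] at hf
    refine eq_zero_of_inner_herm hħ hω₁ hω₂ f fun j k => ?_
    -- the eigenvalues `(j, k)` occur in the subspace with `r = j / m + k / l`
    set q : Fin l := ⟨k % l, Nat.mod_lt _ hl⟩ with hq
    set p : Fin m := ⟨j % m, Nat.mod_lt _ hm⟩ with hp
    set r := j / m + k / l with hr
    set t := tower ħ ω₁ ω₂ l m (P0 r q p) (k / l) with ht
    have hle : k / l ≤ r := Nat.le_add_left _ _
    have hj : (r - k / l) * m + p = j := by
      rw [hr, Nat.add_sub_cancel, hp, mul_comm]; exact Nat.div_add_mod j m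
    have hk : (q : ℕ) + k / l * l = k := by rw [hq, mul_comm]; exact Nat.mod_add_div k l
    have h1 : opA ħ ω₁ ω₂ l m .one t = (ħ * j : ℂ) • t := by
      rw [ht, opA_one_tower hω₁ hω₂ (hv r q p), eig1_eq hle, hj]; push_cast; rfl
    have h2 : opA ħ ω₁ ω₂ l m .two t = (ħ * k : ℂ) • t := by
      rw [ht, opA_two_tower hω₁ hω₂ (hv r q p), eig2_eq, hk]; push_cast; rfl
    obtain ⟨c, hc⟩ := exists_eq_smul_herm hħ hω₁ hω₂ h1 h2
    have h0 := hf (toL2 t) (Submodule.mem_iSup_of_mem (r, q, p) (tower_mem_Lsub hle))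
    rw [hc, inner_smul_left, mul_eq_zero] at h0
    refine h0.resolve_left fun hc0 => ?_
    rw [map_eq_zero] at hc0
    have := inner_tower_self hω₁ hω₂ (hv r q p) hle
    rw [← ht, hc, hc0, zero_smul, inner_zero_left] at this
    exact (towerSq_pos hħ l m r q p (k / l)).ne (by exact_mod_cast this)

variable {r q p : ℕ} {P0 : Sch} (hω₁ : 0 < ω₁) (hω₂ : 0 < ω₂)
  (hv : IsVacuum ħ ω₁ ω₂ l m r q p P0)

include hv in
theorem Lsub_ne_bot : Lsub ħ ω₁ ω₂ l m r P0 ≠ ⊥ := fun h => by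
  have h0 := tower_mem_Lsub (ħ := ħ) (ω₁ := ω₁) (ω₂ := ω₂) (l := l) (m := m) (P0 := P0)
    (Nat.zero_le r)
  rw [h, Submodule.mem_bot, tower_zero] at h0
  have := hv.norm_one
  rw [h0, norm_zero] at this
  exact zero_ne_one this

include hω₁ hω₂ hv

theorem opA_tower_mem (hp : p < m) (g : Gen) {n : ℕ} (hn : n ≤ r) :
    toL2 (opA ħ ω₁ ω₂ l m g (tower ħ ω₁ ω₂ l m P0 n)) ∈ Lsub ħ ω₁ ω₂ l m r P0 := by
  cases g with
  | one =>
    rw [opA_one_tower hω₁ hω₂ hv, map_smul]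
    exact Submodule.smul_mem _ _ (tower_mem_Lsub hn)
  | two =>
    rw [opA_two_tower hω₁ hω₂ hv, map_smul]
    exact Submodule.smul_mem _ _ (tower_mem_Lsub hn)
  | plus =>
    rw [← tower_succ]
    rcases hn.lt_or_eq with h | rfl
    · exact tower_mem_Lsub h
    · rw [tower_last hω₁ hω₂ hv hp, map_zero]; exact zero_mem _
  | minus =>
    cases n with
    | zero => rw [tower_zero, hv.annul, map_zero]; exact zero_mem _
    | succ n =>
      rw [opA_minus_tower hω₁ hω₂ hv, map_smul]
      exact Submodule.smul_mem _ _ (tower_mem_Lsub (by omega))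

theorem opL2_mem_Lsub (hp : p < m) (g : Gen) {ψ : L2} (hψ : ψ ∈ Lsub ħ ω₁ ω₂ l m r P0) :
    opL2 (opA ħ ω₁ ω₂ l m g) ψ ∈ Lsub ħ ω₁ ω₂ l m r P0 := by
  obtain ⟨x, rfl⟩ := mem_Lsub_iff.1 hψ
  simp only [← map_smul, ← map_sum]
  rw [opL2_toL2]
  simp only [map_smul, map_sum]
  refine Submodule.sum_mem _ fun n hn => Submodule.smul_mem _ _ ?_
  exact opA_tower_mem hω₁ hω₂ hv hp g (Nat.lt_succ_iff.1 (Finset.mem_range.1 hn))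

/-- An invariant subspace containing a vector with leading component along `A₊ᵏ P0` contains
`P0`: apply `A₋` repeatedly. -/
theorem vacuum_mem_of_leading (hħ : 0 < ħ) {W : Submodule ℂ L2}
    (hW : ∀ ψ ∈ W, opL2 (opA ħ ω₁ ω₂ l m .minus) ψ ∈ W) (k : ℕ) (hk : k ≤ r) (x : ℕ → ℂ)
    (hx : x k ≠ 0)
    (hmem : toL2 (∑ n ∈ Finset.range (k + 1), x n • tower ħ ω₁ ω₂ l m P0 n) ∈ W) :
    toL2 P0 ∈ W := by
  induction k generalizing x with
  | zero =>
    rw [Finset.sum_range_one, map_smul, Submodule.smul_mem_iff _ hx, tower_zero] at hmem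
    exact hmem
  | succ k ih =>
    refine ih (by omega) (fun n => x (n + 1) * mu ħ l m r q p (n + 1))
      (mul_ne_zero hx (mu_ne_zero hħ hk)) ?_
    have h := hW _ hmem
    rw [opL2_toL2, map_sum, Finset.sum_range_succ', map_smul, tower_zero, hv.annul, smul_zero,
      add_zero] at h
    simpa only [map_smul, opA_minus_tower hω₁ hω₂ hv, smul_smul] using h

theorem Lsub_irreducible (hħ : 0 < ħ) {W : Submodule ℂ L2} (hWle : W ≤ Lsub ħ ω₁ ω₂ l m r P0)
    (hW : ∀ g, ∀ ψ ∈ W, opL2 (opA ħ ω₁ ω₂ l m g) ψ ∈ W) :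
    W = ⊥ ∨ W = Lsub ħ ω₁ ω₂ l m r P0 := by
  rcases eq_or_ne W ⊥ with h | h
  · exact Or.inl h
  right
  obtain ⟨ψ, hψW, hψ0⟩ := Submodule.exists_mem_ne_zero_of_ne_bot h
  obtain ⟨x, hx⟩ := mem_Lsub_iff.1 (hWle hψW)
  have h0 : toL2 P0 ∈ W := by
    have key : ∀ k ≤ r + 1, ∑ n ∈ Finset.range k, x n • toL2 (tower ħ ω₁ ω₂ l m P0 n) ∈ W →
        ∑ n ∈ Finset.range k, x n • toL2 (tower ħ ω₁ ω₂ l m P0 n) ≠ 0 → toL2 P0 ∈ W := by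
      intro k
      induction k with
      | zero => intro _ _ h; exact absurd (Finset.sum_range_zero _) h
      | succ k ih =>
        intro hk hmem hne
        by_cases hxk : x k = 0
        · rw [Finset.sum_range_succ, hxk, zero_smul, add_zero] at hmem hne
          exact ih (by omega) hmem hne
        · refine vacuum_mem_of_leading hω₁ hω₂ hv hħ (hW .minus) k (by omega) x hxk ?_
          simpa only [map_sum, map_smul] using hmem
    exact key (r + 1) le_rfl (hx ▸ hψW) (hx ▸ hψ0)
  have ht : ∀ n, toL2 (tower ħ ω₁ ω₂ l m P0 n) ∈ W := fun n => by
    induction n with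
    | zero => exact h0
    | succ n ih =>
      have := hW .plus _ ih
      rwa [opL2_toL2, ← tower_succ] at this
  refine le_antisymm hWle (Submodule.span_le.2 ?_)
  rintro _ ⟨n, rfl⟩
  exact ht n

end Decomposition

/-! ### The moments of the density of the reproducing measure -/

/-- The open quadrant. -/
def quadrant : Set (ℝ × ℝ) := Ioi 0 ×ˢ Ioi 0

/-- The coordinates `(E, x)` as functions of `(A₁, A₂)`: `E = l A₁ + m A₂`, `x = A₂^l / A₁^m`. -/
noncomputable def leafMap (l m : ℕ) (A : ℝ × ℝ) : ℝ × ℝ :=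
  (l * A.1 + m * A.2, A.2 ^ l / A.1 ^ m)

/-- The derivative of `leafMap`. -/
noncomputable def leafDeriv (l m : ℕ) (A : ℝ × ℝ) : ℝ × ℝ →L[ℝ] ℝ × ℝ :=
  (Matrix.toLin (.finTwoProd ℝ) (.finTwoProd ℝ)
    !![(l : ℝ), m; -(m * (A.2 ^ l / A.1 ^ m) / A.1), l * (A.2 ^ l / A.1 ^ m) / A.2]
      ).toContinuousLinearMap

section Leaf

variable {l m : ℕ}

theorem measurableSet_quadrant : MeasurableSet quadrant := measurableSet_Ioi.prod measurableSet_Ioi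

theorem leafDeriv_det (A : ℝ × ℝ) : (leafDeriv l m A).det =
    A.2 ^ l / A.1 ^ m * ((l : ℝ) ^ 2 / A.2 + (m : ℝ) ^ 2 / A.1) := by
  conv_lhs => rw [leafDeriv, ContinuousLinearMap.det, LinearMap.coe_toContinuousLinearMap,
    LinearMap.det_toLin, Matrix.det_fin_two_of]
  ring

theorem hasFDerivAt_leafMap (hl : 0 < l) (hm : 0 < m) {A : ℝ × ℝ} (hA : A ∈ quadrant) :
    HasFDerivAt (leafMap l m) (leafDeriv l m A) A := by
  obtain ⟨h1, h2⟩ : 0 < A.1 ∧ 0 < A.2 := hA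
  unfold leafDeriv
  rw [Matrix.toLin_finTwoProd_toContinuousLinearMap]
  have d1 : HasFDerivAt (fun x : ℝ × ℝ => x.1) (ContinuousLinearMap.fst ℝ ℝ ℝ) A :=
    hasFDerivAt_fst
  have d2 : HasFDerivAt (fun x : ℝ × ℝ => x.2) (ContinuousLinearMap.snd ℝ ℝ ℝ) A :=
    hasFDerivAt_snd
  refine HasFDerivAt.prodMk ((d1.const_mul (l : ℝ)).add (d2.const_mul (m : ℝ))) ?_
  have e1 : HasFDerivAt (fun x : ℝ × ℝ => (x.1 ^ m)⁻¹) _ A :=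
    ((hasDerivAt_pow m A.1).fun_inv (pow_pos h1 m).ne').comp_hasFDerivAt A d1
  have e := (d2.pow l).mul e1
  have hf : (fun x : ℝ × ℝ => x.2 ^ l / x.1 ^ m) = (fun x => x.2 ^ l) * fun x => (x.1 ^ m)⁻¹ := by
    ext x; simp [div_eq_mul_inv]
  rw [hf]
  refine e.congr_fderiv ?_
  obtain ⟨l, rfl⟩ := Nat.exists_eq_succ_of_ne_zero hl.ne'
  obtain ⟨m, rfl⟩ := Nat.exists_eq_succ_of_ne_zero hm.ne'
  ext
  · simp
    field_simp
    ring
  · simp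
    field_simp
    ring

/-- For fixed `E`, the right-hand side decreases in `A₁` and the left-hand side increases, so
`A₁` and `A₂` on the leaf are determined by `E` and `x`. -/
theorem leaf_unique (hl : 0 < l) (hm : 0 < m) {x a b a' b' : ℝ} (hx : 0 < x) (ha : 0 ≤ a)
    (hb : 0 ≤ b) (ha' : 0 ≤ a') (hb' : 0 ≤ b') (hE : l * a + m * b = l * a' + m * b')
    (h : x * a ^ m = b ^ l) (h' : x * a' ^ m = b' ^ l) : a = a' ∧ b = b' := by
  have hl' : (0 : ℝ) < l := by exact_mod_cast hl
  have hm' : (0 : ℝ) < m := by exact_mod_cast hm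
  have key : ∀ {a b a' b' : ℝ}, 0 ≤ a → 0 ≤ b → 0 ≤ b' → l * a + m * b = l * a' + m * b' →
      x * a ^ m = b ^ l → x * a' ^ m = b' ^ l → ¬a < a' := by
    intro a b a' b' ha hb hb' hE h h' hlt
    have h1 : a ^ m < a' ^ m := pow_lt_pow_left₀ hlt ha hm.ne'
    have h2 : b' < b := by nlinarith
    have h3 : b' ^ l < b ^ l := pow_lt_pow_left₀ h2 hb' hl.ne'
    nlinarith
  have haa : a = a' := le_antisymm (not_lt.1 (key ha' hb' hb hE.symm h' h))
    (not_lt.1 (key ha hb hb' hE h h'))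
  refine ⟨haa, ?_⟩
  rw [haa, add_right_inj] at hE
  exact mul_left_cancel₀ hm'.ne' hE

/-- The choice of `α` in the definition of `clA1`, `clA2` is legitimate on the quadrant and returns
the coordinates `A₁`, `A₂`. -/
theorem clA_leafMap (hl : 0 < l) (hm : 0 < m) {A : ℝ × ℝ} (hA : A ∈ quadrant) :
    clA1 l m (leafMap l m A).1 (leafMap l m A).2 = A.1 ∧
      clA2 l m (leafMap l m A).1 (leafMap l m A).2 = A.2 := by
  obtain ⟨h1, h2⟩ : 0 < A.1 ∧ 0 < A.2 := hA
  have hl' : (0 : ℝ) < l := by exact_mod_cast hl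
  have hm' : (0 : ℝ) < m := by exact_mod_cast hm
  set E := (leafMap l m A).1 with hE
  set x := (leafMap l m A).2 with hx
  have hxpos : 0 < x := div_pos (pow_pos h2 l) (pow_pos h1 m)
  have hxA : x * A.1 ^ m = A.2 ^ l := div_mul_cancel₀ _ (pow_pos h1 m).ne'
  have hEA : E = l * A.1 + m * A.2 := rfl
  have hex : ∃ α : ℝ, α ∈ Icc (-(E / (2 * l * m))) (E / (2 * l * m)) ∧
      x * (E / (2 * l) - m * α) ^ m = (E / (2 * m) + l * α) ^ l := by
    refine ⟨(m * A.2 - l * A.1) / (2 * l * m), ⟨?_, ?_⟩, ?_⟩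
    · rw [← neg_div]
      refine div_le_div_of_nonneg_right ?_ (by positivity)
      rw [hEA]; nlinarith
    · refine div_le_div_of_nonneg_right ?_ (by positivity)
      rw [hEA]; nlinarith
    · rw [show E / (2 * l) - m * ((m * A.2 - l * A.1) / (2 * l * m)) = A.1 by
          rw [hEA]; field_simp; ring,
        show E / (2 * m) + l * ((m * A.2 - l * A.1) / (2 * l * m)) = A.2 by
          rw [hEA]; field_simp; ring, hxA]
  obtain ⟨⟨hα1, hα2⟩, hα⟩ := Classical.epsilon_spec hex
  change -(E / (2 * l * m)) ≤ alpha l m E x at hα1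
  change alpha l m E x ≤ E / (2 * l * m) at hα2
  change x * (clA1 l m E x) ^ m = (clA2 l m E x) ^ l at hα
  have c1 : 0 ≤ clA1 l m E x := by
    have : m * alpha l m E x ≤ m * (E / (2 * l * m)) := by gcongr
    rw [clA1]
    have e : m * (E / (2 * l * m)) = E / (2 * l) := by field_simp
    linarith
  have c2 : 0 ≤ clA2 l m E x := by
    have : l * -(E / (2 * l * m)) ≤ l * alpha l m E x := by gcongr
    rw [clA2]
    have e : l * -(E / (2 * l * m)) = -(E / (2 * m)) := by field_simp
    linarith
  refine leaf_unique hl hm hxpos c1 c2 h1.le h2.le ?_ hα hxA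
  rw [← hEA, clA1, clA2]
  field_simp
  ring

theorem injOn_leafMap (hl : 0 < l) (hm : 0 < m) : InjOn (leafMap l m) quadrant := by
  intro A hA B hB h
  have h1 := clA_leafMap hl hm hA
  have h2 := clA_leafMap hl hm hB
  rw [h] at h1
  exact Prod.ext (h1.1.symm.trans h2.1) (h1.2.symm.trans h2.2)

theorem image_leafMap (hl : 0 < l) (hm : 0 < m) : leafMap l m '' quadrant = quadrant := by
  have hl' : (0 : ℝ) < l := by exact_mod_cast hl
  have hm' : (0 : ℝ) < m := by exact_mod_cast hm
  refine Subset.antisymm ?_ ?_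
  · rintro _ ⟨A, ⟨h1, h2⟩, rfl⟩
    have h1' : 0 < A.1 := h1
    have h2' : 0 < A.2 := h2
    exact ⟨add_pos (mul_pos hl' h1') (mul_pos hm' h2'), div_pos (pow_pos h2' l) (pow_pos h1' m)⟩
  · rintro ⟨E, x⟩ ⟨hE, hx⟩
    have hE' : 0 < E := hE
    have hx' : 0 < x := hx
    set f : ℝ → ℝ := fun t => x * t ^ m - ((E - l * t) / m) ^ l with hf
    have hcont : ContinuousOn f (Icc 0 (E / l)) := by fun_prop
    have hEl : 0 ≤ E / l := by positivity
    have f0 : f 0 < 0 := by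
      have : 0 < (E / m) ^ l := by positivity
      simp only [hf, zero_pow hm.ne', mul_zero, sub_zero, zero_sub]
      linarith
    have f1 : 0 < f (E / l) := by
      have h0 : (E - l * (E / l)) / m = 0 := by field_simp; ring
      simp only [hf, h0, zero_pow hl.ne', sub_zero]
      positivity
    obtain ⟨t, ⟨ht0, ht1⟩, ht⟩ := intermediate_value_Icc hEl hcont ⟨f0.le, f1.le⟩
    have ht0' : 0 < t := lt_of_le_of_ne ht0 fun h => by rw [← h] at ht; exact f0.ne ht
    have ht1' : t < E / l := lt_of_le_of_ne ht1 fun h => by rw [h] at ht; exact f1.ne' ht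
    have hpos : 0 < (E - l * t) / m := by
      rw [lt_div_iff₀ hl'] at ht1'
      exact div_pos (by linarith) hm'
    refine ⟨(t, (E - l * t) / m), ⟨ht0', hpos⟩, Prod.ext ?_ ?_⟩
    · simp only [leafMap]; field_simp; ring
    · simp only [leafMap]
      rw [div_eq_iff (pow_pos ht0' m).ne']
      exact (sub_eq_zero.1 ht).symm

/-- On the quadrant, `A₁` and `A₂` are measurable functions of `E` and `x`. -/
theorem exists_measurable_clA (hl : 0 < l) (hm : 0 < m) : ∃ ψ : ℝ × ℝ → ℝ × ℝ, Measurable ψ ∧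
    ∀ y ∈ quadrant, (clA1 l m y.1 y.2, clA2 l m y.1 y.2) = ψ y := by
  have hc : ContinuousOn (leafMap l m) quadrant := fun A hA =>
    (hasFDerivAt_leafMap hl hm hA).continuousAt.continuousWithinAt
  have hme := hc.measurableEmbedding measurableSet_quadrant (injOn_leafMap hl hm)
  obtain ⟨ψ, hψ, hψ'⟩ := hme.exists_measurable_extend (g := Subtype.val) measurable_subtype_coe
    fun _ => ⟨0⟩
  refine ⟨ψ, hψ, fun y hy => ?_⟩
  rw [← image_leafMap hl hm] at hy
  obtain ⟨A, hA, rfl⟩ := hy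
  have h1 : ψ (leafMap l m A) = A := congrFun hψ' ⟨A, hA⟩
  have h2 := clA_leafMap hl hm hA
  rw [h1, h2.1, h2.2]

end Leaf

theorem lintegral_pow_mul_exp {ħ : ℝ} (hħ : 0 < ħ) (k : ℕ) :
    ∫⁻ t in Ioi (0 : ℝ), ENNReal.ofReal (t ^ k * Real.exp (-t / ħ)) =
      ENNReal.ofReal (k ! * ħ ^ (k + 1)) := by
  have hr : (0 : ℝ) < 1 / ħ := by positivity
  have e : ∀ t : ℝ, t ^ k * Real.exp (-t / ħ) = t ^ ((k : ℝ)) * Real.exp (-(1 / ħ) * t ^ (1 : ℝ)) :=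
    fun t => by
      rw [Real.rpow_natCast, Real.rpow_one]
      congr 2
      ring
  have hi : IntegrableOn (fun t : ℝ => t ^ k * Real.exp (-t / ħ)) (Ioi 0) := by
    simp only [e]
    exact integrableOn_rpow_mul_exp_neg_mul_rpow
      (lt_of_lt_of_le (by norm_num) (Nat.cast_nonneg k)) one_pos hr
  rw [← ofReal_integral_eq_lintegral_ofReal hi]
  · congr 1
    have h := Real.integral_rpow_mul_exp_neg_mul_Ioi (a := k + 1) (r := 1 / ħ) (by positivity) hr
    rw [add_sub_cancel_right, Real.Gamma_nat_eq_factorial, one_div_one_div] at h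
    rw [mul_comm, show ħ ^ (k + 1) = ħ ^ ((k : ℝ) + 1) by exact_mod_cast (Real.rpow_natCast ..).symm,
      ← h]
    refine integral_congr_ae (ae_of_all _ fun t => ?_)
    simp only
    rw [Real.rpow_natCast]
    congr 2
    ring
  · filter_upwards [ae_restrict_mem measurableSet_Ioi] with t ht
    have : (0 : ℝ) < t := ht
    change 0 ≤ t ^ k * _
    positivity

/-- The integrand in the definition of the density, as a function of `A₁`, `A₂`. -/
noncomputable def leafDens (ħ : ℝ) (l m a q : ℕ) (A : ℝ × ℝ) : ℝ :=
  A.1 ^ a * A.2 ^ q * ((l : ℝ) ^ 2 / A.2 + (m : ℝ) ^ 2 / A.1)⁻¹ * Real.exp (-(A.1 + A.2) / ħ)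

theorem measurable_leafDens (ħ : ℝ) (l m a q : ℕ) : Measurable (leafDens ħ l m a q) := by
  unfold leafDens
  fun_prop

theorem leafDens_nonneg (ħ : ℝ) (l m a q : ℕ) {A : ℝ × ℝ} (hA : A ∈ quadrant) :
    0 ≤ leafDens ħ l m a q A := by
  obtain ⟨h1, h2⟩ : 0 < A.1 ∧ 0 < A.2 := hA
  unfold leafDens
  positivity

/-- Passing from the coordinates `(E, x)` to `(A₁, A₂)` splits the moment integrals of the density
into products of Gamma integrals: the Jacobian `x (l² / A₂ + m² / A₁)` cancels the corresponding
factor of the density. -/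
theorem lintegral_leaf {ħ : ℝ} (hħ : 0 < ħ) {l m : ℕ} (hl : 0 < l) (hm : 0 < m) {c : ℝ}
    (hc : 0 < c) {a q n : ℕ} (hn : n * m ≤ a) {ψ : ℝ × ℝ → ℝ × ℝ}
    (hψ : ∀ y ∈ quadrant, (clA1 l m y.1 y.2, clA2 l m y.1 y.2) = ψ y) :
    ∫⁻ y in quadrant, ENNReal.ofReal (y.2 ^ n * (1 / (c * y.2))) *
        ENNReal.ofReal (leafDens ħ l m a q (ψ y)) =
      ENNReal.ofReal (1 / c) * (ENNReal.ofReal ((a - n * m)! * ħ ^ (a - n * m + 1)) *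
        ENNReal.ofReal ((q + n * l)! * ħ ^ (q + n * l + 1))) := by
  have hl' : (0 : ℝ) < l := by exact_mod_cast hl
  have hm' : (0 : ℝ) < m := by exact_mod_cast hm
  have h1 := lintegral_image_eq_lintegral_abs_det_fderiv_mul (volume : Measure (ℝ × ℝ))
    measurableSet_quadrant (fun A hA => (hasFDerivAt_leafMap hl hm hA).hasFDerivWithinAt)
    (injOn_leafMap hl hm) (fun y => ENNReal.ofReal (y.2 ^ n * (1 / (c * y.2))) *
        ENNReal.ofReal (leafDens ħ l m a q (ψ y)))
  rw [image_leafMap hl hm] at h1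
  rw [h1]
  have h2 : ∀ A ∈ quadrant, ENNReal.ofReal |(leafDeriv l m A).det| *
      (ENNReal.ofReal ((leafMap l m A).2 ^ n * (1 / (c * (leafMap l m A).2))) *
        ENNReal.ofReal (leafDens ħ l m a q (ψ (leafMap l m A)))) =
      ENNReal.ofReal (1 / c) * (ENNReal.ofReal (A.1 ^ (a - n * m) * Real.exp (-A.1 / ħ)) *
        ENNReal.ofReal (A.2 ^ (q + n * l) * Real.exp (-A.2 / ħ))) := by
    intro A hA
    have hmem : leafMap l m A ∈ quadrant := by
      rw [← image_leafMap hl hm]; exact mem_image_of_mem _ hA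
    have hψA : ψ (leafMap l m A) = A := by
      rw [← hψ _ hmem, (clA_leafMap hl hm hA).1, (clA_leafMap hl hm hA).2]
    obtain ⟨p1, p2⟩ : 0 < A.1 ∧ 0 < A.2 := hA
    have hD : 0 < (l : ℝ) ^ 2 / A.2 + (m : ℝ) ^ 2 / A.1 := by positivity
    have hx : 0 < A.2 ^ l / A.1 ^ m := by positivity
    rw [hψA, leafDeriv_det, abs_of_pos (mul_pos hx hD)]
    simp only [leafMap]
    rw [← ENNReal.ofReal_mul (by positivity), ← ENNReal.ofReal_mul (by positivity),
      ← ENNReal.ofReal_mul (by positivity), ← ENNReal.ofReal_mul (by positivity)]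
    congr 1
    unfold leafDens
    set D := (l : ℝ) ^ 2 / A.2 + (m : ℝ) ^ 2 / A.1 with hDdef
    obtain ⟨d, rfl⟩ := Nat.exists_eq_add_of_le hn
    have hexp : Real.exp (-(A.1 + A.2) / ħ) = Real.exp (-A.1 / ħ) * Real.exp (-A.2 / ħ) := by
      rw [← Real.exp_add]; congr 1; ring
    have hpow : (A.2 ^ l / A.1 ^ m) ^ n = A.2 ^ (n * l) / A.1 ^ (n * m) := by
      rw [div_pow, ← pow_mul, ← pow_mul, mul_comm l, mul_comm m]
    set x := A.2 ^ l / A.1 ^ m with hxdef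
    rw [hexp, hpow, Nat.add_sub_cancel_left, pow_add, pow_add]
    field_simp
  rw [setLIntegral_congr_fun measurableSet_quadrant h2, lintegral_const_mul _ (by fun_prop)]
  congr 1
  rw [quadrant, Measure.volume_eq_prod, ← Measure.prod_restrict]
  rw [lintegral_prod_mul (f := fun t => ENNReal.ofReal (t ^ (a - n * m) * Real.exp (-t / ħ)))
    (g := fun t => ENNReal.ofReal (t ^ (q + n * l) * Real.exp (-t / ħ)))
    (Measurable.aemeasurable (by fun_prop)) (Measurable.aemeasurable (by fun_prop)),
    lintegral_pow_mul_exp hħ, lintegral_pow_mul_exp hħ]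

section Density

variable {ħ : ℝ} {l m : ℕ} (r q p : ℕ)

/-- The density agrees on the half-line with a measurable nonnegative function that has the
expected moments. -/
theorem exists_measurable_dens (hħ : 0 < ħ) (hl : 0 < l) (hm : 0 < m) :
    ∃ D : ℝ → ℝ, Measurable D ∧ (∀ x, 0 < x → dens ħ l m r q p x = D x ∧ 0 ≤ D x) ∧
      ∀ n ≤ r, ∫⁻ x in Ioi (0 : ℝ), ENNReal.ofReal (x ^ n * D x) =
        ENNReal.ofReal (ħ * weight ħ l m r q p n) := by
  obtain ⟨ψ, hψm, hψ⟩ := exists_measurable_clA hl hm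
  set c : ℝ := ħ ^ (r * m + p + q + 1) * (p + r * m)! * q ! with hc
  have hcpos : 0 < c := by positivity
  set J : ℝ × ℝ → ENNReal := fun y => ENNReal.ofReal (leafDens ħ l m (r * m + p) q (ψ y)) with hJ
  have hJm : Measurable J := ((measurable_leafDens ..).comp hψm).ennreal_ofReal
  set I : ℝ → ENNReal := fun x => ∫⁻ E in Ioi (0 : ℝ), J (E, x) with hI
  have hIm : Measurable I := hJm.lintegral_prod_left'
  have hmom : ∀ n ≤ r, ∫⁻ x in Ioi (0 : ℝ), ENNReal.ofReal (x ^ n * (1 / (c * x))) * I x =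
      ENNReal.ofReal (ħ * weight ħ l m r q p n) := by
    intro n hn
    have hnm : n * m ≤ r * m + p := (Nat.mul_le_mul_right m hn).trans (Nat.le_add_right _ _)
    have hG : Measurable fun y : ℝ × ℝ => ENNReal.ofReal (y.2 ^ n * (1 / (c * y.2))) * J y :=
      Measurable.mul (by fun_prop) hJm
    have h := lintegral_leaf hħ hl hm hcpos (q := q) hnm hψ
    rw [quadrant, Measure.volume_eq_prod, ← Measure.prod_restrict,
      lintegral_prod_symm' _ hG] at h
    have h' : ∀ x : ℝ, ∫⁻ E in Ioi (0 : ℝ), ENNReal.ofReal (x ^ n * (1 / (c * x))) * J (E, x) =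
        ENNReal.ofReal (x ^ n * (1 / (c * x))) * I x := fun x =>
      lintegral_const_mul _ (hJm.comp (measurable_id.prodMk measurable_const))
    simp only [h'] at h
    rw [h, ← ENNReal.ofReal_mul (by positivity), ← ENNReal.ofReal_mul (by positivity)]
    congr 1
    obtain ⟨d, rfl⟩ := Nat.exists_eq_add_of_le hn
    have e1 : (n + d) * m + p - n * m = d * m + p := by
      rw [add_mul]; omega
    have hz : ħ ^ (((l : ℤ) - m) * n) = (ħ ^ l / ħ ^ m) ^ n := by
      rw [zpow_mul, zpow_sub₀ hħ.ne', zpow_natCast, zpow_natCast, zpow_natCast]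
    rw [e1, weight, hz, hc, Nat.add_sub_cancel_left, div_pow, ← pow_mul, ← pow_mul,
      show (n + d) * m + p + q + 1 = m * n + (d * m + p + q + 1) by ring,
      show q + n * l + 1 = l * n + (q + 1) by ring,
      add_comm (d * m) p]
    have f1 : (q ! : ℝ) ≠ 0 := by exact_mod_cast q.factorial_ne_zero
    have f2 : ((p + (n + d) * m)! : ℝ) ≠ 0 := by exact_mod_cast (p + (n + d) * m).factorial_ne_zero
    rw [add_comm q (n * l), mul_comm n l]
    simp only [pow_add, pow_one]
    field_simp
  refine ⟨fun x => 1 / (c * x) * (I x).toReal,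
    Measurable.mul (by fun_prop) hIm.ennreal_toReal, fun x hx => ⟨?_, ?_⟩, fun n hn => ?_⟩
  · have hq : ∀ E ∈ Ioi (0 : ℝ), ((E, x) : ℝ × ℝ) ∈ quadrant := fun E hE => ⟨hE, hx⟩
    rw [dens, ← hc]
    congr 1
    rw [hI]
    have e : ∀ E ∈ Ioi (0 : ℝ), clA1 l m E x ^ (r * m + p) * clA2 l m E x ^ q *
        ((l : ℝ) ^ 2 / clA2 l m E x + (m : ℝ) ^ 2 / clA1 l m E x)⁻¹ *
        Real.exp (-(clA1 l m E x + clA2 l m E x) / ħ) =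
        leafDens ħ l m (r * m + p) q (ψ (E, x)) := fun E hE => by
      rw [← hψ _ (hq E hE)]; rfl
    rw [setIntegral_congr_fun measurableSet_Ioi e, integral_eq_lintegral_of_nonneg_ae]
    · filter_upwards [ae_restrict_mem measurableSet_Ioi] with E hE
      have hmem : ψ (E, x) ∈ quadrant := by
        have h1 := hq E hE
        rw [← image_leafMap hl hm] at h1
        obtain ⟨A, hA, hAE⟩ := h1
        have h2 := hψ _ (hq E hE)
        rw [← hAE, (clA_leafMap hl hm hA).1, (clA_leafMap hl hm hA).2] at h2
        rw [← hAE, ← h2]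
        exact hA
      exact leafDens_nonneg _ _ _ _ _ hmem
    · exact ((measurable_leafDens ..).comp
        (hψm.comp (measurable_id.prodMk measurable_const))).aestronglyMeasurable
  · have : 0 < 1 / (c * x) := by positivity
    exact mul_nonneg this.le ENNReal.toReal_nonneg
  · -- the inner integral is finite almost everywhere, as the zeroth moment is finite
    have hfin : ∀ᵐ x ∂(volume.restrict (Ioi (0 : ℝ))), I x < ⊤ := by
      have h0 := hmom 0 (Nat.zero_le r)
      have hlt := ae_lt_top (μ := volume.restrict (Ioi (0 : ℝ)))
        (f := fun x => ENNReal.ofReal (x ^ 0 * (1 / (c * x))) * I x)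
        (Measurable.mul (by fun_prop) hIm) (by rw [h0]; exact ENNReal.ofReal_ne_top)
      filter_upwards [hlt, ae_restrict_mem measurableSet_Ioi] with x hx hx0
      have hx0' : (0 : ℝ) < x := hx0
      have hpos : 0 < x ^ 0 * (1 / (c * x)) := by positivity
      by_contra htop
      rw [not_lt, top_le_iff] at htop
      rw [htop, ENNReal.mul_top (ENNReal.ofReal_pos.2 hpos).ne'] at hx
      exact lt_irrefl _ hx
    rw [← hmom n hn]
    refine lintegral_congr_ae ?_
    filter_upwards [hfin, ae_restrict_mem measurableSet_Ioi] with x hx hx0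
    have hx0' : (0 : ℝ) < x := hx0
    rw [← mul_assoc, ENNReal.ofReal_mul (by positivity), ENNReal.ofReal_toReal hx.ne]

end Density

/-! ### Integration over the phase space -/

theorem lintegral_radial {f : ℝ → ENNReal} (hf : Measurable f) :
    ∫⁻ z : ℂ, f (‖z‖ ^ 2) = ENNReal.ofReal Real.pi * ∫⁻ x in Ioi (0 : ℝ), f x := by
  have hsq : (fun t : ℝ => t ^ 2) '' Ioi 0 = Ioi 0 := by
    ext x
    constructor
    · rintro ⟨t, ht, rfl⟩; exact pow_pos (mem_Ioi.1 ht) 2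
    · intro hx
      exact ⟨√x, Real.sqrt_pos.2 hx, Real.sq_sqrt (le_of_lt hx)⟩
  have h1 := lintegral_image_eq_lintegral_abs_deriv_mul (s := Ioi (0 : ℝ))
    (f := fun t => t ^ 2) (f' := fun t => 2 * t) measurableSet_Ioi
    (fun t _ => by simpa using (hasDerivAt_pow 2 t).hasDerivWithinAt)
    (fun s hs t ht h => (pow_left_inj₀ (le_of_lt hs) (le_of_lt ht) two_ne_zero).1 h) f
  rw [hsq] at h1
  rw [← Complex.lintegral_comp_polarCoord_symm, polarCoord_target, Measure.volume_eq_prod,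
    ← Measure.prod_restrict, h1]
  simp only [Complex.norm_polarCoord_symm, sq_abs, smul_eq_mul]
  have hmeas : Measurable fun t : ℝ => ENNReal.ofReal t * f (t ^ 2) :=
    Measurable.mul (by fun_prop) (hf.comp (by fun_prop))
  have h2 := lintegral_prod_mul (μ := volume.restrict (Ioi (0 : ℝ)))
    (ν := volume.restrict (Ioo (-Real.pi) Real.pi))
    (f := fun t => ENNReal.ofReal t * f (t ^ 2)) (g := fun _ => 1)
    hmeas.aemeasurable measurable_const.aemeasurable
  simp only [mul_one, lintegral_const, Measure.restrict_apply MeasurableSet.univ, univ_inter,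
    Real.volume_Ioo, one_mul] at h2
  rw [h2, mul_comm, sub_neg_eq_add, ← two_mul, ENNReal.ofReal_mul zero_le_two, mul_comm
    (ENNReal.ofReal 2), mul_assoc, ← lintegral_const_mul _ hmeas]
  congr 1
  refine setLIntegral_congr_fun measurableSet_Ioi fun t ht => ?_
  have ht' : (0 : ℝ) < t := ht
  rw [abs_of_pos (by positivity), ENNReal.ofReal_mul zero_le_two, mul_assoc]

/-- Rotations of the plane annihilate the off-diagonal moments of a radial density. -/
theorem integral_radial_of_ne {D : ℝ → ℝ} {n k : ℕ} (hnk : n ≠ k) :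
    ∫ z : ℂ, (D (‖z‖ ^ 2) : ℂ) * (conj z ^ n * z ^ k) = 0 := by
  have key : ∀ c : Circle, conj (c : ℂ) ^ n * (c : ℂ) ^ k = -1 →
      ∫ z : ℂ, (D (‖z‖ ^ 2) : ℂ) * (conj z ^ n * z ^ k) = 0 := by
    intro c hc
    have h := (rotation c).measurePreserving.integral_comp
      (rotation c).toHomeomorph.measurableEmbedding
      (fun z : ℂ => (D (‖z‖ ^ 2) : ℂ) * (conj z ^ n * z ^ k))
    have e : ∀ z : ℂ, (D (‖rotation c z‖ ^ 2) : ℂ) *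
        (conj (rotation c z) ^ n * (rotation c z) ^ k) =
        -((D (‖z‖ ^ 2) : ℂ) * (conj z ^ n * z ^ k)) := fun z => by
      rw [LinearIsometryEquiv.norm_map, rotation_apply, map_mul, mul_pow, mul_pow]
      linear_combination (D (‖z‖ ^ 2) : ℂ) * (conj z ^ n * z ^ k) * hc
    simp only [e, integral_neg] at h
    exact self_eq_neg.1 h.symm
  have hexp : ∀ d : ℕ, 0 < d → (Circle.exp (Real.pi / d) : ℂ) ^ d = -1 := fun d hd => by
    have hd' : (d : ℂ) ≠ 0 := by exact_mod_cast hd.ne'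
    rw [Circle.coe_exp, ← Complex.exp_nat_mul, ← Complex.exp_pi_mul_I]
    congr 1
    push_cast
    field_simp
  have hunit : ∀ c : Circle, conj (c : ℂ) * c = 1 := fun c => by
    rw [Complex.conj_mul', Circle.norm_coe]; simp
  rcases hnk.lt_or_gt with h | h
  · obtain ⟨d, rfl⟩ := Nat.exists_eq_add_of_lt h
    refine key (Circle.exp (Real.pi / (d + 1 : ℕ))) ?_
    rw [add_assoc, pow_add, ← mul_assoc, ← mul_pow, hunit, one_pow, one_mul,
      hexp _ (Nat.succ_pos d)]
  · obtain ⟨d, rfl⟩ := Nat.exists_eq_add_of_lt h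
    refine key (Circle.exp (Real.pi / (d + 1 : ℕ))) ?_
    rw [add_assoc, pow_add, mul_right_comm, ← mul_pow, hunit, one_pow, one_mul, ← map_pow,
      hexp _ (Nat.succ_pos d), map_neg, map_one]

section Moments

variable {ħ : ℝ} {l m : ℕ} (r q p : ℕ)

theorem ae_norm_sq_pos : ∀ᵐ z : ℂ, 0 < ‖z‖ ^ 2 := by
  have : ∀ᵐ z : ℂ, z ≠ 0 := by
    rw [ae_iff]; simp
  filter_upwards [this] with z hz
  positivity

theorem aemeasurable_dens (hħ : 0 < ħ) (hl : 0 < l) (hm : 0 < m) :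
    AEMeasurable (fun z : ℂ => dens ħ l m r q p (‖z‖ ^ 2)) := by
  obtain ⟨D, hD, hdens, -⟩ := exists_measurable_dens r q p hħ hl hm
  refine ⟨fun z => D (‖z‖ ^ 2), hD.comp (by fun_prop), ?_⟩
  filter_upwards [ae_norm_sq_pos] with z hz
  exact (hdens _ hz).1

theorem dens_nonneg_ae (hħ : 0 < ħ) (hl : 0 < l) (hm : 0 < m) :
    ∀ᵐ z : ℂ, 0 ≤ dens ħ l m r q p (‖z‖ ^ 2) := by
  obtain ⟨D, -, hdens, -⟩ := exists_measurable_dens r q p hħ hl hm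
  filter_upwards [ae_norm_sq_pos] with z hz
  rw [(hdens _ hz).1]
  exact (hdens _ hz).2

theorem lintegral_dens (hħ : 0 < ħ) (hl : 0 < l) (hm : 0 < m) {n : ℕ} (hn : n ≤ r) :
    ∫⁻ z : ℂ, ENNReal.ofReal ((‖z‖ ^ 2) ^ n * dens ħ l m r q p (‖z‖ ^ 2)) =
      ENNReal.ofReal (Real.pi * (ħ * weight ħ l m r q p n)) := by
  obtain ⟨D, hD, hdens, hmom⟩ := exists_measurable_dens r q p hħ hl hm
  rw [ENNReal.ofReal_mul Real.pi_pos.le, ← hmom n hn, ← lintegral_radial (by fun_prop)]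
  refine lintegral_congr_ae ?_
  filter_upwards [ae_norm_sq_pos] with z hz
  rw [(hdens _ hz).1]

theorem integrable_dens_norm (hħ : 0 < ħ) (hl : 0 < l) (hm : 0 < m) {n : ℕ} (hn : n ≤ r) :
    Integrable fun z : ℂ => (‖z‖ ^ 2) ^ n * dens ħ l m r q p (‖z‖ ^ 2) := by
  refine ⟨(AEMeasurable.mul (by fun_prop)
    (aemeasurable_dens r q p hħ hl hm)).aestronglyMeasurable, ?_⟩
  rw [hasFiniteIntegral_iff_ofReal, lintegral_dens r q p hħ hl hm hn]
  · exact ENNReal.ofReal_lt_top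
  · filter_upwards [dens_nonneg_ae r q p hħ hl hm] with z hz
    exact mul_nonneg (by positivity) hz

theorem integrable_dens_monomial (hħ : 0 < ħ) (hl : 0 < l) (hm : 0 < m) {n k : ℕ} (hn : n ≤ r)
    (hk : k ≤ r) :
    Integrable fun z : ℂ => (dens ħ l m r q p (‖z‖ ^ 2) : ℂ) * (conj z ^ n * z ^ k) := by
  refine ((integrable_dens_norm r q p hħ hl hm hn).add
    (integrable_dens_norm r q p hħ hl hm hk)).mono' ?_ ?_
  · refine (AEMeasurable.mul ?_ (by fun_prop)).aestronglyMeasurable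
    exact Complex.measurable_ofReal.comp_aemeasurable (aemeasurable_dens r q p hħ hl hm)
  · filter_upwards [dens_nonneg_ae r q p hħ hl hm] with z hz
    simp only [norm_mul, norm_pow, Complex.norm_real, Real.norm_eq_abs, abs_of_nonneg hz,
      RCLike.norm_conj, Pi.add_apply]
    rw [← add_mul, mul_comm]
    refine mul_le_mul_of_nonneg_right ?_ hz
    rw [← pow_mul, ← pow_mul, mul_comm 2, mul_comm 2, pow_mul, pow_mul]
    nlinarith [sq_nonneg (‖z‖ ^ n - ‖z‖ ^ k), sq_nonneg (‖z‖ ^ n), sq_nonneg (‖z‖ ^ k)]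

/-- The moments of the density: it reproduces the scalar product of the polynomials. -/
theorem integral_dens_monomial (hħ : 0 < ħ) (hl : 0 < l) (hm : 0 < m) {n : ℕ} (k : ℕ)
    (hn : n ≤ r) :
    ∫ z : ℂ, (dens ħ l m r q p (‖z‖ ^ 2) : ℂ) * (conj z ^ n * z ^ k) =
      if n = k then ((Real.pi * (ħ * weight ħ l m r q p n) : ℝ) : ℂ) else 0 := by
  split_ifs with h
  · subst h
    have e : ∀ z : ℂ, (dens ħ l m r q p (‖z‖ ^ 2) : ℂ) * (conj z ^ n * z ^ n) =
        (((‖z‖ ^ 2) ^ n * dens ħ l m r q p (‖z‖ ^ 2) : ℝ) : ℂ) := fun z => by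
      rw [← mul_pow, Complex.conj_mul']; push_cast; ring
    simp only [e]
    rw [integral_complex_ofReal]
    congr 1
    rw [integral_eq_lintegral_of_nonneg_ae, lintegral_dens r q p hħ hl hm hn, ENNReal.toReal_ofReal]
    · have : 0 < weight ħ l m r q p n := by unfold weight; positivity
      positivity
    · filter_upwards [dens_nonneg_ae r q p hħ hl hm] with z hz
      exact mul_nonneg (by positivity) hz
    · exact (integrable_dens_norm r q p hħ hl hm hn).1
  · exact integral_radial_of_ne h

/-- Functions of the form `z ↦ K(z)⁻¹ ∑ z̄ⁿ zᵏ v` are integrable with respect to the reproducing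
measure, with integrals given by the moments of the density. -/
theorem integrable_dm_and_integral {V : Type*} [NormedAddCommGroup V] [NormedSpace ℝ V]
    [NormedSpace ℂ V] [IsScalarTower ℝ ℂ V] [CompleteSpace V] (hħ : 0 < ħ) (hl : 0 < l) (hm : 0 < m) (v : ℕ → ℕ → V) {F : ℂ → V}
    (hF : ∀ z, F z = ((Kern ħ l m r q p z : ℂ)⁻¹) • ∑ n ∈ Finset.range (r + 1),
      ∑ k ∈ Finset.range (r + 1), (conj z ^ n * z ^ k) • v n k) :
    Integrable F (dm ħ l m r q p) ∧
      ∫ z, F z ∂(dm ħ l m r q p) = ∑ n ∈ Finset.range (r + 1),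
        ((2 * Real.pi * ħ * weight ħ l m r q p n : ℝ) : ℂ) • v n n := by
  have hmeas : AEMeasurable (fun z : ℂ => ENNReal.ofReal
      (dens ħ l m r q p (‖z‖ ^ 2) * Kern ħ l m r q p z))
      ((2 : ENNReal) • (volume : Measure ℂ)) := by
    refine AEMeasurable.smul_measure ?_ 2
    refine (AEMeasurable.mul (aemeasurable_dens r q p hħ hl hm) ?_).ennreal_ofReal
    unfold Kern
    fun_prop
  have htop : ∀ᵐ z ∂((2 : ENNReal) • (volume : Measure ℂ)), ENNReal.ofReal
      (dens ħ l m r q p (‖z‖ ^ 2) * Kern ħ l m r q p z) < ⊤ :=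
    ae_of_all _ fun z => ENNReal.ofReal_lt_top
  have hle : ∀ {n}, n ∈ Finset.range (r + 1) → n ≤ r := fun h =>
    Nat.lt_succ_iff.1 (Finset.mem_range.1 h)
  -- the factor `K` of the measure cancels
  have hcong : (fun z : ℂ => (ENNReal.ofReal
      (dens ħ l m r q p (‖z‖ ^ 2) * Kern ħ l m r q p z)).toReal • F z) =ᵐ[volume]
      fun z => ∑ n ∈ Finset.range (r + 1), ∑ k ∈ Finset.range (r + 1),
        ((dens ħ l m r q p (‖z‖ ^ 2) : ℂ) * (conj z ^ n * z ^ k)) • v n k := by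
    filter_upwards [dens_nonneg_ae r q p hħ hl hm] with z hz
    have hK : (Kern ħ l m r q p z : ℂ) ≠ 0 := by exact_mod_cast (Kern_pos hħ l m r q p z).ne'
    rw [ENNReal.toReal_ofReal (mul_nonneg hz (Kern_pos hħ l m r q p z).le), hF,
      ← algebraMap_smul ℂ (_ : ℝ) (_ : V), smul_smul]
    simp only [Complex.coe_algebraMap]
    push_cast
    rw [mul_assoc, mul_inv_cancel₀ hK, mul_one, Finset.smul_sum]
    refine Finset.sum_congr rfl fun n _ => ?_
    rw [Finset.smul_sum]
    refine Finset.sum_congr rfl fun k _ => ?_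
    rw [smul_smul]
  have hint : ∀ n ∈ Finset.range (r + 1), ∀ k ∈ Finset.range (r + 1),
      Integrable fun z : ℂ =>
        ((dens ħ l m r q p (‖z‖ ^ 2) : ℂ) * (conj z ^ n * z ^ k)) • v n k := fun n hn k hk =>
    (integrable_dens_monomial r q p hħ hl hm (hle hn) (hle hk)).smul_const _
  have hsum : Integrable fun z : ℂ => ∑ n ∈ Finset.range (r + 1), ∑ k ∈ Finset.range (r + 1),
        ((dens ħ l m r q p (‖z‖ ^ 2) : ℂ) * (conj z ^ n * z ^ k)) • v n k :=
    integrable_finsetSum _ fun n hn => integrable_finsetSum _ fun k hk => hint n hn k hk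
  constructor
  · rw [dm, integrable_withDensity_iff_integrable_smul₀' hmeas htop]
    exact (hsum.congr hcong.symm).smul_measure (by simp)
  · rw [dm, integral_withDensity_eq_integral_toReal_smul₀ hmeas htop, integral_smul_measure,
      integral_congr_ae hcong, integral_finsetSum _ fun n hn =>
        integrable_finsetSum _ fun k hk => hint n hn k hk, Finset.smul_sum]
    refine Finset.sum_congr rfl fun n hn => ?_
    rw [integral_finsetSum _ fun k hk => hint n hn k hk, Finset.sum_eq_single n]
    · rw [integral_smul_const, integral_dens_monomial r q p hħ hl hm n (hle hn), if_pos rfl,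
        ← algebraMap_smul ℂ (_ : ℝ) (_ : V), smul_smul]
      congr 1
      simp only [ENNReal.toReal_ofNat, Complex.coe_algebraMap]
      push_cast; ring
    · intro k _ hk
      rw [integral_smul_const, integral_dens_monomial r q p hħ hl hm k (hle hn), if_neg hk.symm,
        zero_smul]
    · intro h; exact absurd hn h

end Moments

/-! ### Rank one projections -/

section RankOne

variable {E : Type*} [NormedAddCommGroup E] [InnerProductSpace ℂ E]

theorem starProjection_singleton_eq (v : E) : (Submodule.span ℂ {v}).starProjection =
    (((‖v‖ ^ 2 : ℝ) : ℂ)⁻¹) • InnerProductSpace.rankOne ℂ v v := by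
  ext w
  rw [Submodule.starProjection_singleton, _root_.smul_apply,
    InnerProductSpace.rankOne_apply, smul_smul, div_eq_inv_mul]
  rfl

theorem tendsto_starProjection_singleton {α : Type*} {f : Filter α} {v : α → E} {v₀ : E}
    (hv : Tendsto v f (𝓝 v₀)) (h₀ : v₀ ≠ 0) :
    Tendsto (fun a => (Submodule.span ℂ {v a}).starProjection) f
      (𝓝 (Submodule.span ℂ {v₀}).starProjection) := by
  simp only [starProjection_singleton_eq]
  have h1 : Tendsto (fun a => (((‖v a‖ ^ 2 : ℝ) : ℂ)⁻¹)) f (𝓝 (((‖v₀‖ ^ 2 : ℝ) : ℂ)⁻¹)) := by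
    refine Tendsto.inv₀ ?_ ?_
    · exact (Complex.continuous_ofReal.tendsto _).comp (hv.norm.pow 2)
    · have : ‖v₀‖ ^ 2 ≠ 0 := pow_ne_zero 2 (norm_ne_zero_iff.2 h₀)
      exact_mod_cast this
  have h2 : Tendsto (fun a => InnerProductSpace.rankOne ℂ (v a) (v a)) f
      (𝓝 (InnerProductSpace.rankOne ℂ v₀ v₀)) := by
    rw [tendsto_iff_norm_sub_tendsto_zero]
    have hd : Tendsto (fun a => ‖v a - v₀‖) f (𝓝 0) := tendsto_iff_norm_sub_tendsto_zero.1 hv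
    have hb : Tendsto (fun a => ‖v a - v₀‖ * ‖v a‖ + ‖v₀‖ * ‖v a - v₀‖) f (𝓝 0) := by
      simpa using (hd.mul hv.norm).add (hd.const_mul ‖v₀‖)
    refine squeeze_zero (fun _ => norm_nonneg _) (fun a => ?_) hb
    have e : InnerProductSpace.rankOne ℂ (v a) (v a) - InnerProductSpace.rankOne ℂ v₀ v₀ =
        InnerProductSpace.rankOne ℂ (v a - v₀) (v a) +
          InnerProductSpace.rankOne ℂ v₀ (v a - v₀) := by
      ext w
      simp
    rw [e, ← InnerProductSpace.norm_rankOne (𝕜 := ℂ), ← InnerProductSpace.norm_rankOne (𝕜 := ℂ)]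
    exact norm_add_le _ _
  exact h1.smul h2

theorem span_smul_singleton_eq {c : ℂ} (hc : c ≠ 0) (v : E) :
    Submodule.span ℂ {c • v} = Submodule.span ℂ {v} :=
  Submodule.span_singleton_smul_eq hc.isUnit v

end RankOne

/-! ### Resolution of unity and the coherent transform -/

section Transform

variable {ħ ω₁ ω₂ : ℝ} {l m r q p : ℕ} {P0 : Sch}

theorem toL2_coh (z : ℂ) : toL2 (coh ħ ω₁ ω₂ l m r q P0 z) =
    ∑ n ∈ Finset.range (r + 1), ((dcoef ħ l q n : ℂ) * z ^ n) •
      toL2 (tower ħ ω₁ ω₂ l m P0 n) := by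
  simp only [coh_eq, map_sum, map_smul]

theorem eventually_ne_zero_cocompact : ∀ᶠ z : ℂ in cocompact ℂ, z ≠ 0 :=
  (isCompact_singleton.compl_mem_cocompact : ({0}ᶜ : Set ℂ) ∈ cocompact ℂ)

/-- A polynomial with vector coefficients, divided by `z ^ r`, converges at infinity to its
coefficient of degree `r`. -/
theorem tendsto_inv_pow_smul_sum {V : Type*} [NormedAddCommGroup V] [NormedSpace ℂ V] (r : ℕ)
    (v : ℕ → V) :
    Tendsto (fun z : ℂ => (z ^ r)⁻¹ • ∑ n ∈ Finset.range (r + 1), z ^ n • v n) (cocompact ℂ)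
      (𝓝 (v r)) := by
  have hlim : Tendsto (fun z : ℂ => ∑ n ∈ Finset.range (r + 1), z⁻¹ ^ (r - n) • v n)
      (cocompact ℂ) (𝓝 (∑ n ∈ Finset.range (r + 1), (0 : ℂ) ^ (r - n) • v n)) := by
    have hinv : Tendsto (fun z : ℂ => z⁻¹) (cocompact ℂ) (𝓝 0) := by
      rw [← Metric.cobounded_eq_cocompact]; exact tendsto_inv₀_cobounded
    exact tendsto_finsetSum _ fun n _ => (hinv.pow _).smul_const _
  have hval : ∑ n ∈ Finset.range (r + 1), (0 : ℂ) ^ (r - n) • v n = v r := by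
    rw [Finset.sum_range_succ, Finset.sum_eq_zero]
    · simp
    · intro n hn
      rw [zero_pow (by have := Finset.mem_range.1 hn; omega), zero_smul]
  rw [hval] at hlim
  refine hlim.congr' ?_
  filter_upwards [eventually_ne_zero_cocompact] with z hz
  rw [Finset.smul_sum]
  refine Finset.sum_congr rfl fun n hn => ?_
  have hn' : n ≤ r := Nat.lt_succ_iff.1 (Finset.mem_range.1 hn)
  rw [smul_smul, inv_pow]
  congr 1
  have : z ^ r = z ^ (r - n) * z ^ n := by rw [← pow_add, Nat.sub_add_cancel hn']
  rw [this]
  field_simp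

/-- The coherent states, normalized at infinity, converge to a multiple of `A₊^r P0`. -/
theorem tendsto_coh_div :
    Tendsto (fun z : ℂ => (z ^ r)⁻¹ • toL2 (coh ħ ω₁ ω₂ l m r q P0 z)) (cocompact ℂ)
      (𝓝 ((dcoef ħ l q r : ℂ) • toL2 (tower ħ ω₁ ω₂ l m P0 r))) := by
  refine (tendsto_inv_pow_smul_sum r fun n =>
    (dcoef ħ l q n : ℂ) • toL2 (tower ħ ω₁ ω₂ l m P0 n)).congr fun z => ?_
  rw [toL2_coh]
  simp only [smul_smul, mul_comm]

theorem cohTrans_coeff (ψ : L2) (n : ℕ) : (cohTrans ħ ω₁ ω₂ l m r q P0 ψ).coeff n =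
    if n ≤ r then (dcoef ħ l q n : ℂ) * inner ℂ (toL2 (tower ħ ω₁ ω₂ l m P0 n)) ψ else 0 := by
  simp only [cohTrans, Polynomial.finsetSum_coeff, Polynomial.coeff_monomial]
  rw [Finset.sum_ite_eq']
  simp only [Finset.mem_range, Nat.lt_succ_iff, dcoef]
  push_cast
  rfl

theorem mem_Pol_of_coeff {phi : ℂ[X]} (h : ∀ n, r < n → phi.coeff n = 0) : phi ∈ Pol r := by
  rw [Polynomial.mem_degreeLE, Polynomial.degree_le_iff_coeff_zero]
  exact fun n hn => h n (by exact_mod_cast hn)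

theorem coeff_of_mem_Pol {phi : ℂ[X]} (h : phi ∈ Pol r) {n : ℕ} (hn : r < n) :
    phi.coeff n = 0 := by
  rw [Polynomial.mem_degreeLE, Polynomial.degree_le_iff_coeff_zero] at h
  exact h n (by exact_mod_cast hn)

theorem eval_of_mem_Pol {phi : ℂ[X]} (h : phi ∈ Pol r) (w : ℂ) :
    phi.eval w = ∑ n ∈ Finset.range (r + 1), phi.coeff n * w ^ n := by
  refine Polynomial.eval_eq_sum_range' (Nat.lt_succ_of_le ?_) w
  exact Polynomial.natDegree_le_iff_degree_le.2 (Polynomial.mem_degreeLE.1 h)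

theorem cohTrans_mem_Pol (ψ : L2) : cohTrans ħ ω₁ ω₂ l m r q P0 ψ ∈ Pol r :=
  mem_Pol_of_coeff fun n hn => by rw [cohTrans_coeff, if_neg (not_le.2 hn)]

theorem cohTrans_add (ψ χ : L2) : cohTrans ħ ω₁ ω₂ l m r q P0 (ψ + χ) =
    cohTrans ħ ω₁ ω₂ l m r q P0 ψ + cohTrans ħ ω₁ ω₂ l m r q P0 χ := by
  ext n
  rw [Polynomial.coeff_add, cohTrans_coeff, cohTrans_coeff, cohTrans_coeff, inner_add_right]
  split_ifs <;> ring

theorem cohTrans_smul (c : ℂ) (ψ : L2) : cohTrans ħ ω₁ ω₂ l m r q P0 (c • ψ) =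
    c • cohTrans ħ ω₁ ω₂ l m r q P0 ψ := by
  ext n
  rw [Polynomial.coeff_smul, cohTrans_coeff, cohTrans_coeff, inner_smul_right, smul_eq_mul]
  split_ifs <;> ring

theorem cohTrans_sum (x : ℕ → ℂ) (f : ℕ → L2) (s : Finset ℕ) :
    cohTrans ħ ω₁ ω₂ l m r q P0 (∑ n ∈ s, x n • f n) =
      ∑ n ∈ s, x n • cohTrans ħ ω₁ ω₂ l m r q P0 (f n) := by
  have h : IsLinearMap ℂ (cohTrans ħ ω₁ ω₂ l m r q P0) := ⟨cohTrans_add, cohTrans_smul⟩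
  exact (map_sum (h.mk' _) (fun n => x n • f n) s).trans
    (Finset.sum_congr rfl fun n _ => cohTrans_smul _ _)

/-- The inverse coherent transform, computed from the moments of the density. -/
theorem integrable_invIntegrand (hħ : 0 < ħ) (hl : 0 < l) (hm : 0 < m) {phi : ℂ[X]}
    (hphi : phi ∈ Pol r) :
    Integrable (invIntegrand ħ ω₁ ω₂ l m r q p P0 phi) (dm ħ l m r q p) ∧
      invTrans ħ ω₁ ω₂ l m r q p P0 phi = ∑ n ∈ Finset.range (r + 1),
        ((weight ħ l m r q p n * dcoef ħ l q n : ℝ) * phi.coeff n : ℂ) •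
          toL2 (tower ħ ω₁ ω₂ l m P0 n) := by
  have h := integrable_dm_and_integral r q p hħ hl hm
    (fun n k => (phi.coeff n * (dcoef ħ l q k : ℂ)) • toL2 (tower ħ ω₁ ω₂ l m P0 k))
    (F := invIntegrand ħ ω₁ ω₂ l m r q p P0 phi) (fun z => by
      rw [invIntegrand, eval_of_mem_Pol hphi, toL2_coh, div_eq_inv_mul, mul_smul]
      congr 1
      rw [Finset.sum_smul]
      refine Finset.sum_congr rfl fun n _ => ?_
      rw [Finset.smul_sum]
      refine Finset.sum_congr rfl fun k _ => ?_
      rw [smul_smul, smul_smul]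
      congr 1
      ring)
  refine ⟨h.1, ?_⟩
  rw [invTrans, h.2, Finset.smul_sum]
  refine Finset.sum_congr rfl fun n _ => ?_
  rw [smul_smul, smul_smul]
  congr 1
  have h1 : (Real.pi : ℂ) ≠ 0 := by exact_mod_cast Real.pi_ne_zero
  have h2 : (ħ : ℂ) ≠ 0 := by exact_mod_cast hħ.ne'
  push_cast
  field_simp

variable (hω₁ : 0 < ω₁) (hω₂ : 0 < ω₂) (hv : IsVacuum ħ ω₁ ω₂ l m r q p P0)

include hω₁ hω₂ hv

theorem toL2_tower_ne_zero (hħ : 0 < ħ) {n : ℕ} (hn : n ≤ r) :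
    toL2 (tower ħ ω₁ ω₂ l m P0 n) ≠ 0 := fun h => by
  have := inner_tower_self hω₁ hω₂ hv hn
  rw [h, inner_zero_left] at this
  exact (towerSq_pos hħ l m r q p n).ne (by exact_mod_cast this)

theorem cohProj_eq (hħ : 0 < ħ) (hl : 0 < l) (z : ℂ) : cohProj ħ ω₁ ω₂ l m r q P0 z =
    ((Kern ħ l m r q p z : ℂ)⁻¹) • InnerProductSpace.rankOne ℂ
      (toL2 (coh ħ ω₁ ω₂ l m r q P0 z)) (toL2 (coh ħ ω₁ ω₂ l m r q P0 z)) := by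
  rw [cohProj, starProjection_singleton_eq, norm_sq_coh hω₁ hω₂ hv hħ hl]

theorem cohProj_apply (hħ : 0 < ħ) (hl : 0 < l) (z : ℂ) (ψ : L2) :
    cohProj ħ ω₁ ω₂ l m r q P0 z ψ =
      (inner ℂ (toL2 (coh ħ ω₁ ω₂ l m r q P0 z)) ψ / (Kern ħ l m r q p z : ℂ)) •
        toL2 (coh ħ ω₁ ω₂ l m r q P0 z) := by
  rw [cohProj_eq hω₁ hω₂ hv hħ hl, _root_.smul_apply, InnerProductSpace.rankOne_apply, smul_smul,
    div_eq_inv_mul]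

theorem tendsto_cohProj (hħ : 0 < ħ) :
    Tendsto (fun z => cohProj ħ ω₁ ω₂ l m r q P0 z) (cocompact ℂ)
      (𝓝 (cohProjInf ħ ω₁ ω₂ l m r P0)) := by
  have hd : (dcoef ħ l q r : ℂ) ≠ 0 := by exact_mod_cast (dcoef_pos hħ l q r).ne'
  have h := tendsto_starProjection_singleton
    (tendsto_coh_div (ħ := ħ) (ω₁ := ω₁) (ω₂ := ω₂) (l := l) (m := m) (r := r) (q := q) (P0 := P0))
    (smul_ne_zero hd (toL2_tower_ne_zero hω₁ hω₂ hv hħ le_rfl))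
  rw [cohProjInf]
  simp only [span_smul_singleton_eq hd] at h
  refine h.congr' ?_
  filter_upwards [eventually_ne_zero_cocompact] with z hz
  simp only [cohProj, span_smul_singleton_eq (inv_ne_zero (pow_ne_zero r hz))]

/-- The coherent projections resolve the identity of the subspace. -/
theorem resolution_of_unity (hħ : 0 < ħ) (hl : 0 < l) (hm : 0 < m) :
    Integrable (fun z => cohProj ħ ω₁ ω₂ l m r q P0 z) (dm ħ l m r q p) ∧
      ((1 / (2 * Real.pi * ħ) : ℝ) : ℂ) •
          ∫ z, cohProj ħ ω₁ ω₂ l m r q P0 z ∂(dm ħ l m r q p) =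
        (Lsub ħ ω₁ ω₂ l m r P0).starProjection := by
  set t := fun n => toL2 (tower ħ ω₁ ω₂ l m P0 n) with ht
  have h := integrable_dm_and_integral r q p hħ hl hm
    (fun n k => ((dcoef ħ l q n : ℂ) * (dcoef ħ l q k : ℂ)) •
      InnerProductSpace.rankOne ℂ (t k) (t n))
    (F := fun z => cohProj ħ ω₁ ω₂ l m r q P0 z) (fun z => by
      rw [cohProj_eq hω₁ hω₂ hv hħ hl]
      congr 1
      rw [toL2_coh, map_sum]
      refine Finset.sum_congr rfl fun n _ => ?_
      rw [map_sum, _root_.sum_apply]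
      refine Finset.sum_congr rfl fun k _ => ?_
      rw [map_smulₛₗ, map_smul, _root_.smul_apply, smul_smul, smul_smul]
      congr 1
      simp only [map_mul, map_pow, Complex.conj_ofReal]
      ring)
  refine ⟨h.1, ?_⟩
  rw [h.2]
  refine ContinuousLinearMap.ext fun u => ?_
  have hval : (((1 / (2 * Real.pi * ħ) : ℝ) : ℂ) • ∑ n ∈ Finset.range (r + 1),
      ((2 * Real.pi * ħ * weight ħ l m r q p n : ℝ) : ℂ) •
        ((dcoef ħ l q n : ℂ) * (dcoef ħ l q n : ℂ)) • InnerProductSpace.rankOne ℂ (t n) (t n)) u =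
      ∑ n ∈ Finset.range (r + 1), (((weight ħ l m r q p n * dcoef ħ l q n ^ 2 : ℝ) : ℂ) *
        inner ℂ (t n) u) • t n := by
    rw [_root_.smul_apply, _root_.sum_apply, Finset.smul_sum]
    refine Finset.sum_congr rfl fun n _ => ?_
    rw [_root_.smul_apply, _root_.smul_apply, InnerProductSpace.rankOne_apply, smul_smul,
      smul_smul, smul_smul]
    congr 1
    have h1 : (Real.pi : ℂ) ≠ 0 := by exact_mod_cast Real.pi_ne_zero
    have h2 : (ħ : ℂ) ≠ 0 := by exact_mod_cast hħ.ne'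
    push_cast
    field_simp
  rw [hval]
  symm
  refine Submodule.eq_starProjection_of_mem_orthogonal (mem_Lsub_iff.2 ⟨_, rfl⟩) ?_
  rw [Submodule.mem_orthogonal]
  intro w hw
  obtain ⟨x, rfl⟩ := mem_Lsub_iff.1 hw
  rw [sum_inner]
  refine Finset.sum_eq_zero fun k hk => ?_
  rw [inner_smul_left, inner_sub_right, inner_tower_sum hω₁ hω₂ hv hħ hl _
    (Nat.lt_succ_iff.1 (Finset.mem_range.1 hk))]
  have h1 : (((weight ħ l m r q p k * dcoef ħ l q k ^ 2 : ℝ) : ℂ)) *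
      (towerSq ħ l m r q p k : ℂ) = 1 := by
    rw [← Complex.ofReal_mul, mul_assoc, dcoef_sq_mul_towerSq hħ, weight_mul_kcoef hħ,
      Complex.ofReal_one]
  rw [mul_right_comm, h1, one_mul, ht, sub_self, mul_zero]

theorem cohTrans_tower (hħ : 0 < ħ) (hl : 0 < l) {n : ℕ} (hn : n ≤ r) :
    cohTrans ħ ω₁ ω₂ l m r q P0 (toL2 (tower ħ ω₁ ω₂ l m P0 n)) =
      Polynomial.monomial n ((dcoef ħ l q n : ℂ) * towerSq ħ l m r q p n) := by
  ext k
  rw [cohTrans_coeff, Polynomial.coeff_monomial]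
  by_cases h : n = k
  · subst h
    rw [if_pos hn, if_pos rfl, inner_tower_self hω₁ hω₂ hv hn]
  · rw [if_neg h, inner_tower_of_ne hω₁ hω₂ hv hħ hl (Ne.symm h), mul_zero, ite_self]

theorem invTrans_cohTrans (hħ : 0 < ħ) (hl : 0 < l) (hm : 0 < m) {ψ : L2}
    (hψ : ψ ∈ Lsub ħ ω₁ ω₂ l m r P0) :
    invTrans ħ ω₁ ω₂ l m r q p P0 (cohTrans ħ ω₁ ω₂ l m r q P0 ψ) = ψ := by
  rw [(integrable_invIntegrand hħ hl hm (cohTrans_mem_Pol ψ)).2]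
  obtain ⟨x, rfl⟩ := mem_Lsub_iff.1 hψ
  refine Finset.sum_congr rfl fun n hn => ?_
  have hn' : n ≤ r := Nat.lt_succ_iff.1 (Finset.mem_range.1 hn)
  rw [cohTrans_coeff, if_pos hn', inner_tower_sum hω₁ hω₂ hv hħ hl x hn']
  congr 1
  have h1 : ((weight ħ l m r q p n : ℂ)) * ((dcoef ħ l q n : ℂ) ^ 2 *
      (towerSq ħ l m r q p n : ℂ)) = 1 := by
    exact_mod_cast (dcoef_sq_mul_towerSq hħ l m r q p n) ▸ weight_mul_kcoef hħ l m r q p n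
  push_cast
  linear_combination x n * h1

theorem cohTrans_invTrans (hħ : 0 < ħ) (hl : 0 < l) (hm : 0 < m) {phi : ℂ[X]}
    (hphi : phi ∈ Pol r) :
    cohTrans ħ ω₁ ω₂ l m r q P0 (invTrans ħ ω₁ ω₂ l m r q p P0 phi) = phi := by
  rw [(integrable_invIntegrand hħ hl hm hphi).2]
  ext n
  rw [cohTrans_coeff]
  split_ifs with hn
  · rw [inner_tower_sum hω₁ hω₂ hv hħ hl _ hn]
    have h1 : ((weight ħ l m r q p n : ℂ)) * ((dcoef ħ l q n : ℂ) ^ 2 *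
        (towerSq ħ l m r q p n : ℂ)) = 1 := by
      exact_mod_cast (dcoef_sq_mul_towerSq hħ l m r q p n) ▸ weight_mul_kcoef hħ l m r q p n
    push_cast
    linear_combination phi.coeff n * h1
  · rw [coeff_of_mem_Pol hphi (not_le.1 hn)]

omit hω₁ hω₂ hv in
theorem invTrans_mem_Lsub (hħ : 0 < ħ) (hl : 0 < l) (hm : 0 < m) {phi : ℂ[X]}
    (hphi : phi ∈ Pol r) :
    invTrans ħ ω₁ ω₂ l m r q p P0 phi ∈ Lsub ħ ω₁ ω₂ l m r P0 := by
  rw [(integrable_invIntegrand hħ hl hm hphi).2]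
  exact mem_Lsub_iff.2 ⟨_, rfl⟩

/-- The coherent transform intertwines the generators on the vectors `A₊ⁿ P0`. -/
theorem cohTrans_opA_tower (hħ : 0 < ħ) (hl : 0 < l) (hp : p < m) (g : Gen)
    {n : ℕ} (hn : n ≤ r) :
    cohTrans ħ ω₁ ω₂ l m r q P0 (toL2 (opA ħ ω₁ ω₂ l m g (tower ħ ω₁ ω₂ l m P0 n))) =
      opPol ħ l m r q p g (cohTrans ħ ω₁ ω₂ l m r q P0 (toL2 (tower ħ ω₁ ω₂ l m P0 n))) := by
  rw [cohTrans_tower hω₁ hω₂ hv hħ hl hn]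
  cases g with
  | one =>
    rw [opA_one_tower hω₁ hω₂ hv, map_smul, cohTrans_smul, cohTrans_tower hω₁ hω₂ hv hħ hl hn]
    ext k
    rw [opPol_one_coeff, Polynomial.coeff_smul, Polynomial.coeff_monomial, smul_eq_mul]
    split_ifs with h
    · rw [h]
    · simp
  | two =>
    rw [opA_two_tower hω₁ hω₂ hv, map_smul, cohTrans_smul, cohTrans_tower hω₁ hω₂ hv hħ hl hn]
    ext k
    rw [opPol_two_coeff, Polynomial.coeff_smul, Polynomial.coeff_monomial, smul_eq_mul]
    split_ifs with h
    · rw [h]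
    · simp
  | plus =>
    have hR : opPol ħ l m r q p .plus
        (Polynomial.monomial n ((dcoef ħ l q n : ℂ) * towerSq ħ l m r q p n)) =
        Polynomial.monomial (n + 1) ((rhoPlusPoly ħ m).eval (eig1 ħ m r p (n + 1)) *
          ((dcoef ħ l q n : ℂ) * towerSq ħ l m r q p n)) := by
      ext k
      cases k with
      | zero => rw [opPol_plus_coeff_zero, Polynomial.coeff_monomial, if_neg (by omega)]
      | succ k =>
        rw [opPol_plus_coeff_succ, Polynomial.coeff_monomial, Polynomial.coeff_monomial]
        by_cases h : n = k
        · rw [if_pos h, if_pos (by omega), h]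
        · rw [if_neg h, if_neg (by omega), mul_zero]
    rw [hR, ← tower_succ]
    rcases hn.lt_or_eq with h | h
    · rw [cohTrans_tower hω₁ hω₂ hv hħ hl h, towerSq_succ h]
      congr 1
      rw [mu, ← dcoef_succ hħ l q n]
      ring
    · rw [h, tower_last hω₁ hω₂ hv hp, rhoPlus_eval_last hp, zero_mul, map_zero, map_zero]
      have := cohTrans_smul (ħ := ħ) (ω₁ := ω₁) (ω₂ := ω₂) (l := l) (m := m) (r := r) (q := q)
        (P0 := P0) 0 0
      rwa [zero_smul, zero_smul] at this
  | minus =>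
    cases n with
    | zero =>
      rw [tower_zero, hv.annul]
      ext k
      rw [map_zero, opPol_minus_coeff, cohTrans_coeff, inner_zero_right, Polynomial.coeff_monomial]
      simp
    | succ n =>
      rw [opA_minus_tower hω₁ hω₂ hv, map_smul, cohTrans_smul,
        cohTrans_tower hω₁ hω₂ hv hħ hl (by omega)]
      ext k
      rw [opPol_minus_coeff, Polynomial.coeff_smul, Polynomial.coeff_monomial,
        Polynomial.coeff_monomial, smul_eq_mul]
      by_cases h : n = k
      · rw [if_pos h, if_pos (by omega), towerSq_succ (by omega), ← h, ← dcoef_succ hħ l q n]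
        ring
      · rw [if_neg h, if_neg (by omega), mul_zero, mul_zero]

/-- The coherent transform intertwines the two representations. -/
theorem cohTrans_intertwines (hħ : 0 < ħ) (hl : 0 < l) (hp : p < m)
    {π : ResAlg ħ l m →ₐ[ℂ] Module.End ℂ Sch} (hπ : ∀ g, π (gen ħ l m g) = opA ħ ω₁ ω₂ l m g)
    {τ : ResAlg ħ l m →ₐ[ℂ] Module.End ℂ ℂ[X]}
    (hτ : ∀ g, τ (gen ħ l m g) = opPol ħ l m r q p g) (F : ResAlg ħ l m) {ψ : L2}
    (hψ : ψ ∈ Lsub ħ ω₁ ω₂ l m r P0) :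
    opL2 (π F) ψ ∈ Lsub ħ ω₁ ω₂ l m r P0 ∧
      cohTrans ħ ω₁ ω₂ l m r q P0 (opL2 (π F) ψ) =
        τ F (cohTrans ħ ω₁ ω₂ l m r q P0 ψ) := by
  have hex : ∀ ψ ∈ Lsub ħ ω₁ ω₂ l m r P0, ∃ χ : Sch, toL2 χ = ψ := fun ψ hψ => by
    obtain ⟨x, rfl⟩ := mem_Lsub_iff.1 hψ
    exact ⟨∑ n ∈ Finset.range (r + 1), x n • tower ħ ω₁ ω₂ l m P0 n, by
      simp only [map_sum, map_smul]⟩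
  induction F using resAlg_induction generalizing ψ with
  | hs c =>
    obtain ⟨χ, rfl⟩ := hex ψ hψ
    rw [opL2_toL2, AlgHom.commutes, AlgHom.commutes, Module.algebraMap_end_apply,
      Module.algebraMap_end_apply, map_smul, cohTrans_smul]
    exact ⟨Submodule.smul_mem _ _ hψ, rfl⟩
  | hg g =>
    rw [hπ, hτ]
    refine ⟨opL2_mem_Lsub hω₁ hω₂ hv hp g hψ, ?_⟩
    obtain ⟨x, rfl⟩ := mem_Lsub_iff.1 hψ
    have e : opL2 (opA ħ ω₁ ω₂ l m g) (∑ n ∈ Finset.range (r + 1), x n •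
        toL2 (tower ħ ω₁ ω₂ l m P0 n)) = ∑ n ∈ Finset.range (r + 1), x n •
          toL2 (opA ħ ω₁ ω₂ l m g (tower ħ ω₁ ω₂ l m P0 n)) := by
      simp only [← map_smul, ← map_sum]
      rw [opL2_toL2]
    rw [e, cohTrans_sum, cohTrans_sum, map_sum]
    refine Finset.sum_congr rfl fun n hn => ?_
    rw [map_smul, cohTrans_opA_tower hω₁ hω₂ hv hħ hl hp g
      (Nat.lt_succ_iff.1 (Finset.mem_range.1 hn))]
  | hm a b ha hb =>
    obtain ⟨hb1, hb2⟩ := hb hψ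
    obtain ⟨ha1, ha2⟩ := ha hb1
    obtain ⟨χ, rfl⟩ := hex ψ hψ
    have e : opL2 (π (a * b)) (toL2 χ) = opL2 (π a) (opL2 (π b) (toL2 χ)) := by
      rw [opL2_toL2, opL2_toL2, opL2_toL2, map_mul, Module.End.mul_apply]
    rw [e, ha2, hb2, map_mul, Module.End.mul_apply]
    exact ⟨ha1, rfl⟩
  | ha a b ha hb =>
    obtain ⟨hb1, hb2⟩ := hb hψ
    obtain ⟨ha1, ha2⟩ := ha hψ
    obtain ⟨χ, rfl⟩ := hex ψ hψ
    have e : opL2 (π (a + b)) (toL2 χ) = opL2 (π a) (toL2 χ) + opL2 (π b) (toL2 χ) := by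
      rw [opL2_toL2, opL2_toL2, opL2_toL2, map_add, LinearMap.add_apply, map_add]
    rw [e, cohTrans_add, ha2, hb2, map_add, LinearMap.add_apply]
    exact ⟨add_mem ha1 hb1, rfl⟩

/-- The inverse coherent transform intertwines the two representations. -/
theorem invTrans_intertwines (hħ : 0 < ħ) (hl : 0 < l) (hm : 0 < m) (hp : p < m)
    {π : ResAlg ħ l m →ₐ[ℂ] Module.End ℂ Sch} (hπ : ∀ g, π (gen ħ l m g) = opA ħ ω₁ ω₂ l m g)
    {τ : ResAlg ħ l m →ₐ[ℂ] Module.End ℂ ℂ[X]}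
    (hτ : ∀ g, τ (gen ħ l m g) = opPol ħ l m r q p g) (F : ResAlg ħ l m) {phi : ℂ[X]}
    (hphi : phi ∈ Pol r) :
    τ F phi ∈ Pol r ∧ invTrans ħ ω₁ ω₂ l m r q p P0 (τ F phi) =
      opL2 (π F) (invTrans ħ ω₁ ω₂ l m r q p P0 phi) := by
  obtain ⟨h1, h2⟩ := cohTrans_intertwines hω₁ hω₂ hv hħ hl hp hπ hτ F
    (invTrans_mem_Lsub (ω₁ := ω₁) (ω₂ := ω₂) (q := q) (p := p) (P0 := P0) hħ hl hm hphi)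
  rw [cohTrans_invTrans hω₁ hω₂ hv hħ hl hm hphi] at h2
  rw [← h2]
  exact ⟨cohTrans_mem_Pol _, invTrans_cohTrans hω₁ hω₂ hv hħ hl hm h1⟩

end Transform

/-! ### Traces and Wick symbols -/

/-- Parseval's identity: the trace of a rank one operator. -/
theorem hasTrace_rankOne (u v : L2) : HasTrace (fun ψ => (inner ℂ u ψ : ℂ) • v) (inner ℂ u v) :=
  fun _ e => by
    simp only [inner_smul_right]
    exact e.hasSum_inner_mul_inner u v

theorem hasTrace_opL2_starProjection (T : Module.End ℂ Sch) (χ : Sch) :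
    HasTrace (fun ψ => opL2 T ((Submodule.span ℂ {toL2 χ}).starProjection ψ))
      (inner ℂ (toL2 χ) (toL2 (T χ)) / ((‖toL2 χ‖ ^ 2 : ℝ) : ℂ)) := by
  have h := hasTrace_rankOne (toL2 χ) ((((‖toL2 χ‖ ^ 2 : ℝ) : ℂ)⁻¹) • toL2 (T χ))
  rw [inner_smul_right, inv_mul_eq_div] at h
  convert h using 2 with ψ
  rw [Submodule.starProjection_singleton, smul_smul, ← div_eq_mul_inv, ← map_smul, opL2_toL2,
    map_smul, map_smul]
  rfl

section Wick

variable {ħ ω₁ ω₂ : ℝ} {l m r q p : ℕ} {P0 : Sch} (hω₁ : 0 < ω₁) (hω₂ : 0 < ω₂)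
  (hv : IsVacuum ħ ω₁ ω₂ l m r q p P0)

theorem kerPol_coeff (z : ℂ) (n : ℕ) : (kerPol ħ l m r q p z).coeff n =
    if n ≤ r then (kcoef ħ l m r q p n : ℂ) * z ^ n else 0 := by
  simp only [kerPol, Polynomial.finsetSum_coeff, Polynomial.coeff_monomial]
  rw [Finset.sum_ite_eq']
  simp only [Finset.mem_range, Nat.lt_succ_iff]

include hω₁ hω₂ hv

theorem cohTrans_coh (hħ : 0 < ħ) (hl : 0 < l) (z : ℂ) :
    cohTrans ħ ω₁ ω₂ l m r q P0 (toL2 (coh ħ ω₁ ω₂ l m r q P0 z)) = kerPol ħ l m r q p z := by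
  ext n
  rw [cohTrans_coeff, kerPol_coeff]
  split_ifs with hn
  · rw [toL2_coh, inner_tower_sum hω₁ hω₂ hv hħ hl _ hn, ← dcoef_sq_mul_towerSq hħ]
    push_cast
    ring
  · rfl

theorem invTrans_kerPol (hħ : 0 < ħ) (hl : 0 < l) (hm : 0 < m) (z : ℂ) :
    invTrans ħ ω₁ ω₂ l m r q p P0 (kerPol ħ l m r q p z) =
      toL2 (coh ħ ω₁ ω₂ l m r q P0 z) := by
  rw [← cohTrans_coh hω₁ hω₂ hv hħ hl, invTrans_cohTrans hω₁ hω₂ hv hħ hl hm (coh_mem_Lsub z)]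

/-- The Wick symbol is the normalized diagonal matrix element in the coherent states. -/
theorem wick_transOp (hħ : 0 < ħ) (hl : 0 < l) (hm : 0 < m) (S : L2 → L2) (z : ℂ) :
    wick ħ l m r q p (transOp ħ ω₁ ω₂ l m r q p P0 S) z =
      inner ℂ (toL2 (coh ħ ω₁ ω₂ l m r q P0 z)) (S (toL2 (coh ħ ω₁ ω₂ l m r q P0 z))) /
        (Kern ħ l m r q p z : ℂ) := by
  rw [wick, transOp, invTrans_kerPol hω₁ hω₂ hv hħ hl hm, cohTrans_eval]

theorem hasTrace_wick (hħ : 0 < ħ) (hl : 0 < l) (hm : 0 < m) (T : Module.End ℂ Sch) (z : ℂ) :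
    HasTrace (fun ψ => opL2 T (cohProj ħ ω₁ ω₂ l m r q P0 z ψ))
      (wick ħ l m r q p (transOp ħ ω₁ ω₂ l m r q p P0 (opL2 T)) z) := by
  rw [wick_transOp hω₁ hω₂ hv hħ hl hm, opL2_toL2, ← norm_sq_coh hω₁ hω₂ hv hħ hl]
  exact hasTrace_opL2_starProjection T _

/-- The Wick symbol extends continuously to the point at infinity of the phase space. -/
theorem tendsto_wick (hħ : 0 < ħ) (hl : 0 < l) (hm : 0 < m) (T : Module.End ℂ Sch) :
    ∃ t : ℂ, Tendsto (wick ħ l m r q p (transOp ħ ω₁ ω₂ l m r q p P0 (opL2 T)))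
        (cocompact ℂ) (𝓝 t) ∧
      HasTrace (fun ψ => opL2 T (cohProjInf ħ ω₁ ω₂ l m r P0 ψ)) t := by
  refine ⟨_, ?_, hasTrace_opL2_starProjection T _⟩
  have hd : (dcoef ħ l q r : ℂ) ≠ 0 := by exact_mod_cast (dcoef_pos hħ l q r).ne'
  have ht0 : toL2 (tower ħ ω₁ ω₂ l m P0 r) ≠ 0 := toL2_tower_ne_zero hω₁ hω₂ hv hħ le_rfl
  have h1 := tendsto_coh_div (ħ := ħ) (ω₁ := ω₁) (ω₂ := ω₂) (l := l) (m := m) (r := r) (q := q)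
    (P0 := P0)
  have h2 : Tendsto (fun z : ℂ => (z ^ r)⁻¹ • toL2 (T (coh ħ ω₁ ω₂ l m r q P0 z))) (cocompact ℂ)
      (𝓝 ((dcoef ħ l q r : ℂ) • toL2 (T (tower ħ ω₁ ω₂ l m P0 r)))) := by
    refine (tendsto_inv_pow_smul_sum r fun n =>
      (dcoef ħ l q n : ℂ) • toL2 (T (tower ħ ω₁ ω₂ l m P0 n))).congr fun z => ?_
    simp only [coh_eq, map_sum, map_smul, smul_smul, mul_comm]
  have h3 : Tendsto (fun z : ℂ => ((‖(z ^ r)⁻¹ • toL2 (coh ħ ω₁ ω₂ l m r q P0 z)‖ ^ 2 : ℝ) : ℂ))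
      (cocompact ℂ)
      (𝓝 ((‖(dcoef ħ l q r : ℂ) • toL2 (tower ħ ω₁ ω₂ l m P0 r)‖ ^ 2 : ℝ) : ℂ)) :=
    (Complex.continuous_ofReal.tendsto _).comp (h1.norm.pow 2)
  have hne : ((‖(dcoef ħ l q r : ℂ) • toL2 (tower ħ ω₁ ω₂ l m P0 r)‖ ^ 2 : ℝ) : ℂ) ≠ 0 := by
    exact_mod_cast pow_ne_zero 2 (norm_ne_zero_iff.2 (smul_ne_zero hd ht0))
  -- the quotient is invariant under rescaling of the vector
  have key : ∀ (c : ℂ) (χ : Sch), c ≠ 0 →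
      inner ℂ (c • toL2 χ) (c • toL2 (T χ)) / ((‖c • toL2 χ‖ ^ 2 : ℝ) : ℂ) =
        inner ℂ (toL2 χ) (toL2 (T χ)) / ((‖toL2 χ‖ ^ 2 : ℝ) : ℂ) := fun c χ hc => by
    rw [inner_smul_left, inner_smul_right, norm_smul, mul_pow, ← mul_assoc, Complex.conj_mul']
    push_cast
    refine mul_div_mul_left _ _ (pow_ne_zero 2 ?_)
    exact_mod_cast norm_ne_zero_iff.2 hc
  have h4 := (h1.inner h2 (𝕜 := ℂ)).div h3 hne
  rw [key _ _ hd] at h4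
  refine h4.congr' ?_
  filter_upwards [eventually_ne_zero_cocompact] with z hz
  rw [wick_transOp hω₁ hω₂ hv hħ hl hm, opL2_toL2, ← norm_sq_coh hω₁ hω₂ hv hħ hl]
  exact key _ _ (inv_ne_zero (pow_ne_zero r hz))

/-- Diagonal matrix elements of coherent projections. -/
theorem inner_cohProj (hħ : 0 < ħ) (hl : 0 < l) (a b : ℂ) :
    inner ℂ (toL2 (coh ħ ω₁ ω₂ l m r q P0 b))
      (cohProj ħ ω₁ ω₂ l m r q P0 a (toL2 (coh ħ ω₁ ω₂ l m r q P0 b))) /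
        (Kern ħ l m r q p b : ℂ) = prob ħ l m r q p a b := by
  rw [cohProj_apply hω₁ hω₂ hv hħ hl, inner_smul_right, ← inner_conj_symm
    (toL2 (coh ħ ω₁ ω₂ l m r q P0 b)), inner_coh hω₁ hω₂ hv hħ hl, prob, div_mul_eq_mul_div,
    Complex.mul_conj', div_div]
  push_cast
  rfl

theorem hasTrace_cohProj_cohProj (hħ : 0 < ħ) (hl : 0 < l) (a b : ℂ) :
    HasTrace (fun ψ => cohProj ħ ω₁ ω₂ l m r q P0 a (cohProj ħ ω₁ ω₂ l m r q P0 b ψ))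
      (prob ħ l m r q p a b) := by
  have h := hasTrace_rankOne (toL2 (coh ħ ω₁ ω₂ l m r q P0 b))
    (((Kern ħ l m r q p b : ℂ)⁻¹) •
      cohProj ħ ω₁ ω₂ l m r q P0 a (toL2 (coh ħ ω₁ ω₂ l m r q P0 b)))
  rw [inner_smul_right, inv_mul_eq_div, inner_cohProj hω₁ hω₂ hv hħ hl] at h
  convert h using 2 with ψ
  rw [cohProj_apply hω₁ hω₂ hv hħ hl b, map_smul, smul_smul, div_eq_mul_inv]

/-- Transformed operators are given by the ordered polynomials that represent them. -/
theorem transOp_ordEval (hħ : 0 < ħ) (hl : 0 < l) (hm : 0 < m) (hp : p < m)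
    {π : ResAlg ħ l m →ₐ[ℂ] Module.End ℂ Sch} (hπ : ∀ g, π (gen ħ l m g) = opA ħ ω₁ ω₂ l m g)
    {τ : ResAlg ħ l m →ₐ[ℂ] Module.End ℂ ℂ[X]}
    (hτ : ∀ g, τ (gen ħ l m g) = opPol ħ l m r q p g) {F : ResAlg ħ l m}
    {P : MvPolynomial Gen ℂ} (hF : F = ordEval (gen ħ l m) P) :
    π F = ordEval (opA ħ ω₁ ω₂ l m) P ∧ ∀ phi ∈ Pol r,
      transOp ħ ω₁ ω₂ l m r q p P0 (opL2 (π F)) phi = ordEval (opPol ħ l m r q p) P phi := by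
  refine ⟨by rw [hF, map_ordEval, funext hπ], fun phi hphi => ?_⟩
  rw [transOp, (cohTrans_intertwines hω₁ hω₂ hv hħ hl hp hπ hτ F
    (invTrans_mem_Lsub (ω₁ := ω₁) (ω₂ := ω₂) (q := q) (p := p) (P0 := P0) hħ hl hm hphi)).2,
    cohTrans_invTrans hω₁ hω₂ hv hħ hl hm hphi, hF, map_ordEval, funext hτ]

end Wick

/-! ### The operator `ρ₊(A₁)` -/

/-- The factors `A₁ + jħ` of `ρ₊(A₁)` are bounded below since `A₁` is nonnegative. -/
theorem rhoPlusA_injective {ħ : ℝ} (hħ : 0 < ħ) (ω₁ ω₂ : ℝ) (l m : ℕ) :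
    Function.Injective (rhoPlusA ħ ω₁ ω₂ l m) := by
  have hfac : ∀ j : ℕ, ∀ f : Sch, Polynomial.aeval (opA ħ ω₁ ω₂ l m .one)
      (Polynomial.X + Polynomial.C (((j : ℂ) + 1) * (ħ : ℂ))) f = 0 → f = 0 := by
    intro j f h
    have hn : ∀ g : Sch, inner ℂ (toL2 g) (toL2 g) = ((‖toL2 g‖ ^ 2 : ℝ) : ℂ) := fun g => by
      rw [inner_self_eq_norm_sq_to_K]; push_cast; rfl
    have h1 : inner ℂ (toL2 f) (toL2 (opA ħ ω₁ ω₂ l m .one f)) =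
        ((‖toL2 (b1 ħ ω₁ f)‖ ^ 2 : ℝ) : ℂ) := by
      rw [opA, Module.End.mul_apply, ← (isAdj_b1s ħ ω₁).symm, hn]
    have h2 := congrArg (fun g => inner ℂ (toL2 f) (toL2 g)) h
    simp only [map_add, Polynomial.aeval_X, Polynomial.aeval_C, LinearMap.add_apply,
      Module.algebraMap_end_apply, map_smul, inner_add_right, inner_smul_right, h1,
      hn, map_zero, inner_zero_right] at h2
    have h3 : ‖toL2 (b1 ħ ω₁ f)‖ ^ 2 + (j + 1) * ħ * ‖toL2 f‖ ^ 2 = 0 := by exact_mod_cast h2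
    have h4 : ‖toL2 f‖ ^ 2 = 0 := by
      have hc : 0 < ((j : ℝ) + 1) * ħ := by positivity
      have h5 : 0 ≤ ((j : ℝ) + 1) * ħ * ‖toL2 f‖ ^ 2 := by positivity
      have h6 : ((j : ℝ) + 1) * ħ * ‖toL2 f‖ ^ 2 = 0 := by
        linarith [sq_nonneg ‖toL2 (b1 ħ ω₁ f)‖]
      exact (mul_eq_zero.1 h6).resolve_left hc.ne'
    exact toL2_injective ((norm_eq_zero.1 (pow_eq_zero_iff two_ne_zero |>.1 h4)).trans
      (map_zero toL2).symm)
  have hprod : ∀ k : ℕ, ∀ f : Sch,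
      Polynomial.aeval (opA ħ ω₁ ω₂ l m .one) (rhoPlusPoly ħ k) f = 0 → f = 0 := by
    intro k
    induction k with
    | zero => intro f h; simpa [rhoPlusPoly] using h
    | succ k ih =>
      intro f h
      rw [rhoPlusPoly, Finset.prod_range_succ, map_mul, Module.End.mul_apply] at h
      exact hfac k f (ih _ h)
  exact (injective_iff_map_eq_zero _).2 (hprod m)

theorem rhoPlus_eval_ne_zero {ħ : ℝ} (hħ : 0 < ħ) {m r p n : ℕ} (hn : n ≤ r) :
    (rhoPlusPoly ħ m).eval (eig1 ħ m r p n) ≠ 0 := by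
  rw [eig1_eq hn, rhoPlus_eval_nat]
  have h : 0 < ħ ^ m * ((((r - n) * m + p + m)! : ℝ) / ((r - n) * m + p)!) := by positivity
  exact_mod_cast h.ne'

section RhoPlus

variable {ħ ω₁ ω₂ : ℝ} {l m r q p : ℕ} {P0 : Sch}

theorem exists_of_mem_Lsub {ψ : Sch} (hψ : toL2 ψ ∈ Lsub ħ ω₁ ω₂ l m r P0) :
    ∃ x : ℕ → ℂ, ψ = ∑ n ∈ Finset.range (r + 1), x n • tower ħ ω₁ ω₂ l m P0 n := by
  obtain ⟨x, hx⟩ := mem_Lsub_iff.1 hψ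
  exact ⟨x, toL2_injective (by rw [hx]; simp only [map_sum, map_smul])⟩

theorem sum_tower_mem_Lsub (x : ℕ → ℂ) :
    toL2 (∑ n ∈ Finset.range (r + 1), x n • tower ħ ω₁ ω₂ l m P0 n) ∈
      Lsub ħ ω₁ ω₂ l m r P0 :=
  mem_Lsub_iff.2 ⟨x, by simp only [map_sum, map_smul]⟩

variable (hω₁ : 0 < ω₁) (hω₂ : 0 < ω₂) (hv : IsVacuum ħ ω₁ ω₂ l m r q p P0)

include hω₁ hω₂ hv

theorem rhoPlusA_tower (n : ℕ) : rhoPlusA ħ ω₁ ω₂ l m (tower ħ ω₁ ω₂ l m P0 n) =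
    (rhoPlusPoly ħ m).eval (eig1 ħ m r p n) • tower ħ ω₁ ω₂ l m P0 n :=
  aeval_apply_eig (opA_one_tower hω₁ hω₂ hv n) _

theorem rhoPlusAInv_sum (hħ : 0 < ħ) (x : ℕ → ℂ) :
    rhoPlusAInv ħ ω₁ ω₂ l m (∑ n ∈ Finset.range (r + 1), x n • tower ħ ω₁ ω₂ l m P0 n) =
      ∑ n ∈ Finset.range (r + 1),
        (x n / (rhoPlusPoly ħ m).eval (eig1 ħ m r p n)) • tower ħ ω₁ ω₂ l m P0 n := by
  have h : rhoPlusA ħ ω₁ ω₂ l m (∑ n ∈ Finset.range (r + 1),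
      (x n / (rhoPlusPoly ħ m).eval (eig1 ħ m r p n)) • tower ħ ω₁ ω₂ l m P0 n) =
      ∑ n ∈ Finset.range (r + 1), x n • tower ħ ω₁ ω₂ l m P0 n := by
    rw [map_sum]
    refine Finset.sum_congr rfl fun n hn => ?_
    rw [map_smul, rhoPlusA_tower hω₁ hω₂ hv, smul_smul, div_mul_cancel₀ _
      (rhoPlus_eval_ne_zero hħ (Nat.lt_succ_iff.1 (Finset.mem_range.1 hn)))]
  rw [← h]
  exact Function.leftInverse_invFun (rhoPlusA_injective hħ ω₁ ω₂ l m) _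

theorem exists_rhoPlusA_eq (hħ : 0 < ħ) {ψ : Sch} (hψ : toL2 ψ ∈ Lsub ħ ω₁ ω₂ l m r P0) :
    ∃ χ : Sch, toL2 χ ∈ Lsub ħ ω₁ ω₂ l m r P0 ∧ rhoPlusA ħ ω₁ ω₂ l m χ = ψ := by
  obtain ⟨x, rfl⟩ := exists_of_mem_Lsub hψ
  refine ⟨_, sum_tower_mem_Lsub fun n => x n / (rhoPlusPoly ħ m).eval (eig1 ħ m r p n), ?_⟩
  rw [map_sum]
  refine Finset.sum_congr rfl fun n hn => ?_
  rw [map_smul, rhoPlusA_tower hω₁ hω₂ hv, smul_smul, div_mul_cancel₀ _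
    (rhoPlus_eval_ne_zero hħ (Nat.lt_succ_iff.1 (Finset.mem_range.1 hn)))]

end RhoPlus

/-! ### Double power series in `z̄` and `z` -/

theorem infinite_sphere : (Metric.sphere (0 : ℂ) 1).Infinite := by
  have h := isConnected_sphere (E := ℂ) (by rw [Complex.rank_real_complex]; norm_num) 0 zero_le_one
  refine h.isPreconnected.infinite_of_nontrivial ⟨1, by simp, -1, by simp, ?_⟩
  norm_num

/-- The coefficients of a double power series `∑ g_{ab} z̄ᵃ zᵇ` are determined by its sum near
zero: along each ray the homogeneous components vanish, and a homogeneous component that vanishes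
on the unit circle is a polynomial in `ζ²` with infinitely many zeros. -/
theorem HasExpansion.eq_zero {g : ℕ → ℕ → ℂ} (h : HasExpansion (fun _ => 0) g) (a b : ℕ) :
    g a b = 0 := by
  have hom : ∀ ζ : ℂ, ∀ N : ℕ,
      ∑ i ∈ Finset.HasAntidiagonal.antidiagonal N, g i.1 i.2 * conj ζ ^ i.1 * ζ ^ i.2 = 0 := by
    intro ζ
    set C : ℕ → ℂ := fun N =>
      ∑ i ∈ Finset.HasAntidiagonal.antidiagonal N, g i.1 i.2 * conj ζ ^ i.1 * ζ ^ i.2 with hC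
    let P : FormalMultilinearSeries ℝ ℝ ℂ := fun n =>
      ContinuousMultilinearMap.mkPiRing ℝ (Fin n) (C n)
    have hcoef : ∀ n, P.coeff n = C n := fun n => by simp [P, FormalMultilinearSeries.coeff]
    have hP : HasFPowerSeriesAt (0 : ℝ → ℂ) P 0 := by
      rw [hasFPowerSeriesAt_iff]
      have ht : Tendsto (fun t : ℝ => (t : ℂ) * ζ) (𝓝 0) (𝓝 0) := by
        have : Continuous fun t : ℝ => (t : ℂ) * ζ := by fun_prop
        simpa using this.tendsto 0
      filter_upwards [ht.eventually h] with t hs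
      have hs2 := ((Finset.HasAntidiagonal.sigmaAntidiagonalEquivProd (A := ℕ)).hasSum_iff.2
        hs).sigma fun N => hasSum_fintype _
      refine hs2.congr_fun ?_
      intro N
      rw [hcoef, hC, Complex.real_smul]
      simp only [Function.comp_apply,
        Finset.HasAntidiagonal.sigmaAntidiagonalEquivProd_apply]
      rw [Finset.sum_coe_sort (Finset.HasAntidiagonal.antidiagonal N)
        (fun i => g i.1 i.2 * conj ((t : ℂ) * ζ) ^ i.1 * ((t : ℂ) * ζ) ^ i.2), Finset.mul_sum]
      refine Finset.sum_congr rfl fun i hi => ?_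
      rw [← Finset.HasAntidiagonal.mem_antidiagonal.1 hi, map_mul, Complex.conj_ofReal]
      push_cast
      ring
    intro N
    change C N = 0
    rw [← hcoef, hP.eq_zero]
    rfl
  set Q : ℂ[X] := ∑ i ∈ Finset.HasAntidiagonal.antidiagonal (a + b),
    Polynomial.monomial i.2 (g i.1 i.2) with hQ
  have hroot : Polynomial.expand ℂ 2 Q = 0 := by
    refine Polynomial.eq_zero_of_infinite_isRoot _ (infinite_sphere.mono fun ζ hζ => ?_)
    have h1 : conj ζ * ζ = 1 := by
      rw [Complex.conj_mul', mem_sphere_zero_iff_norm.1 hζ]; norm_num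
    change Polynomial.eval ζ _ = 0
    rw [Polynomial.expand_eval, hQ, Polynomial.eval_finsetSum]
    have h2 := congrArg (fun x => ζ ^ (a + b) * x) (hom ζ (a + b))
    simp only [mul_zero, Finset.mul_sum] at h2
    rw [← h2]
    refine Finset.sum_congr rfl fun i hi => ?_
    rw [Polynomial.eval_monomial, ← Finset.HasAntidiagonal.mem_antidiagonal.1 hi, pow_add]
    have h3 : conj ζ ^ i.1 * ζ ^ i.1 = 1 := by rw [← mul_pow, h1, one_pow]
    linear_combination (-g i.1 i.2 * ζ ^ i.2 * ζ ^ i.2) * h3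
  have hQ0 := (Polynomial.expand_eq_zero two_pos).1 hroot
  have hc := congrArg (fun p => Polynomial.coeff p b) hQ0
  simp only [hQ, Polynomial.finsetSum_coeff, Polynomial.coeff_monomial, Polynomial.coeff_zero] at hc
  rw [Finset.sum_eq_single (a, b)] at hc
  · simpa using hc
  · intro i hi hne
    refine if_neg fun h => hne ?_
    have := Finset.HasAntidiagonal.mem_antidiagonal.1 hi
    exact Prod.ext (by omega) h
  · exact fun h => absurd (Finset.HasAntidiagonal.mem_antidiagonal.2
      (rfl : (a, b).1 + (a, b).2 = a + b)) h

/-- Reindexing by the diagonal shift `(j, k) ↦ (j + n, k + n)`. -/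
theorem hasSum_shift {V : Type*} [NormedAddCommGroup V] {g : ℕ × ℕ → V} {v : V} (n : ℕ)
    (h : HasSum g v) :
    HasSum (fun i : ℕ × ℕ => if n ≤ i.1 ∧ n ≤ i.2 then g (i.1 - n, i.2 - n) else 0) v := by
  have hinj : Function.Injective fun i : ℕ × ℕ => (i.1 + n, i.2 + n) := fun i j hij => by
    simp only [Prod.mk.injEq, add_left_inj] at hij
    exact Prod.ext hij.1 hij.2
  refine (hinj.hasSum_iff ?_).1 ?_
  · intro i hi
    refine if_neg fun h => hi ⟨(i.1 - n, i.2 - n), ?_⟩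
    exact Prod.ext (Nat.sub_add_cancel h.1) (Nat.sub_add_cancel h.2)
  · convert h using 1
    funext i
    simp

/-- Multiplication of a double power series by the polynomial `∑ κ_n |z|^{2n}`. -/
theorem HasExpansion.mul_kernel {f : ℂ → ℂ} {c : ℕ → ℕ → ℂ} (h : HasExpansion f c) (r : ℕ)
    (κ : ℕ → ℂ) :
    HasExpansion (fun z => (∑ n ∈ Finset.range (r + 1), κ n * (conj z * z) ^ n) * f z)
      (fun a b => ∑ n ∈ Finset.range (r + 1),
        if n ≤ a ∧ n ≤ b then κ n * c (a - n) (b - n) else 0) := by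
  filter_upwards [h] with z hz
  rw [Finset.sum_mul]
  have := hasSum_sum (s := Finset.range (r + 1)) fun n _ =>
    (hasSum_shift n hz).mul_left (κ n * (conj z * z) ^ n)
  refine this.congr_fun fun i => ?_
  rw [Finset.sum_mul, Finset.sum_mul]
  refine Finset.sum_congr rfl fun n _ => ?_
  split_ifs with hn
  · obtain ⟨d, hd⟩ := Nat.exists_eq_add_of_le hn.1
    obtain ⟨e, he⟩ := Nat.exists_eq_add_of_le hn.2
    rw [hd, he, Nat.add_sub_cancel_left, Nat.add_sub_cancel_left]
    ring
  · simp

theorem HasExpansion.sub {f f' : ℂ → ℂ} {c c' : ℕ → ℕ → ℂ} (h : HasExpansion f c)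
    (h' : HasExpansion f' c') :
    HasExpansion (fun z => f z - f' z) (fun a b => c a b - c' a b) := by
  filter_upwards [h, h'] with z hz hz'
  refine (hz.sub hz').congr_fun fun i => ?_
  ring

theorem hasExpansion_finite (r : ℕ) {M : ℕ → ℕ → ℂ}
    (hM : ∀ a b, ¬(a ≤ r ∧ b ≤ r) → M a b = 0) :
    HasExpansion (fun z => ∑ a ∈ Finset.range (r + 1), ∑ b ∈ Finset.range (r + 1),
      M a b * conj z ^ a * z ^ b) M := by
  refine Eventually.of_forall fun z => ?_
  simp only
  rw [← Finset.sum_product' (f := fun a b => M a b * conj z ^ a * z ^ b)]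
  refine hasSum_sum_of_ne_finset_zero fun i hi => ?_
  rw [hM, zero_mul, zero_mul]
  simpa [Nat.lt_succ_iff] using hi

/-- If `k(|z|²) f(z)` is the polynomial with the coefficients `M`, then every expansion of `f`
is related to `M` by multiplication with `k`. -/
theorem HasExpansion.kernel_coeff {f : ℂ → ℂ} {c : ℕ → ℕ → ℂ} (h : HasExpansion f c) {r : ℕ}
    {κ : ℕ → ℂ} {M : ℕ → ℕ → ℂ} (hM : ∀ a b, ¬(a ≤ r ∧ b ≤ r) → M a b = 0)
    (hf : ∀ z, (∑ n ∈ Finset.range (r + 1), κ n * (conj z * z) ^ n) * f z =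
      ∑ a ∈ Finset.range (r + 1), ∑ b ∈ Finset.range (r + 1), M a b * conj z ^ a * z ^ b)
    (a b : ℕ) : ∑ n ∈ Finset.range (r + 1),
        (if n ≤ a ∧ n ≤ b then κ n * c (a - n) (b - n) else 0) = M a b := by
  have h1 := (h.mul_kernel r κ).sub (hasExpansion_finite r hM)
  simp only [hf, sub_self] at h1
  exact sub_eq_zero.1 (h1.eq_zero a b)

/-- Division of a polynomial in `z̄`, `z` by `k(|z|²)` with `k(0) ≠ 0`. -/
theorem exists_hasExpansion {f : ℂ → ℂ} {r : ℕ} {κ : ℕ → ℂ} {M : ℕ → ℕ → ℂ} (hκ : κ 0 ≠ 0)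
    (hf : ∀ z, f z = (∑ n ∈ Finset.range (r + 1), κ n * (conj z * z) ^ n)⁻¹ *
      ∑ a ∈ Finset.range (r + 1), ∑ b ∈ Finset.range (r + 1), M a b * conj z ^ a * z ^ b) :
    ∃ c, HasExpansion f c := by
  have han : AnalyticAt ℂ (fun x : ℂ => (∑ n ∈ Finset.range (r + 1), κ n * x ^ n)⁻¹) 0 := by
    refine AnalyticAt.inv (by fun_prop) ?_
    rw [Finset.sum_range_succ', Finset.sum_eq_zero (fun n _ => by simp)]
    simpa using hκ
  obtain ⟨P, hP⟩ := han
  rw [hasFPowerSeriesAt_iff] at hP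
  set e := P.coeff
  refine ⟨fun j k => ∑ a ∈ Finset.range (r + 1), ∑ b ∈ Finset.range (r + 1),
    if a ≤ j ∧ b ≤ k ∧ j - a = k - b then M a b * e (j - a) else 0, ?_⟩
  have ht : Tendsto (fun z : ℂ => conj z * z) (𝓝 0) (𝓝 0) := by
    have : Continuous fun z : ℂ => conj z * z := by fun_prop
    simpa using this.tendsto 0
  filter_upwards [ht.eventually hP] with z hz
  rw [zero_add] at hz
  rw [hf, Finset.mul_sum]
  have key : ∀ a b : ℕ, HasSum (fun i : ℕ × ℕ =>
      (if a ≤ i.1 ∧ b ≤ i.2 ∧ i.1 - a = i.2 - b then M a b * e (i.1 - a) else 0) *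
        conj z ^ i.1 * z ^ i.2)
      ((∑ n ∈ Finset.range (r + 1), κ n * (conj z * z) ^ n)⁻¹ *
        (M a b * conj z ^ a * z ^ b)) := fun a b => by
    have hinj : Function.Injective fun n : ℕ => (a + n, b + n) := fun i j hij => by
      simpa using hij
    refine (hinj.hasSum_iff ?_).1 ?_
    · intro i hi
      rw [if_neg, zero_mul, zero_mul]
      rintro ⟨h1, h2, h3⟩
      exact hi ⟨i.1 - a, Prod.ext (Nat.add_sub_cancel' h1) (by simp only; omega)⟩
    · refine (hz.mul_right (M a b * conj z ^ a * z ^ b)).congr_fun fun n => ?_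
      simp only [Function.comp_apply, Nat.le_add_right, Nat.add_sub_cancel_left, and_self, if_true,
        smul_eq_mul]
      ring
  have h2 := hasSum_sum (s := Finset.range (r + 1)) fun a _ =>
    hasSum_sum (s := Finset.range (r + 1)) fun b _ => key a b
  simp only [Finset.mul_sum]
  refine h2.congr_fun fun i => ?_
  rw [Finset.sum_mul, Finset.sum_mul]
  refine Finset.sum_congr rfl fun a _ => ?_
  rw [Finset.sum_mul, Finset.sum_mul]

/-- Resummation along the diagonals: if `s` is shifted by `j` and `y` by `k` in the term with the
coefficient `c_{jk}`, then the double series is the action of the matrix `M`. The vectors `s a` are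
powers `z̄ᵃ` for operators on polynomials, and multiples of `A₊ᵃ P0` for operators in `L²`. -/
theorem hasSum_reorder {V : Type*} [NormedAddCommGroup V] [NormedSpace ℂ V] {r : ℕ} {κ : ℕ → ℂ}
    {c M : ℕ → ℕ → ℂ} (hM : ∀ a b, ¬(a ≤ r ∧ b ≤ r) → M a b = 0)
    (hc : ∀ a b, ∑ n ∈ Finset.range (r + 1),
      (if n ≤ a ∧ n ≤ b then κ n * c (a - n) (b - n) else 0) = M a b)
    (s : ℕ → V) (y : ℕ → ℂ)
    (hs : ∀ n, Summable fun i : ℕ × ℕ => (c i.1 i.2 * (κ n * y (i.2 + n))) • s (i.1 + n)) :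
    HasSum (fun i : ℕ × ℕ => ∑ n ∈ Finset.range (r + 1),
        (c i.1 i.2 * (κ n * y (i.2 + n))) • s (i.1 + n))
      (∑ a ∈ Finset.range (r + 1), ∑ b ∈ Finset.range (r + 1), (M a b * y b) • s a) := by
  have h1 := hasSum_sum (s := Finset.range (r + 1)) fun n _ => (hs n).hasSum
  have h2 := hasSum_sum (s := Finset.range (r + 1)) fun n _ => hasSum_shift n (hs n).hasSum
  have h3 : HasSum (fun i : ℕ × ℕ => (M i.1 i.2 * y i.2) • s i.1)
      (∑ a ∈ Finset.range (r + 1), ∑ b ∈ Finset.range (r + 1), (M a b * y b) • s a) := by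
    rw [← Finset.sum_product' (f := fun a b => (M a b * y b) • s a)]
    refine hasSum_sum_of_ne_finset_zero fun i hi => ?_
    rw [hM, zero_mul, zero_smul]
    simpa [Nat.lt_succ_iff] using hi
  have h4 : (fun i : ℕ × ℕ => ∑ n ∈ Finset.range (r + 1), if n ≤ i.1 ∧ n ≤ i.2 then
      (c (i.1 - n) (i.2 - n) * (κ n * y (i.2 - n + n))) • s (i.1 - n + n) else 0) =
      fun i => (M i.1 i.2 * y i.2) • s i.1 := by
    funext i
    rw [← hc, Finset.sum_mul, Finset.sum_smul]
    refine Finset.sum_congr rfl fun n _ => ?_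
    split_ifs with hn
    · rw [Nat.sub_add_cancel hn.1, Nat.sub_add_cancel hn.2]
      congr 1
      ring
    · rw [zero_mul, zero_smul]
  simp only at h2
  rw [h4] at h2
  rwa [h2.unique h3] at h1

/-! ### Reconstruction of an operator from its Wick symbol -/

section Reconstruction

variable {ħ ω₁ ω₂ : ℝ} {l m r q p : ℕ} {P0 : Sch}

/-- The matrix elements of an operator between the summands of the coherent states, extended
by zero. -/
noncomputable def wickMat (ħ ω₁ ω₂ : ℝ) (l m r q : ℕ) (P0 : Sch) (T : Module.End ℂ Sch)
    (a b : ℕ) : ℂ :=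
  if a ≤ r ∧ b ≤ r then (dcoef ħ l q a : ℂ) * dcoef ħ l q b *
    inner ℂ (toL2 (tower ħ ω₁ ω₂ l m P0 a)) (toL2 (T (tower ħ ω₁ ω₂ l m P0 b))) else 0

theorem wickMat_of_not {T : Module.End ℂ Sch} (a b : ℕ) (h : ¬(a ≤ r ∧ b ≤ r)) :
    wickMat ħ ω₁ ω₂ l m r q P0 T a b = 0 := if_neg h

theorem sum_kcoef_eq_Kern (z : ℂ) :
    ∑ n ∈ Finset.range (r + 1), (kcoef ħ l m r q p n : ℂ) * (conj z * z) ^ n =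
      (Kern ħ l m r q p z : ℂ) := Ksharp_self ħ l m r q p z

/-- The vectors `𝐬_n`, proportional to `A₊ⁿ P0`, on which `𝐳*` acts as the shift. They vanish for
`n > r`. -/
noncomputable def shiftVec (ħ ω₁ ω₂ : ℝ) (l m r q p : ℕ) (P0 : Sch) (n : ℕ) : Sch :=
  ((dcoef ħ l q n / kcoef ħ l m r q p n : ℝ) : ℂ) • tower ħ ω₁ ω₂ l m P0 n

theorem kcoef_smul_shiftVec (hħ : 0 < ħ) (n : ℕ) :
    (kcoef ħ l m r q p n : ℂ) • shiftVec ħ ω₁ ω₂ l m r q p P0 n =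
      (dcoef ħ l q n : ℂ) • tower ħ ω₁ ω₂ l m P0 n := by
  have h : (kcoef ħ l m r q p n : ℂ) ≠ 0 := by exact_mod_cast (kcoef_pos hħ l m r q p n).ne'
  rw [shiftVec, smul_smul]
  congr 1
  push_cast
  field_simp

variable (hω₁ : 0 < ω₁) (hω₂ : 0 < ω₂) (hv : IsVacuum ħ ω₁ ω₂ l m r q p P0)

include hω₁ hω₂ hv

theorem wick_eq_wickMat (hħ : 0 < ħ) (hl : 0 < l) (hm : 0 < m) (T : Module.End ℂ Sch) (z : ℂ) :
    wick ħ l m r q p (transOp ħ ω₁ ω₂ l m r q p P0 (opL2 T)) z =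
      (∑ n ∈ Finset.range (r + 1), (kcoef ħ l m r q p n : ℂ) * (conj z * z) ^ n)⁻¹ *
      ∑ a ∈ Finset.range (r + 1), ∑ b ∈ Finset.range (r + 1),
        wickMat ħ ω₁ ω₂ l m r q P0 T a b * conj z ^ a * z ^ b := by
  rw [wick_transOp hω₁ hω₂ hv hħ hl hm, opL2_toL2, sum_kcoef_eq_Kern, div_eq_inv_mul, coh_eq]
  congr 1
  simp only [map_sum, map_smul, sum_inner, inner_sum, inner_smul_left, inner_smul_right, map_mul,
    map_pow, Complex.conj_ofReal]
  rw [Finset.sum_comm]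
  refine Finset.sum_congr rfl fun b hb => ?_
  rw [Finset.mul_sum]
  refine Finset.sum_congr rfl fun a ha => ?_
  rw [wickMat, if_pos ⟨Nat.lt_succ_iff.1 (Finset.mem_range.1 ha),
    Nat.lt_succ_iff.1 (Finset.mem_range.1 hb)⟩]
  ring

/-- The matrix elements of an operator in terms of any expansion of its Wick symbol. -/
theorem wickMat_eq_of_hasExpansion (hħ : 0 < ħ) (hl : 0 < l) (hm : 0 < m)
    {T : Module.End ℂ Sch} {c : ℕ → ℕ → ℂ} (hc : HasExpansion
      (wick ħ l m r q p (transOp ħ ω₁ ω₂ l m r q p P0 (opL2 T))) c) (a b : ℕ) :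
    ∑ n ∈ Finset.range (r + 1),
        (if n ≤ a ∧ n ≤ b then (kcoef ħ l m r q p n : ℂ) * c (a - n) (b - n) else 0) =
      wickMat ħ ω₁ ω₂ l m r q P0 T a b := by
  refine hc.kernel_coeff (κ := fun n => (kcoef ħ l m r q p n : ℂ)) wickMat_of_not (fun z => ?_) a b
  rw [wick_eq_wickMat hω₁ hω₂ hv hħ hl hm, mul_inv_cancel_left₀]
  rw [sum_kcoef_eq_Kern]
  exact_mod_cast (Kern_pos hħ l m r q p z).ne'

theorem tower_of_lt (hp : p < m) {n : ℕ} (hn : r < n) : tower ħ ω₁ ω₂ l m P0 n = 0 := by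
  obtain ⟨d, rfl⟩ := Nat.exists_eq_add_of_lt hn
  induction d with
  | zero => exact tower_last hω₁ hω₂ hv hp
  | succ d ih =>
    rw [show r + (d + 1) + 1 = r + d + 1 + 1 by ring, tower_succ, ih (by omega), map_zero]

theorem shiftVec_of_lt (hp : p < m) {n : ℕ} (hn : r < n) :
    shiftVec ħ ω₁ ω₂ l m r q p P0 n = 0 := by
  rw [shiftVec, tower_of_lt hω₁ hω₂ hv hp hn, smul_zero]

/-- In other words, `𝐳* = ρ₊(A₁)⁻¹ A₊` maps each vector `𝐬_n` to the next one. -/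
theorem rhoPlusA_shiftVec_succ (hħ : 0 < ħ) (hp : p < m) (n : ℕ) :
    rhoPlusA ħ ω₁ ω₂ l m (shiftVec ħ ω₁ ω₂ l m r q p P0 (n + 1)) =
      opA ħ ω₁ ω₂ l m .plus (shiftVec ħ ω₁ ω₂ l m r q p P0 n) := by
  rcases lt_or_ge n r with hn | hn
  · rw [shiftVec, shiftVec, map_smul, map_smul, rhoPlusA_tower hω₁ hω₂ hv, ← tower_succ, smul_smul]
    congr 1
    have h0 : ∀ n, (dcoef ħ l q n : ℂ) ≠ 0 := fun n => by
      exact_mod_cast (dcoef_pos hħ l q n).ne'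
    have h1 : ∀ n, (towerSq ħ l m r q p n : ℂ) ≠ 0 := fun n => by
      exact_mod_cast (towerSq_pos hħ l m r q p n).ne'
    have h2 := towerSq_succ (ħ := ħ) (l := l) (m := m) (q := q) (p := p) hn
    have h3 := dcoef_succ hħ l q n
    rw [mu] at h2
    have hne := h1 (n + 1)
    rw [h2] at hne
    have h4 := right_ne_zero_of_mul (left_ne_zero_of_mul hne)
    have h5 := left_ne_zero_of_mul (left_ne_zero_of_mul hne)
    rw [← dcoef_sq_mul_towerSq hħ, ← dcoef_sq_mul_towerSq hħ]
    push_cast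
    rw [h2, ← h3]
    have h6 := h0 (n + 1)
    have h7 := h1 n
    field_simp
  · rw [shiftVec_of_lt hω₁ hω₂ hv hp (by omega), map_zero, shiftVec, map_smul, ← tower_succ,
      tower_of_lt hω₁ hω₂ hv hp (by omega), smul_zero]

theorem iterate_zStarOp (hħ : 0 < ħ) (hp : p < m) (x : ℕ → ℂ) (j : ℕ) :
    (zStarOp ħ ω₁ ω₂ l m)^[j]
        (∑ n ∈ Finset.range (r + 1), x n • shiftVec ħ ω₁ ω₂ l m r q p P0 n) =
      ∑ n ∈ Finset.range (r + 1), x n • shiftVec ħ ω₁ ω₂ l m r q p P0 (j + n) := by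
  induction j with
  | zero => simp
  | succ j ih =>
    rw [Function.iterate_succ_apply', ih, zStarOp]
    have h : opA ħ ω₁ ω₂ l m .plus
        (∑ n ∈ Finset.range (r + 1), x n • shiftVec ħ ω₁ ω₂ l m r q p P0 (j + n)) =
        rhoPlusA ħ ω₁ ω₂ l m
          (∑ n ∈ Finset.range (r + 1), x n • shiftVec ħ ω₁ ω₂ l m r q p P0 (j + 1 + n)) := by
      simp only [map_sum, map_smul, Nat.add_right_comm j 1,
        rhoPlusA_shiftVec_succ hω₁ hω₂ hv hħ hp]
    rw [h]
    exact Function.leftInverse_invFun (rhoPlusA_injective hħ ω₁ ω₂ l m) _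

/-- With respect to the summands of the coherent states, `𝐳` acts as the backward shift. -/
theorem zOp_sum (hħ : 0 < ħ) {y : ℕ → ℂ} (hy : ∀ n, r < n → y n = 0) :
    zOp ħ ω₁ ω₂ l m
        (∑ n ∈ Finset.range (r + 1), (y n * dcoef ħ l q n) • tower ħ ω₁ ω₂ l m P0 n) =
      ∑ n ∈ Finset.range (r + 1), (y (n + 1) * dcoef ħ l q n) • tower ħ ω₁ ω₂ l m P0 n := by
  rw [zOp, rhoPlusAInv_sum hω₁ hω₂ hv hħ, map_sum, Finset.sum_range_succ', map_smul, tower_zero,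
    hv.annul, smul_zero, add_zero, Finset.sum_range_succ _ r, hy (r + 1) (by omega), zero_mul,
    zero_smul, add_zero]
  refine Finset.sum_congr rfl fun n hn => ?_
  have hne := rhoPlus_eval_ne_zero hħ (m := m) (p := p)
    (show n + 1 ≤ r from Finset.mem_range.1 hn)
  rw [map_smul, opA_minus_tower hω₁ hω₂ hv, smul_smul, mu, ← dcoef_succ hħ l q n]
  congr 1
  field_simp

theorem iterate_zOp (hħ : 0 < ħ) {y : ℕ → ℂ} (hy : ∀ n, r < n → y n = 0) (k : ℕ) :
    (zOp ħ ω₁ ω₂ l m)^[k]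
        (∑ n ∈ Finset.range (r + 1), (y n * dcoef ħ l q n) • tower ħ ω₁ ω₂ l m P0 n) =
      ∑ n ∈ Finset.range (r + 1), (y (k + n) * dcoef ħ l q n) • tower ħ ω₁ ω₂ l m P0 n := by
  induction k with
  | zero => simp
  | succ k ih =>
    rw [Function.iterate_succ_apply', ih,
      zOp_sum hω₁ hω₂ hv hħ (y := fun n => y (k + n)) fun n hn => hy _ (by omega)]
    simp only [Nat.add_right_comm k 1, add_assoc]

theorem iterate_zStarOp_zOp (hħ : 0 < ħ) (hp : p < m) {y : ℕ → ℂ} (hy : ∀ n, r < n → y n = 0)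
    (j k : ℕ) :
    (zStarOp ħ ω₁ ω₂ l m)^[j] ((zOp ħ ω₁ ω₂ l m)^[k]
        (∑ n ∈ Finset.range (r + 1), (y n * dcoef ħ l q n) • tower ħ ω₁ ω₂ l m P0 n)) =
      ∑ n ∈ Finset.range (r + 1),
        ((kcoef ħ l m r q p n : ℂ) * y (k + n)) • shiftVec ħ ω₁ ω₂ l m r q p P0 (j + n) := by
  rw [iterate_zOp hω₁ hω₂ hv hħ hy, ← iterate_zStarOp hω₁ hω₂ hv hħ hp]
  congr 1
  refine Finset.sum_congr rfl fun n _ => ?_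
  rw [mul_smul, ← kcoef_smul_shiftVec (m := m) (r := r) (p := p) hħ, smul_smul, mul_comm]

omit hω₁ hω₂ hv in
/-- Matrix elements of `T` in a vector of the irreducible subspace. -/
theorem dcoef_mul_inner (T : Module.End ℂ Sch) (y : ℕ → ℂ) {a : ℕ} (ha : a ≤ r) :
    (dcoef ħ l q a : ℂ) * inner ℂ (toL2 (tower ħ ω₁ ω₂ l m P0 a))
      (toL2 (T (∑ n ∈ Finset.range (r + 1), (y n * dcoef ħ l q n) • tower ħ ω₁ ω₂ l m P0 n))) =
      ∑ b ∈ Finset.range (r + 1), wickMat ħ ω₁ ω₂ l m r q P0 T a b * y b := by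
  simp only [map_sum, map_smul, inner_sum, inner_smul_right, Finset.mul_sum]
  refine Finset.sum_congr rfl fun b hb => ?_
  rw [wickMat, if_pos ⟨ha, Nat.lt_succ_iff.1 (Finset.mem_range.1 hb)⟩]
  ring

theorem toL2_apply_eq (hħ : 0 < ħ) (hl : 0 < l) (T : Module.End ℂ Sch) (y : ℕ → ℂ)
    (hT : toL2 (T (∑ n ∈ Finset.range (r + 1), (y n * dcoef ħ l q n) • tower ħ ω₁ ω₂ l m P0 n)) ∈
      Lsub ħ ω₁ ω₂ l m r P0) :
    toL2 (T (∑ n ∈ Finset.range (r + 1), (y n * dcoef ħ l q n) • tower ħ ω₁ ω₂ l m P0 n)) =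
      ∑ a ∈ Finset.range (r + 1), ∑ b ∈ Finset.range (r + 1),
        (wickMat ħ ω₁ ω₂ l m r q P0 T a b * y b) •
          toL2 (shiftVec ħ ω₁ ω₂ l m r q p P0 a) := by
  have h := fun a (ha : a ≤ r) => dcoef_mul_inner (ħ := ħ) (ω₁ := ω₁) (ω₂ := ω₂) (l := l) (m := m)
    (q := q) (P0 := P0) T y ha
  obtain ⟨x, hx⟩ := mem_Lsub_iff.1 hT
  rw [hx] at h ⊢
  refine Finset.sum_congr rfl fun a ha => ?_
  have ha' := Nat.lt_succ_iff.1 (Finset.mem_range.1 ha)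
  rw [← Finset.sum_smul, ← h a ha', inner_tower_sum hω₁ hω₂ hv hħ hl x ha', shiftVec, map_smul,
    smul_smul, ← dcoef_sq_mul_towerSq hħ]
  congr 1
  have h0 : (dcoef ħ l q a : ℂ) ≠ 0 := by exact_mod_cast (dcoef_pos hħ l q a).ne'
  have h1 : (towerSq ħ l m r q p a : ℂ) ≠ 0 := by
    exact_mod_cast (towerSq_pos hħ l m r q p a).ne'
  push_cast
  field_simp

/-- The operator is the normally ordered double series in `𝐳*`, `𝐳` with the coefficients of its
Wick symbol. -/
theorem hasSum_zStar_z (hħ : 0 < ħ) (hl : 0 < l) (hm : 0 < m) (hp : p < m)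
    {T : Module.End ℂ Sch}
    (hT : ∀ ψ : Sch, toL2 ψ ∈ Lsub ħ ω₁ ω₂ l m r P0 → toL2 (T ψ) ∈ Lsub ħ ω₁ ω₂ l m r P0)
    {c : ℕ → ℕ → ℂ} (hc : HasExpansion
      (wick ħ l m r q p (transOp ħ ω₁ ω₂ l m r q p P0 (opL2 T))) c) {ψ : Sch}
    (hψ : toL2 ψ ∈ Lsub ħ ω₁ ω₂ l m r P0) :
    HasSum (fun i : ℕ × ℕ => c i.1 i.2 •
      toL2 ((zStarOp ħ ω₁ ω₂ l m)^[i.1] ((zOp ħ ω₁ ω₂ l m)^[i.2] ψ))) (opL2 T (toL2 ψ)) := by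
  obtain ⟨x, hx⟩ := exists_of_mem_Lsub hψ
  -- coordinates with respect to the summands of the coherent states
  set y : ℕ → ℂ := fun n => if n ≤ r then x n / dcoef ħ l q n else 0 with hydef
  have hy : ∀ n, r < n → y n = 0 := fun n hn => if_neg (not_le.2 hn)
  have hψy : ψ = ∑ n ∈ Finset.range (r + 1), (y n * dcoef ħ l q n) • tower ħ ω₁ ω₂ l m P0 n := by
    rw [hx]
    refine Finset.sum_congr rfl fun n hn => ?_
    have h0 : (dcoef ħ l q n : ℂ) ≠ 0 := by exact_mod_cast (dcoef_pos hħ l q n).ne'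
    rw [hydef]
    simp only [if_pos (Nat.lt_succ_iff.1 (Finset.mem_range.1 hn)), div_mul_cancel₀ _ h0]
  have hTψ := hT ψ hψ
  rw [hψy] at hTψ ⊢
  rw [opL2_toL2, toL2_apply_eq hω₁ hω₂ hv hħ hl T y hTψ]
  have hK := wickMat_eq_of_hasExpansion hω₁ hω₂ hv hħ hl hm hc
  have h := hasSum_reorder wickMat_of_not hK
    (fun n => toL2 (shiftVec ħ ω₁ ω₂ l m r q p P0 n)) y fun n => by
      refine summable_of_ne_finset_zero (s := Finset.range (r + 1) ×ˢ Finset.range (r + 1))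
        fun i hi => ?_
      simp only [Finset.mem_product, Finset.mem_range, not_and_or, not_lt] at hi
      rcases hi with hi | hi
      · rw [shiftVec_of_lt hω₁ hω₂ hv hp (by omega), map_zero, smul_zero]
      · rw [hy _ (by omega), mul_zero, mul_zero, zero_smul]
  refine h.congr_fun fun i => ?_
  rw [iterate_zStarOp_zOp hω₁ hω₂ hv hħ hp hy, map_sum, Finset.smul_sum]
  refine Finset.sum_congr rfl fun n _ => ?_
  rw [map_smul, smul_smul]

omit hω₁ hω₂ hv in
/-- With respect to the summands of the kernel `k`, the conjugate of the multiplication by `z̄` acts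
as the backward shift. -/
theorem mulVarAdj_sum (hħ : 0 < ħ) {y : ℕ → ℂ} (hy : ∀ n, r < n → y n = 0) :
    mulVarAdj ħ l m r q p (∑ n ∈ Finset.range (r + 1),
        Polynomial.monomial n ((kcoef ħ l m r q p n : ℂ) * y n)) =
      ∑ n ∈ Finset.range (r + 1),
        Polynomial.monomial n ((kcoef ħ l m r q p n : ℂ) * y (n + 1)) := by
  rw [mulVarAdj]
  conv_rhs => rw [Finset.sum_range_succ, hy (r + 1) (by omega), mul_zero, map_zero, add_zero]
  refine Finset.sum_congr rfl fun n hn => ?_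
  congr 1
  simp only [Polynomial.finsetSum_coeff, Polynomial.coeff_monomial]
  rw [Finset.sum_ite_eq', if_pos (Finset.mem_range.2 (by have := Finset.mem_range.1 hn; omega))]
  have h1 : ∀ n, (weight ħ l m r q p n : ℂ) * kcoef ħ l m r q p n = 1 := fun n => by
    exact_mod_cast weight_mul_kcoef hħ l m r q p n
  have h2 := left_ne_zero_of_mul_eq_one (h1 n)
  push_cast
  rw [div_mul_eq_mul_div, div_eq_iff h2]
  linear_combination y (n + 1) * (h1 (n + 1)) - y (n + 1) * h1 n

omit hω₁ hω₂ hv in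
theorem iterate_mulVarAdj (hħ : 0 < ħ) {y : ℕ → ℂ} (hy : ∀ n, r < n → y n = 0) (k : ℕ) :
    (mulVarAdj ħ l m r q p)^[k] (∑ n ∈ Finset.range (r + 1),
        Polynomial.monomial n ((kcoef ħ l m r q p n : ℂ) * y n)) =
      ∑ n ∈ Finset.range (r + 1),
        Polynomial.monomial n ((kcoef ħ l m r q p n : ℂ) * y (k + n)) := by
  induction k with
  | zero => simp
  | succ k ih =>
    rw [Function.iterate_succ_apply', ih,
      mulVarAdj_sum hħ (y := fun n => y (k + n)) fun n hn => hy _ (by omega)]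
    simp only [Nat.add_right_comm k 1, add_assoc]

omit hω₁ hω₂ hv in
/-- Absolute convergence of the expansion at one point bounds the series in powers of `z̄` alone
that occur after the action of the finitely many powers of `z̄*`. -/
theorem summable_of_hasExpansion {f : ℂ → ℂ} {c : ℕ → ℕ → ℂ} (hc : HasExpansion f c)
    {y : ℕ → ℂ} (hy : ∀ n, r < n → y n = 0) (κ : ℕ → ℂ) :
    ∀ᶠ w : ℂ in 𝓝 0, ∀ n, Summable fun i : ℕ × ℕ =>
      (c i.1 i.2 * (κ n * y (i.2 + n))) • w ^ (i.1 + n) := by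
  obtain ⟨ε, hε, hball⟩ := Metric.eventually_nhds_iff.1 hc
  set t : ℝ := ε / 2 with ht
  have ht0 : 0 < t := by positivity
  have hs := (hball (y := (t : ℂ)) (by
    rw [dist_zero_right, Complex.norm_real, Real.norm_of_nonneg ht0.le, ht]; linarith)).summable.norm
  simp only [norm_mul, norm_pow, RCLike.norm_conj, Complex.norm_real,
    Real.norm_of_nonneg ht0.le] at hs
  filter_upwards [Metric.closedBall_mem_nhds (0 : ℂ) ht0] with w hw n
  rw [mem_closedBall_zero_iff] at hw
  set C : ℝ := t ^ n * ‖κ n‖ * ∑ k ∈ Finset.range (r + 1), ‖y (k + n)‖ / t ^ k with hC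
  refine Summable.of_norm_bounded (hs.mul_left C) fun i => ?_
  have hkey : ‖y (i.2 + n)‖ ≤ (∑ k ∈ Finset.range (r + 1), ‖y (k + n)‖ / t ^ k) * t ^ i.2 := by
    rcases lt_or_ge r i.2 with h | h
    · rw [hy _ (by omega), norm_zero]
      positivity
    · rw [← div_le_iff₀ (by positivity)]
      exact Finset.single_le_sum (f := fun k => ‖y (k + n)‖ / t ^ k)
        (fun k _ => by positivity) (Finset.mem_range.2 (Nat.lt_succ_of_le h))
  have hw' : ‖w‖ ^ (i.1 + n) ≤ t ^ (i.1 + n) := pow_le_pow_left₀ (norm_nonneg _) hw _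
  rw [norm_smul, norm_mul, norm_mul, norm_pow]
  calc ‖c i.1 i.2‖ * (‖κ n‖ * ‖y (i.2 + n)‖) * ‖w‖ ^ (i.1 + n)
      ≤ ‖c i.1 i.2‖ * (‖κ n‖ * ((∑ k ∈ Finset.range (r + 1), ‖y (k + n)‖ / t ^ k) * t ^ i.2)) *
        t ^ (i.1 + n) := by gcongr
    _ = C * (‖c i.1 i.2‖ * t ^ i.1 * t ^ i.2) := by rw [hC, pow_add]; ring

/-- The transformed operator is the ordered double series in `z̄` and its conjugate with the
coefficients of the Wick symbol. -/
theorem hasSum_mulVar_mulVarAdj (hħ : 0 < ħ) (hl : 0 < l) (hm : 0 < m)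
    {T : Module.End ℂ Sch} {c : ℕ → ℕ → ℂ} (hc : HasExpansion
      (wick ħ l m r q p (transOp ħ ω₁ ω₂ l m r q p P0 (opL2 T))) c) {phi : ℂ[X]}
    (hphi : phi ∈ Pol r) :
    ∀ᶠ z in 𝓝 (0 : ℂ), HasSum (fun i : ℕ × ℕ => c i.1 i.2 * conj z ^ i.1 *
        ((mulVarAdj ħ l m r q p)^[i.2] phi).eval (conj z))
      ((transOp ħ ω₁ ω₂ l m r q p P0 (opL2 T) phi).eval (conj z)) := by
  set y : ℕ → ℂ := fun n => (weight ħ l m r q p n : ℂ) * phi.coeff n with hydef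
  have hy : ∀ n, r < n → y n = 0 := fun n hn => by
    rw [hydef]; simp only [coeff_of_mem_Pol hphi hn, mul_zero]
  have hphiy : phi = ∑ n ∈ Finset.range (r + 1),
      Polynomial.monomial n ((kcoef ħ l m r q p n : ℂ) * y n) := by
    ext k
    simp only [Polynomial.finsetSum_coeff, Polynomial.coeff_monomial]
    rw [Finset.sum_ite_eq']
    split_ifs with hk
    · have h1 : (weight ħ l m r q p k : ℂ) * kcoef ħ l m r q p k = 1 := by
        exact_mod_cast weight_mul_kcoef hħ l m r q p k
      rw [hydef]
      linear_combination (-phi.coeff k) * h1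
    · exact coeff_of_mem_Pol hphi (by simpa [Nat.lt_succ_iff] using hk)
  have hinv : invTrans ħ ω₁ ω₂ l m r q p P0 phi = toL2 (∑ n ∈ Finset.range (r + 1),
      (y n * dcoef ħ l q n) • tower ħ ω₁ ω₂ l m P0 n) := by
    rw [(integrable_invIntegrand hħ hl hm hphi).2, map_sum]
    refine Finset.sum_congr rfl fun n _ => ?_
    rw [map_smul]
    congr 1
    rw [hydef]
    push_cast
    ring
  have hval : ∀ w : ℂ, (transOp ħ ω₁ ω₂ l m r q p P0 (opL2 T) phi).eval w =
      ∑ a ∈ Finset.range (r + 1), ∑ b ∈ Finset.range (r + 1),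
        (wickMat ħ ω₁ ω₂ l m r q P0 T a b * y b) • w ^ a := fun w => by
    rw [transOp, eval_of_mem_Pol (cohTrans_mem_Pol _), hinv, opL2_toL2]
    refine Finset.sum_congr rfl fun a ha => ?_
    have ha' := Nat.lt_succ_iff.1 (Finset.mem_range.1 ha)
    rw [cohTrans_coeff, if_pos ha', dcoef_mul_inner T y ha', ← Finset.sum_smul,
      smul_eq_mul]
  have hK := wickMat_eq_of_hasExpansion hω₁ hω₂ hv hħ hl hm hc
  have hconj : Tendsto (fun z : ℂ => conj z) (𝓝 0) (𝓝 0) := by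
    simpa using Complex.continuous_conj.tendsto 0
  filter_upwards [hconj.eventually
    (summable_of_hasExpansion hc hy fun n => (kcoef ħ l m r q p n : ℂ))] with z hz
  rw [hval]
  refine (hasSum_reorder wickMat_of_not hK (fun n => conj z ^ n) y hz).congr_fun fun i => ?_
  conv_lhs => rw [hphiy, iterate_mulVarAdj hħ hy, Polynomial.eval_finsetSum, Finset.mul_sum]
  refine Finset.sum_congr rfl fun n _ => ?_
  rw [Polynomial.eval_monomial, smul_eq_mul, pow_add]
  ring

theorem exists_hasExpansion_wick (hħ : 0 < ħ) (hl : 0 < l) (hm : 0 < m) (T : Module.End ℂ Sch) :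
    ∃ c, HasExpansion (wick ħ l m r q p (transOp ħ ω₁ ω₂ l m r q p P0 (opL2 T))) c :=
  exists_hasExpansion (κ := fun n => (kcoef ħ l m r q p n : ℂ))
    (by exact_mod_cast (kcoef_pos hħ l m r q p 0).ne') (wick_eq_wickMat hω₁ hω₂ hv hħ hl hm T)

end Reconstruction

/-! ### The membrane formula for the probability function -/

/-- The exponential of the integral of a logarithmic derivative; no branch of the logarithm is
needed, since `f · exp (-∫ f'/f)` is constant. -/
theorem exp_integral_logDeriv {f f' : ℝ → ℂ} (hf : ∀ s, HasDerivAt f (f' s) s)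
    (hf' : Continuous f') (hne : ∀ s ∈ Icc (0 : ℝ) 1, f s ≠ 0) :
    Complex.exp (∫ s in (0 : ℝ)..1, f' s / f s) = f 1 / f 0 := by
  have hfc : Continuous f := continuous_iff_continuousAt.2 fun s => (hf s).continuousAt
  -- the quotient is extended to a continuous function on the line by its boundary values
  set c : ℝ → ℝ := fun s => max 0 (min 1 s) with hc
  have hcc : Continuous c := by rw [hc]; fun_prop
  have hcm : ∀ s, c s ∈ Icc (0 : ℝ) 1 := fun s =>
    ⟨le_max_left _ _, max_le zero_le_one (min_le_left _ _)⟩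
  have hci : ∀ s ∈ Icc (0 : ℝ) 1, c s = s := fun s hs => by
    rw [hc]; simp only [min_eq_right hs.2, max_eq_right hs.1]
  set g : ℝ → ℂ := fun s => f' (c s) / f (c s) with hg
  have hgc : Continuous g :=
    (hf'.comp hcc).div (hfc.comp hcc) fun s => hne _ (hcm s)
  set G : ℝ → ℂ := fun s => ∫ x in (0 : ℝ)..s, g x with hG
  have hGd : ∀ s, HasDerivAt G (g s) s := fun s =>
    (hgc.integral_hasStrictDerivAt 0 s).hasDerivAt
  have hint : ∫ s in (0 : ℝ)..1, f' s / f s = G 1 := by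
    refine intervalIntegral.integral_congr fun s hs => ?_
    rw [uIcc_of_le zero_le_one] at hs
    simp only [hg, hci s hs]
  have hd : ∀ s, HasDerivAt (fun s => f s * Complex.exp (-G s))
      (f' s * Complex.exp (-G s) + f s * (Complex.exp (-G s) * -g s)) s := fun s =>
    (hf s).mul (hGd s).neg.cexp
  have hconst := constant_of_has_deriv_right_zero (a := (0 : ℝ)) (b := 1)
    (f := fun s => f s * Complex.exp (-G s))
    (fun s _ => (hd s).continuousAt.continuousWithinAt) (fun s hs => by
      have hs' : s ∈ Icc (0 : ℝ) 1 := ⟨hs.1, hs.2.le⟩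
      refine ((hd s).congr_deriv ?_).hasDerivWithinAt
      have h1 := hne s hs'
      simp only [hg, hci s hs']
      field_simp
      ring) 1 ⟨zero_le_one, le_rfl⟩
  have hG0 : G 0 = 0 := intervalIntegral.integral_same
  simp only [hG0, neg_zero, Complex.exp_zero, mul_one] at hconst
  rw [hint, ← hconst, Complex.exp_neg]
  have h1 := hne 1 ⟨zero_le_one, le_rfl⟩
  have h2 := Complex.exp_ne_zero (G 1)
  field_simp

theorem hasDerivAt_derivative_div (Q : ℂ[X]) {x : ℂ} (hx : Q.eval x ≠ 0) :
    HasDerivAt (fun y => Q.derivative.eval y / Q.eval y)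
      ((Q.derivative.derivative.eval x * Q.eval x -
        Q.derivative.eval x * Q.derivative.eval x) / Q.eval x ^ 2) x :=
  (Q.derivative.hasDerivAt x).div (Q.hasDerivAt x) hx

/-- For a polynomial `k` the form `d/dx (x d/dx ln k)(ȳz) dȳ dz` has the mixed primitive
`ln k(ȳz)`: the membrane integral is a cross-ratio of values of `k`. -/
theorem exp_membrane (Q : ℂ[X]) {u v : ℝ → ℂ} (hu : ContDiff ℝ 1 u) (hv : ContDiff ℝ 1 v)
    (hne : ∀ s ∈ Icc (0 : ℝ) 1, ∀ t ∈ Icc (0 : ℝ) 1, Q.eval (u s * v t) ≠ 0) :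
    Complex.exp (-∫ s in (0 : ℝ)..1, ∫ t in (0 : ℝ)..1,
        deriv (fun y => y * logDeriv (fun x => Q.eval x) y) (u s * v t) * deriv u s * deriv v t) =
      Q.eval (u 0 * v 1) * Q.eval (u 1 * v 0) /
        (Q.eval (u 0 * v 0) * Q.eval (u 1 * v 1)) := by
  have hlog : logDeriv (fun x => Q.eval x) = fun y => Q.derivative.eval y / Q.eval y := by
    funext y
    rw [logDeriv_apply, Polynomial.deriv]
  have hud : ∀ s, HasDerivAt u (deriv u s) s := fun s =>
    (hu.differentiable one_ne_zero s).hasDerivAt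
  have hvd : ∀ t, HasDerivAt v (deriv v t) t := fun t =>
    (hv.differentiable one_ne_zero t).hasDerivAt
  have huc : Continuous (deriv u) := hu.continuous_deriv le_rfl
  have hvc : Continuous (deriv v) := hv.continuous_deriv le_rfl
  have hu0 := hu.continuous
  have hv0 := hv.continuous
  set D : ℂ → ℂ := fun x => (Q.derivative.derivative.eval x * Q.eval x -
        Q.derivative.eval x * Q.derivative.eval x) / Q.eval x ^ 2 with hD
  set L : ℂ → ℂ := fun x => Q.derivative.eval x / Q.eval x with hL
  have hLD : ∀ x, Q.eval x ≠ 0 → HasDerivAt L (D x) x := fun x hx =>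
    hasDerivAt_derivative_div Q hx
  have hder : ∀ x, Q.eval x ≠ 0 → deriv (fun y => y * L y) x = L x + x * D x := fun x hx => by
    have h := ((hasDerivAt_id' x).mul (hLD x hx)).deriv
    rw [one_mul] at h
    exact h
  have h1 : (1 : ℝ) ∈ Icc (0 : ℝ) 1 := ⟨zero_le_one, le_rfl⟩
  have h0 : (0 : ℝ) ∈ Icc (0 : ℝ) 1 := ⟨le_rfl, zero_le_one⟩
  have hinner : ∀ s ∈ Icc (0 : ℝ) 1, ∫ t in (0 : ℝ)..1,
      deriv (fun y => y * L y) (u s * v t) * deriv u s * deriv v t =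
      Q.derivative.eval (u s * v 1) * (deriv u s * v 1) / Q.eval (u s * v 1) -
      Q.derivative.eval (u s * v 0) * (deriv u s * v 0) / Q.eval (u s * v 0) := by
    intro s hs
    have hcong : ∫ t in (0 : ℝ)..1, deriv (fun y => y * L y) (u s * v t) * deriv u s * deriv v t =
        ∫ t in (0 : ℝ)..1, deriv u s * (deriv v t * L (u s * v t) +
          v t * (D (u s * v t) * (u s * deriv v t))) := by
      refine intervalIntegral.integral_congr fun t ht => ?_
      rw [uIcc_of_le zero_le_one] at ht
      simp only [hder _ (hne s hs t ht)]
      ring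
    have hcont : ContinuousOn (fun t => deriv u s * (deriv v t * L (u s * v t) +
          v t * (D (u s * v t) * (u s * deriv v t)))) (uIcc 0 1) := by
      rw [uIcc_of_le zero_le_one]
      have e1 : ContinuousOn (fun t => L (u s * v t)) (Icc 0 1) :=
        ContinuousOn.div (by fun_prop) (by fun_prop) fun t ht => hne s hs t ht
      have e2 : ContinuousOn (fun t => D (u s * v t)) (Icc 0 1) :=
        ContinuousOn.div (by fun_prop) (by fun_prop) fun t ht => pow_ne_zero 2 (hne s hs t ht)
      exact continuousOn_const.mul ((hvc.continuousOn.mul e1).add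
        (hv0.continuousOn.mul (e2.mul (continuousOn_const.mul hvc.continuousOn))))
    rw [hcong, intervalIntegral.integral_eq_sub_of_hasDerivAt
      (f := fun t => deriv u s * (v t * L (u s * v t))) (fun t ht => ?_)
      hcont.intervalIntegrable]
    · simp only [hL]
      ring
    · rw [uIcc_of_le zero_le_one] at ht
      have e : HasDerivAt (fun t => L (u s * v t)) (D (u s * v t) * (u s * deriv v t)) t :=
        (hLD _ (hne s hs t ht)).comp_of_eq t ((hvd t).const_mul (u s)) rfl
      exact ((hvd t).mul e).const_mul (deriv u s)
  have hfd : ∀ (c : ℂ) (s : ℝ), HasDerivAt (fun s => Q.eval (u s * c))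
      (Q.derivative.eval (u s * c) * (deriv u s * c)) s := fun c s =>
    (Q.hasDerivAt (u s * c)).comp_of_eq s ((hud s).mul_const c) rfl
  have hfc : ∀ c : ℂ, Continuous fun s => Q.derivative.eval (u s * c) * (deriv u s * c) :=
    fun c => by fun_prop
  have hii : ∀ t ∈ Icc (0 : ℝ) 1, IntervalIntegrable (fun s =>
      Q.derivative.eval (u s * v t) * (deriv u s * v t) / Q.eval (u s * v t)) volume 0 1 :=
    fun t ht => by
      refine ContinuousOn.intervalIntegrable ?_
      rw [uIcc_of_le zero_le_one]
      exact ContinuousOn.div (by fun_prop) (by fun_prop) fun s hs => hne s hs t ht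
  have houter : ∫ s in (0 : ℝ)..1, ∫ t in (0 : ℝ)..1,
        deriv (fun y => y * L y) (u s * v t) * deriv u s * deriv v t =
      (∫ s in (0 : ℝ)..1,
        Q.derivative.eval (u s * v 1) * (deriv u s * v 1) / Q.eval (u s * v 1)) -
      ∫ s in (0 : ℝ)..1,
        Q.derivative.eval (u s * v 0) * (deriv u s * v 0) / Q.eval (u s * v 0) := by
    rw [← intervalIntegral.integral_sub (hii 1 h1) (hii 0 h0)]
    refine intervalIntegral.integral_congr fun s hs => ?_
    rw [uIcc_of_le zero_le_one] at hs
    exact hinner s hs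
  rw [hlog, houter, neg_sub, Complex.exp_sub,
    exp_integral_logDeriv (hfd (v 0)) (hfc (v 0)) fun s hs => hne s hs 0 h0,
    exp_integral_logDeriv (hfd (v 1)) (hfc (v 1)) fun s hs => hne s hs 1 h1]
  have n1 := hne 0 h0 0 h0
  have n2 := hne 0 h0 1 h1
  have n3 := hne 1 h1 1 h1
  field_simp

theorem Ksharp_conj (ħ : ℝ) (l m r q p : ℕ) (a b : ℂ) :
    Ksharp ħ l m r q p b a = conj (Ksharp ħ l m r q p a b) := by
  simp only [Ksharp, kfun, map_sum, map_mul, map_pow, Complex.conj_ofReal, Complex.conj_conj]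
  simp only [mul_comm]

/-- The probability function as the exponential of the symplectic area of a membrane. -/
theorem prob_eq_exp_membrane {ħ : ℝ} (hħ : 0 < ħ) (l m r q p : ℕ) {a b : ℂ} {u v : ℝ → ℂ}
    (hu : ContDiff ℝ 1 u) (hv : ContDiff ℝ 1 v) (hu0 : u 0 = conj a) (hu1 : u 1 = conj b)
    (hv0 : v 0 = a) (hv1 : v 1 = b)
    (hne : ∀ s ∈ Icc (0 : ℝ) 1, ∀ t ∈ Icc (0 : ℝ) 1, kfun ħ l m r q p (u s * v t) ≠ 0) :
    (prob ħ l m r q p a b : ℂ) = Complex.exp (Complex.I / ħ *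
      ∫ s in (0 : ℝ)..1, ∫ t in (0 : ℝ)..1,
        Complex.I * qmetric ħ l m r q p (u s * v t) * deriv u s * deriv v t) := by
  have hk : kfun ħ l m r q p = fun x => (kerPol ħ l m r q p 1).eval x := by
    funext x
    simp only [kfun, kerPol, Polynomial.eval_finsetSum, Polynomial.eval_monomial, one_pow, mul_one]
  have h2 : (ħ : ℂ) ≠ 0 := by exact_mod_cast hħ.ne'
  have hexp : Complex.I / ħ * ∫ s in (0 : ℝ)..1, ∫ t in (0 : ℝ)..1,
        Complex.I * qmetric ħ l m r q p (u s * v t) * deriv u s * deriv v t =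
      -∫ s in (0 : ℝ)..1, ∫ t in (0 : ℝ)..1, deriv (fun y => y * logDeriv
        (fun x => (kerPol ħ l m r q p 1).eval x) y) (u s * v t) * deriv u s * deriv v t := by
    have e : ∀ s t : ℝ, Complex.I * qmetric ħ l m r q p (u s * v t) * deriv u s * deriv v t =
        (Complex.I * ħ) * (deriv (fun y => y * logDeriv
          (fun x => (kerPol ħ l m r q p 1).eval x) y) (u s * v t) * deriv u s * deriv v t) :=
      fun s t => by rw [qmetric, hk]; ring
    simp only [e, intervalIntegral.integral_const_mul]
    rw [← mul_assoc, ← neg_one_mul]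
    congr 1
    rw [div_mul_eq_mul_div, ← mul_assoc, Complex.I_mul_I, mul_div_assoc, div_self h2, mul_one]
  rw [hk] at hne
  rw [hexp, exp_membrane _ hu hv hne, hu0, hu1, hv0, hv1]
  have hK : ∀ a b : ℂ, (kerPol ħ l m r q p 1).eval (conj a * b) = Ksharp ħ l m r q p a b :=
    fun a b => by rw [Ksharp, hk]
  rw [hK, hK, hK, hK, Ksharp_self, Ksharp_self, Ksharp_conj ħ l m r q p a b, Complex.mul_conj',
    prob]
  push_cast
  rfl

end Resonance

theorem mainTheorem3 (ħ ω₁ ω₂ : ℝ) (hħ : 0 < ħ) (hω₁ : 0 < ω₁) (hω₂ : 0 < ω₂)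
    (l m : ℕ) (hl : 0 < l) (hm : 0 < m) (hlm : Nat.Coprime l m) :
    -- `A₊` and `A₋` are conjugate to each other
    (∀ f g : Sch, inner ℂ (toL2 (opA ħ ω₁ ω₂ l m .minus f)) (toL2 g) =
      inner ℂ (toL2 f) (toL2 (opA ħ ω₁ ω₂ l m .plus g))) ∧
    -- both realizations are representations of the resonance algebra
    (∃! π : ResAlg ħ l m →ₐ[ℂ] Module.End ℂ Sch, ∀ g, π (gen ħ l m g) = opA ħ ω₁ ω₂ l m g) ∧
    (∀ (r : ℕ) (q : Fin l) (p : Fin m), ∃! τ : ResAlg ħ l m →ₐ[ℂ] Module.End ℂ ℂ[X],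
      ∀ g, τ (gen ħ l m g) = opPol ħ l m r q p g) ∧
    -- vacuum vectors exist
    (∀ (r : ℕ) (q : Fin l) (p : Fin m), ∃ P0 : Sch, IsVacuum ħ ω₁ ω₂ l m r q p P0) ∧
    ∀ P0 : ℕ → Fin l → Fin m → Sch,
      (∀ (r : ℕ) (q : Fin l) (p : Fin m), IsVacuum ħ ω₁ ω₂ l m r q p (P0 r q p)) →
      -- (a) scalar products of coherent states
      (∀ (r : ℕ) (q : Fin l) (p : Fin m) (z w : ℂ),
        ‖toL2 (coh ħ ω₁ ω₂ l m r q (P0 r q p) z)‖ ^ 2 = Kern ħ l m r q p z ∧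
        inner ℂ (toL2 (coh ħ ω₁ ω₂ l m r q (P0 r q p) w))
          (toL2 (coh ħ ω₁ ω₂ l m r q (P0 r q p) z)) = Ksharp ħ l m r q p w z) ∧
      -- (b) resolution of unity
      (∀ (r : ℕ) (q : Fin l) (p : Fin m),
        Integrable (fun z => cohProj ħ ω₁ ω₂ l m r q (P0 r q p) z) (dm ħ l m r q p) ∧
        ((1 / (2 * Real.pi * ħ) : ℝ) : ℂ) •
            ∫ z, cohProj ħ ω₁ ω₂ l m r q (P0 r q p) z ∂(dm ħ l m r q p) =
          (Lsub ħ ω₁ ω₂ l m r (P0 r q p)).starProjection ∧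
        Tendsto (fun z => cohProj ħ ω₁ ω₂ l m r q (P0 r q p) z) (cocompact ℂ)
          (𝓝 (cohProjInf ħ ω₁ ω₂ l m r (P0 r q p)))) ∧
      -- (c) decomposition into irreducible subspaces
      (IsHilbertSum ℂ
          (fun i : ℕ × Fin l × Fin m => Lsub ħ ω₁ ω₂ l m i.1 (P0 i.1 i.2.1 i.2.2))
          (fun i => (Lsub ħ ω₁ ω₂ l m i.1 (P0 i.1 i.2.1 i.2.2)).subtypeₗᵢ) ∧
        ∀ (r : ℕ) (q : Fin l) (p : Fin m), Lsub ħ ω₁ ω₂ l m r (P0 r q p) ≠ ⊥ ∧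
          (∀ g, ∀ ψ ∈ Lsub ħ ω₁ ω₂ l m r (P0 r q p),
            opL2 (opA ħ ω₁ ω₂ l m g) ψ ∈ Lsub ħ ω₁ ω₂ l m r (P0 r q p)) ∧
          ∀ W : Submodule ℂ L2, W ≤ Lsub ħ ω₁ ω₂ l m r (P0 r q p) →
            (∀ g, ∀ ψ ∈ W, opL2 (opA ħ ω₁ ω₂ l m g) ψ ∈ W) →
            W = ⊥ ∨ W = Lsub ħ ω₁ ω₂ l m r (P0 r q p)) ∧
      ∀ (r : ℕ) (q : Fin l) (p : Fin m),
        ∀ π : ResAlg ħ l m →ₐ[ℂ] Module.End ℂ Sch,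
        (∀ g, π (gen ħ l m g) = opA ħ ω₁ ω₂ l m g) →
        ∀ τ : ResAlg ħ l m →ₐ[ℂ] Module.End ℂ ℂ[X],
        (∀ g, τ (gen ħ l m g) = opPol ħ l m r q p g) →
        -- (d) the coherent transform and its inverse
        ((∀ ψ ∈ Lsub ħ ω₁ ω₂ l m r (P0 r q p),
            cohTrans ħ ω₁ ω₂ l m r q (P0 r q p) ψ ∈ Pol r ∧
            invTrans ħ ω₁ ω₂ l m r q p (P0 r q p)
              (cohTrans ħ ω₁ ω₂ l m r q (P0 r q p) ψ) = ψ) ∧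
          (∀ phi ∈ Pol r,
            Integrable (invIntegrand ħ ω₁ ω₂ l m r q p (P0 r q p) phi) (dm ħ l m r q p) ∧
            invTrans ħ ω₁ ω₂ l m r q p (P0 r q p) phi ∈ Lsub ħ ω₁ ω₂ l m r (P0 r q p) ∧
            cohTrans ħ ω₁ ω₂ l m r q (P0 r q p)
              (invTrans ħ ω₁ ω₂ l m r q p (P0 r q p) phi) = phi) ∧
          (∀ F, ∀ ψ ∈ Lsub ħ ω₁ ω₂ l m r (P0 r q p),
            opL2 (π F) ψ ∈ Lsub ħ ω₁ ω₂ l m r (P0 r q p) ∧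
            cohTrans ħ ω₁ ω₂ l m r q (P0 r q p) (opL2 (π F) ψ) =
              τ F (cohTrans ħ ω₁ ω₂ l m r q (P0 r q p) ψ)) ∧
          (∀ F, ∀ phi ∈ Pol r, τ F phi ∈ Pol r ∧
            invTrans ħ ω₁ ω₂ l m r q p (P0 r q p) (τ F phi) =
              opL2 (π F) (invTrans ħ ω₁ ω₂ l m r q p (P0 r q p) phi))) ∧
        -- (e) the Wick symbol is the trace
        (∀ F, (∀ z : ℂ, HasTrace
              (fun ψ => opL2 (π F) (cohProj ħ ω₁ ω₂ l m r q (P0 r q p) z ψ))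
              (wick ħ l m r q p
                (transOp ħ ω₁ ω₂ l m r q p (P0 r q p) (opL2 (π F))) z)) ∧
          ∃ t : ℂ, Tendsto
              (wick ħ l m r q p (transOp ħ ω₁ ω₂ l m r q p (P0 r q p) (opL2 (π F))))
              (cocompact ℂ) (𝓝 t) ∧
            HasTrace (fun ψ => opL2 (π F) (cohProjInf ħ ω₁ ω₂ l m r (P0 r q p) ψ)) t) ∧
        -- (e) `𝐅 = F(𝐀)` and `𝐟 = F(𝐚)` for the ordered polynomials `F` representing `𝐅`
        (∀ F, (∃ P : MvPolynomial Gen ℂ, F = ordEval (gen ħ l m) P) ∧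
          ∀ P : MvPolynomial Gen ℂ, F = ordEval (gen ħ l m) P →
            π F = ordEval (opA ħ ω₁ ω₂ l m) P ∧
            ∀ phi ∈ Pol r, transOp ħ ω₁ ω₂ l m r q p (P0 r q p) (opL2 (π F)) phi =
              ordEval (opPol ħ l m r q p) P phi) ∧
        -- (e) the operator `ρ₊(A)` is invertible where its inverse is used
        (Function.Injective (rhoPlusA ħ ω₁ ω₂ l m) ∧
          ∀ ψ : Sch, toL2 ψ ∈ Lsub ħ ω₁ ω₂ l m r (P0 r q p) →
            ∃ χ : Sch, toL2 χ ∈ Lsub ħ ω₁ ω₂ l m r (P0 r q p) ∧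
              rhoPlusA ħ ω₁ ω₂ l m χ = ψ) ∧
        -- (e) reconstruction of the operators from the symbol
        (∀ F,
          (∃ c, HasExpansion
            (wick ħ l m r q p (transOp ħ ω₁ ω₂ l m r q p (P0 r q p) (opL2 (π F)))) c) ∧
          ∀ c, HasExpansion
              (wick ħ l m r q p (transOp ħ ω₁ ω₂ l m r q p (P0 r q p) (opL2 (π F)))) c →
            (∀ ψ : Sch, toL2 ψ ∈ Lsub ħ ω₁ ω₂ l m r (P0 r q p) →
              HasSum (fun i : ℕ × ℕ => c i.1 i.2 •
                toL2 ((zStarOp ħ ω₁ ω₂ l m)^[i.1] ((zOp ħ ω₁ ω₂ l m)^[i.2] ψ)))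
                (opL2 (π F) (toL2 ψ))) ∧
            ∀ phi ∈ Pol r, ∀ᶠ z in 𝓝 (0 : ℂ),
              HasSum (fun i : ℕ × ℕ => c i.1 i.2 * conj z ^ i.1 *
                ((mulVarAdj ħ l m r q p)^[i.2] phi).eval (conj z))
                ((transOp ħ ω₁ ω₂ l m r q p (P0 r q p) (opL2 (π F)) phi).eval (conj z))) ∧
        -- (e) the Wick symbol of the coherent projection is the probability function
        (∀ a b : ℂ,
          HasTrace (fun ψ => cohProj ħ ω₁ ω₂ l m r q (P0 r q p) a
            (cohProj ħ ω₁ ω₂ l m r q (P0 r q p) b ψ)) (prob ħ l m r q p a b) ∧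
          wick ħ l m r q p (transOp ħ ω₁ ω₂ l m r q p (P0 r q p)
            (cohProj ħ ω₁ ω₂ l m r q (P0 r q p) a)) b = prob ħ l m r q p a b ∧
          ∀ u v : ℝ → ℂ, ContDiff ℝ 1 u → ContDiff ℝ 1 v →
            u 0 = conj a → u 1 = conj b → v 0 = a → v 1 = b →
            (∀ s ∈ Icc (0 : ℝ) 1, ∀ t ∈ Icc (0 : ℝ) 1, kfun ħ l m r q p (u s * v t) ≠ 0) →
            (prob ħ l m r q p a b : ℂ) = Complex.exp (Complex.I / ħ *
              ∫ s in (0 : ℝ)..1, ∫ t in (0 : ℝ)..1,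
                Complex.I * qmetric ħ l m r q p (u s * v t) * deriv u s * deriv v t)) := by
  have hinv : ∀ (r : ℕ) (q : Fin l) (p : Fin m) (P0 : Sch), IsVacuum ħ ω₁ ω₂ l m r q p P0 →
      ∀ π : ResAlg ħ l m →ₐ[ℂ] Module.End ℂ Sch, (∀ g, π (gen ħ l m g) = opA ħ ω₁ ω₂ l m g) →
      ∀ F, ∀ ψ : Sch, toL2 ψ ∈ Lsub ħ ω₁ ω₂ l m r P0 →
        toL2 (π F ψ) ∈ Lsub ħ ω₁ ω₂ l m r P0 := by
    intro r q p P0 hv π hπ F ψ hψ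
    obtain ⟨τ, hτ, -⟩ := (isResRep_opPol (ħ := ħ) (m := m) (r := r) (p := p) q.2).existsUnique
    rw [← opL2_toL2]
    exact (cohTrans_intertwines hω₁ hω₂ hv hħ hl p.2 hπ hτ F hψ).1
  refine ⟨isAdj_minus ħ ω₁ ω₂ l m, (isResRep_opA hω₁ hω₂ l m).existsUnique,
    fun r q p => (isResRep_opPol q.2).existsUnique,
    fun r q p => exists_isVacuum hħ hω₁ hω₂ m r p q.2, fun P0 hv => ⟨?_, ?_, ⟨?_, ?_⟩, ?_⟩⟩
  · exact fun r q p z w => ⟨norm_sq_coh hω₁ hω₂ (hv r q p) hħ hl z,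
      inner_coh hω₁ hω₂ (hv r q p) hħ hl w z⟩
  · intro r q p
    obtain ⟨h1, h2⟩ := resolution_of_unity hω₁ hω₂ (hv r q p) hħ hl hm
    exact ⟨h1, h2, tendsto_cohProj hω₁ hω₂ (hv r q p) hħ⟩
  · exact isHilbertSum_Lsub hω₁ hω₂ hħ hl hm P0 hv
  · exact fun r q p => ⟨Lsub_ne_bot (hv r q p),
      fun g ψ hψ => opL2_mem_Lsub hω₁ hω₂ (hv r q p) p.2 g hψ,
      fun W hWle hW => Lsub_irreducible hω₁ hω₂ (hv r q p) hħ hWle hW⟩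
  intro r q p π hπ τ hτ
  have hV := hv r q p
  refine ⟨⟨?_, ?_, ?_, ?_⟩, ?_, ?_, ⟨?_, ?_⟩, ?_, ?_⟩
  · exact fun ψ hψ => ⟨cohTrans_mem_Pol ψ, invTrans_cohTrans hω₁ hω₂ hV hħ hl hm hψ⟩
  · exact fun phi hphi => ⟨(integrable_invIntegrand hħ hl hm hphi).1,
      invTrans_mem_Lsub hħ hl hm hphi, cohTrans_invTrans hω₁ hω₂ hV hħ hl hm hphi⟩
  · exact fun F ψ hψ => cohTrans_intertwines hω₁ hω₂ hV hħ hl p.2 hπ hτ F hψ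
  · exact fun F phi hphi => invTrans_intertwines hω₁ hω₂ hV hħ hl hm p.2 hπ hτ F hphi
  · exact fun F => ⟨fun z => hasTrace_wick hω₁ hω₂ hV hħ hl hm (π F) z,
      tendsto_wick hω₁ hω₂ hV hħ hl hm (π F)⟩
  · exact fun F => ⟨exists_ordEval F,
      fun P hF => transOp_ordEval hω₁ hω₂ hV hħ hl hm p.2 hπ hτ hF⟩
  · exact rhoPlusA_injective hħ ω₁ ω₂ l m
  · exact fun ψ hψ => exists_rhoPlusA_eq hω₁ hω₂ hV hħ hψ
  · exact fun F => ⟨exists_hasExpansion_wick hω₁ hω₂ hV hħ hl hm (π F), fun c hc =>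
      ⟨fun ψ hψ => hasSum_zStar_z hω₁ hω₂ hV hħ hl hm p.2 (hinv r q p _ hV π hπ F) hc hψ,
        fun phi hphi => hasSum_mulVar_mulVarAdj hω₁ hω₂ hV hħ hl hm hc hphi⟩⟩
  · intro a b
    refine ⟨hasTrace_cohProj_cohProj hω₁ hω₂ hV hħ hl a b, ?_, ?_⟩
    · rw [wick_transOp hω₁ hω₂ hV hħ hl hm, inner_cohProj hω₁ hω₂ hV hħ hl]
    · intro u v hu hv' hu0 hu1 hv0 hv1 hne
      exact prob_eq_exp_membrane hħ l m r q p hu hv' hu0 hu1 hv0 hv1 hne
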